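/- **Notation.** For $q\in[0,1]$ let $G(n,q)$ be the Erdős–Rényi random graph on $[n]$. For $k\le n$, let $G(n,k,p,q)$ be the random graph obtained by choosing a subset $S\subseteq[n]$ of size exactly $k$ uniformly at random and joining, independently, every two nodes of $S$ with probability $p$ and every other pair with probability $q$; let $G(n,k,p)$ be a sample of $G(n,p)$ in which a clique on a uniformly random $k$-subset is planted. $\textsc{PC}_D(n,k,p)$ is the problem of testing $H_0: G(n,p)$ against $H_1: G(n,k,p)$, and $\textsc{PDS}_D(n,k,p,q)$ that of testing $H_0: G(n,q)$ against $H_1: G(n,k,p,q)$. Let $\mathcal G_m$ be the set of simple graphs on $[m]$. A *sequence of randomized polynomial-time tests* $\phi_n:\mathcal G_{m_n}\to\{0,1\}$ is a sequence of programs (the $n$-th program may depend on $n$, hence on all parameters of the $n$-th problem) of a random access machine with coin flips, addition, truncated subtraction and unit-cost steps, such that the length of the $n$-th program and its number of steps, on every graph in $\mathcal G_{m_n}$ and for all coin outcomes, are at most $P(m_n)$ for one polynomial $P$. The Type I$+$II error of a test $\phi$ is $\mathbb P_{H_0}[\phi(G)=1]+\mathbb P_{H_1}[\phi(G)=0]$,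 and the asymptotic Type I$+$II error of a sequence of tests on a sequence of problems is the $\limsup$ of these errors. The *PC conjecture at density $p$* states: for every sequence of randomized polynomial-time algorithms $A_n:\mathcal G_n\to\{0,1\}$ and all positive integers $k_n$ with $\limsup_n\log_n k_n<\frac12$, the Type I$+$II errors of $A_n$ on $\textsc{PC}_D(n,k_n,p)$ have $\liminf_n\ge 1$. A sequence $(N_n,K_n,p_n,q_n)$ with $N_n\to\infty$, integers $1\le K_n\le N_n$ and $0<q_n<p_n\le1$ is *in the regime $(\alpha,\gamma,\beta)$* (that is, $q=\tilde\Theta(N^{-\alpha})$, $p-q=\tilde\Theta(N^{-\gamma})$, $K=\tilde\Theta(N^{\beta})$) if $$\lim_{n\to\infty}\frac{\log q_n^{-1}}{\log N_n}=\alpha,\qquad \lim_{n\to\infty}\frac{\log (p_n-q_n)^{-1}}{\log N_n}=\gamma,\qquad \lim_{n\to\infty}\frac{\log K_n}{\log N_n}=\beta .$$ **Theorem.** Let $\alpha,\gamma\in[0,2)$ and $\beta\in(0,1)$ with $\gamma\ge\alpha$. Then $\beta^*=\frac12+\frac\gamma2-\frac\alpha4$ is the computational boundary for $\textsc{PDS}_D$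 in this regime: 1. If $\beta<\frac12+\frac\gamma2-\frac\alpha4$, there is a sequence $(N_n,K_n,p_n,q_n)$ in the regime $(\alpha,\gamma,\beta)$ such that, assuming the PC conjecture at density $1/2$, every sequence of randomized polynomial-time tests $\phi_n:\mathcal G_{N_n}\to\{0,1\}$ has asymptotic Type I$+$II error at least $1$ on the problems $\textsc{PDS}_D(N_n,K_n,p_n,q_n)$. 2. If $\beta>\frac12+\frac\gamma2-\frac\alpha4$, then for every sequence $(N_n,K_n,p_n,q_n)$ in the regime $(\alpha,\gamma,\beta)$ there is a sequence of randomized polynomial-time tests $\phi_n:\mathcal G_{N_n}\to\{0,1\}$ with asymptotic Type I$+$II error $0$ on the problems $\textsc{PDS}_D(N_n,K_n,p_n,q_n)$. -/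

import Mathlib

open Filter Topology

/-! ### Random graphs on the vertex set `Fin n`, given by their probability mass functions -/

namespace PlantedGraph

open Classical in
/-- The probability of `G` when every pair `e` of distinct vertices is joined independently with
probability `w e`. -/
noncomputable def edgeMass {n : ℕ} (w : Sym2 (Fin n) → ℝ) (G : SimpleGraph (Fin n)) : ℝ :=
  ∏ e : Sym2 (Fin n) with ¬ e.IsDiag, if e ∈ G.edgeSet then w e else 1 - w e

/-- The Erdős–Rényi distribution `G(n, q)`. -/
noncomputable def erdosRenyi (n : ℕ) (q : ℝ) (G : SimpleGraph (Fin n)) : ℝ :=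
  edgeMass (fun _ => q) G

open Classical in
/-- The planted dense subgraph distribution `G(n, k, p, q)`: a subset `S` of exactly `k` vertices is
chosen uniformly at random; independently, pairs inside `S` are joined with probability `p` and all
other pairs with probability `q`. -/
noncomputable def plantedDense (n k : ℕ) (p q : ℝ) (G : SimpleGraph (Fin n)) : ℝ :=
  (∑ S ∈ Finset.powersetCard k (Finset.univ : Finset (Fin n)),
    edgeMass (fun e => if ∀ v ∈ e, v ∈ S then p else q) G) / (n.choose k : ℝ)

/-- The graph whose edges are all pairs of distinct vertices of `S`. -/
def cliqueOn {n : ℕ} (S : Finset (Fin n)) : SimpleGraph (Fin n) where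
  Adj u v := u ≠ v ∧ u ∈ S ∧ v ∈ S
  symm := ⟨fun _ _ h => ⟨h.1.symm, h.2.2, h.2.1⟩⟩
  loopless := ⟨fun _ h => h.1 rfl⟩

open Classical in
/-- The planted clique distribution `G(n, k, p)`: a sample `H` of `G(n, p)` to which all edges inside
a uniformly random set `S` of `k` vertices are added. -/
noncomputable def plantedClique (n k : ℕ) (p : ℝ) (G : SimpleGraph (Fin n)) : ℝ :=
  (∑ S ∈ Finset.powersetCard k (Finset.univ : Finset (Fin n)),
    ∑ H : SimpleGraph (Fin n), if H ⊔ cliqueOn S = G then erdosRenyi n p H else 0) /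
      (n.choose k : ℝ)

end PlantedGraph

/-! ### Randomized algorithms: a random access machine with coin flips and unit-cost steps -/

namespace RandomizedRAM

/-- Instructions. Memory cells are indexed by natural numbers and hold natural numbers; arithmetic is
limited to addition and truncated subtraction, so that unit cost is polynomially equivalent to the
cost on a Turing machine. -/
inductive Instr where
  /-- `mem[x] := c` -/
  | const (x c : ℕ)
  /-- `mem[x] := mem[y] + mem[z]` -/
  | add (x y z : ℕ)
  /-- `mem[x] := mem[y] - mem[z]` (truncated at `0`) -/
  | sub (x y z : ℕ)
  /-- `mem[x] := mem[mem[y]]` -/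
  | load (x y : ℕ)
  /-- `mem[mem[x]] := mem[y]` -/
  | store (x y : ℕ)
  /-- `mem[x] :=` the next random bit -/
  | coin (x : ℕ)
  /-- jump to instruction number `l` if `mem[x] = 0` -/
  | jumpZero (x l : ℕ)

/-- A program is a list of instructions, numbered from `0`. -/
abbrev Program := List Instr

/-- The length of an instruction, its operands being written in binary. -/
def Instr.length : Instr → ℕ
  | .const x c => 1 + x.size + c.size
  | .add x y z => 1 + x.size + y.size + z.size
  | .sub x y z => 1 + x.size + y.size + z.size
  | .load x y => 1 + x.size + y.size
  | .store x y => 1 + x.size + y.size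
  | .coin x => 1 + x.size
  | .jumpZero x l => 1 + x.size + l.size

/-- The length of a program. -/
def Program.size (P : Program) : ℕ := (P.map Instr.length).sum

/-- A configuration: program counter, memory contents, and the random bits not yet used. -/
structure Config where
  pc : ℕ
  mem : ℕ → ℕ
  coins : List Bool

/-- The effect of one instruction. -/
def Instr.exec (i : Instr) (s : Config) : Config :=
  match i with
  | .const x c => ⟨s.pc + 1, Function.update s.mem x c, s.coins⟩
  | .add x y z => ⟨s.pc + 1, Function.update s.mem x (s.mem y + s.mem z), s.coins⟩
  | .sub x y z => ⟨s.pc + 1, Function.update s.mem x (s.mem y - s.mem z), s.coins⟩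
  | .load x y => ⟨s.pc + 1, Function.update s.mem x (s.mem (s.mem y)), s.coins⟩
  | .store x y => ⟨s.pc + 1, Function.update s.mem (s.mem x) (s.mem y), s.coins⟩
  | .coin x => ⟨s.pc + 1, Function.update s.mem x (s.coins.headD false).toNat, s.coins.tail⟩
  | .jumpZero x l => ⟨if s.mem x = 0 then l else s.pc + 1, s.mem, s.coins⟩

/-- One step. The machine has halted once the program counter is past the end of the program. -/
def step (P : Program) (s : Config) : Config :=
  match P[s.pc]? with
  | none => s
  | some i => i.exec s

/-- The configuration after `t` steps. -/
def run (P : Program) (t : ℕ) (s : Config) : Config := (step P)^[t] s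

open Classical in
/-- The initial configuration on a graph with vertex set `Fin n`: cell `0` holds `n`, cell
`2 * (i * n + j) + 1` holds the entry `(i, j)` of the adjacency matrix, all other cells hold `0`. -/
noncomputable def initial {n : ℕ} (G : SimpleGraph (Fin n)) (coins : List Bool) : Config where
  pc := 0
  mem := fun a =>
    if a = 0 then n
    else if ∃ i j : Fin n, a = 2 * ((i : ℕ) * n + j) + 1 ∧ G.Adj i j then 1 else 0
  coins := coins

/-- A randomized algorithm mapping graphs on `Fin n` to `{0, 1}`: a program together with a bound
`time` on its running time, over all graphs and all values of the random bits. As it flips at most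
one coin per step, `time` random bits suffice. -/
structure Test (n : ℕ) where
  program : Program
  time : ℕ
  halts : ∀ (G : SimpleGraph (Fin n)) (ω : Fin time → Bool),
    program.length ≤ (run program time (initial G (List.ofFn ω))).pc

namespace Test

variable {n : ℕ}

/-- The output on the graph `G` with random bits `ω`: it is `1` (`true`) if cell `0` is nonzero when
the machine halts, and `0` (`false`) otherwise. -/
noncomputable def output (A : Test n) (G : SimpleGraph (Fin n)) (ω : Fin A.time → Bool) : Bool :=
  (run A.program A.time (initial G (List.ofFn ω))).mem 0 != 0

/-- The probability, over independent fair random bits, that the output on `G` is `b`. -/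
noncomputable def prob (A : Test n) (b : Bool) (G : SimpleGraph (Fin n)) : ℝ :=
  (Finset.card {ω : Fin A.time → Bool | A.output G ω = b} : ℝ) / 2 ^ A.time

/-- The Type I+II error `ℙ_{H₀}[A(G) = 1] + ℙ_{H₁}[A(G) = 0]` of `A`, where the hypotheses are given
by their probability mass functions. -/
noncomputable def error (A : Test n) (H₀ H₁ : SimpleGraph (Fin n) → ℝ) : ℝ :=
  ∑ G, H₀ G * A.prob true G + ∑ G, H₁ G * A.prob false G

end Test

/-- A sequence of randomized algorithms, the `n`-th one on graphs with `m n` vertices, is polynomial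
time if running times and program lengths are bounded by a polynomial in the number of vertices. -/
def PolynomialTime {m : ℕ → ℕ} (A : ∀ n, Test (m n)) : Prop :=
  ∃ P : Polynomial ℕ, ∀ n, (A n).time ≤ P.eval (m n) ∧ (A n).program.size ≤ P.eval (m n)

end RandomizedRAM

/-! ### The detection problems -/

open PlantedGraph RandomizedRAM

/-- The planted clique conjecture at edge density `p`. -/
def PCConjecture (p : ℝ) : Prop :=
  ∀ (A : ∀ n, Test n) (k : ℕ → ℕ), PolynomialTime A → (∀ n, 0 < k n) →
    limsup (fun n : ℕ => ((Real.logb n (k n) : ℝ) : EReal)) atTop < ((1 / 2 : ℝ) : EReal) →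
    1 ≤ liminf (fun n => (A n).error (erdosRenyi n p) (plantedClique n (k n) p)) atTop

/-- The asymptotic Type I+II error of the tests `φ n` on the problems
`PDS_D(N n, K n, p n, q n)`. -/
noncomputable def asymptoticErrorPDS {N : ℕ → ℕ} (φ : ∀ n, Test (N n)) (K : ℕ → ℕ) (p q : ℕ → ℝ) :
    ℝ :=
  limsup (fun n => (φ n).error (erdosRenyi (N n) (q n)) (plantedDense (N n) (K n) (p n) (q n))) atTop

/-- The parameter regime `q = Θ̃(N^{-α})`, `p - q = Θ̃(N^{-γ})`, `K = Θ̃(N^β)` as `N → ∞`, where `p > q`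
are edge probabilities and `K` is a size of a nonempty set of vertices. -/
structure PDSRegime (α γ β : ℝ) (N K : ℕ → ℕ) (p q : ℕ → ℝ) : Prop where
  tendsto_N : Tendsto N atTop atTop
  K_pos : ∀ n, 0 < K n
  K_le : ∀ n, K n ≤ N n
  q_pos : ∀ n, 0 < q n
  q_lt_p : ∀ n, q n < p n
  p_le_one : ∀ n, p n ≤ 1
  log_q : Tendsto (fun n => Real.log (q n)⁻¹ / Real.log (N n)) atTop (𝓝 α)
  log_p_sub_q : Tendsto (fun n => Real.log (p n - q n)⁻¹ / Real.log (N n)) atTop (𝓝 γ)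
  log_K : Tendsto (fun n => Real.log (K n) / Real.log (N n)) atTop (𝓝 β)

/-! Above the boundary, counting edges suffices. The count has mean `M = C(N,2) q` under the null
and `M + Δ`, `Δ = C(K,2) (p - q)`, given any planted set, and its variance is at most its mean.
Chebyshev's inequality at the midpoint bounds the total error by `8 M / Δ ^ 2 + 4 / Δ`
(`error_edgeCountTest_le`). As a power of `N`, the first term has exponent `2 - α - (4 β - 2 γ)`,
which is negative exactly above the boundary; since `α < 2`, the second term then vanishes as well.

Below the boundary, a test for planted dense subgraphs is turned into one for planted cliques. Each
of the `n` vertices is blown up to a block of `l` vertices, so `N = n l`, `K = k l`. The bits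
between two different blocks are drawn from a law `A` or a law `B` according to the corresponding
input bit. With `Q` and `P` the product Bernoulli laws of parameters `q` and `q + d`, the pair
satisfies `A + B = 2 Q`, so fair input bits give exactly `G(N, q)` (`channelMass_half`), while `A`
is close to `P`. Such an `A` exists because `P` has tiny mass above `2 Q`: this is seen from a
likelihood ratio moment of logarithmic order once `l ^ 2 d ^ 2 / q` is below an inverse power of
`log N` (`bernoulliMass_excess_le`, `exists_channel`).

Inside a block there is no input bit, and the output has density `q` there even for planted
vertices. After a uniform relabelling this defect is invisible. The planted blocks are lowered from
`q + d` to `q` one at a time; under the relabelling, lowering one block has the same effect as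
lowering a random transversal of the `r` blocks still intact. Two random transversals share few
pairs, so a `χ²` computation bounds the `ℓ¹` cost by order `√(d ^ 2 / q) l / r`
(`sum_abs_blockMixture_insert_le`), and summing over `r` costs only a logarithm
(`sum_abs_blockMixture_le`).

Programs may depend on `n`, so relabelling and samples are fixed at a choice no worse than average.
Every output bit is then a function of a single input bit, which a straight-line program evaluates
(`exists_test_comp`, `exists_test_of_blowup`).

With `n ≈ N ^ ν` and `l ≈ N ^ (1 - ν)` the cost is small if `2 (1 - ν) ≤ 2 γ - α`, and `K ≈ N ^ β`
leaves a clique of size below `√n` if `ν < 2 (1 - β)`. Both can be met exactly because `β < 1/2 +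
γ/2 - α/4` (`exists_exponent`). -/

/-! ### Product Bernoulli masses -/

/-- The probability mass function of independent bits, bit `i` being `true` with probability
`w i`. -/
def bernoulliMass {ι : Type*} [Fintype ι] (w : ι → ℝ) (x : ι → Bool) : ℝ :=
  ∏ i, if x i then w i else 1 - w i

section BernoulliMass

variable {ι : Type*} [Fintype ι]

theorem sum_pi_prod [DecidableEq ι] {κ : ι → Type*} [∀ i, Fintype (κ i)] (g : ∀ i, κ i → ℝ) :
    ∑ x : ∀ i, κ i, ∏ i, g i (x i) = ∏ i, ∑ b, g i b := by
  rw [Finset.prod_univ_sum, Fintype.piFinset_univ]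

theorem sum_bool_prod [DecidableEq ι] (g : ι → Bool → ℝ) :
    ∑ x : ι → Bool, ∏ i, g i (x i) = ∏ i, (g i true + g i false) := by
  rw [sum_pi_prod]
  simp

theorem bernoulliMass_nonneg {w : ι → ℝ} (h0 : ∀ i, 0 ≤ w i) (h1 : ∀ i, w i ≤ 1) (x : ι → Bool) :
    0 ≤ bernoulliMass w x := by
  refine Finset.prod_nonneg fun i _ => ?_
  split_ifs
  · exact h0 i
  · linarith [h1 i]

theorem bernoulliMass_pos {w : ι → ℝ} (h0 : ∀ i, 0 < w i) (h1 : ∀ i, w i < 1) (x : ι → Bool) :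
    0 < bernoulliMass w x := by
  refine Finset.prod_pos fun i _ => ?_
  split_ifs
  · exact h0 i
  · linarith [h1 i]

theorem sum_bernoulliMass [DecidableEq ι] (w : ι → ℝ) : ∑ x, bernoulliMass w x = 1 := by
  unfold bernoulliMass
  rw [sum_bool_prod (fun i b => if b then w i else 1 - w i)]
  simp

theorem sum_bernoulliMass_mul_prod [DecidableEq ι] (w : ι → ℝ) (g : ι → Bool → ℝ) :
    ∑ x, bernoulliMass w x * ∏ i, g i (x i) =
      ∏ i, (w i * g i true + (1 - w i) * g i false) := by
  unfold bernoulliMass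
  simp_rw [← Finset.prod_mul_distrib]
  rw [sum_bool_prod (fun i b => (if b then w i else 1 - w i) * g i b)]
  simp

/-- The covariance of two centred bits. -/
theorem sum_bernoulliMass_mul_centred [DecidableEq ι] (w : ι → ℝ) (e e' : ι) :
    ∑ x, bernoulliMass w x * (((if x e then 1 else 0) - w e) * ((if x e' then 1 else 0) - w e')) =
      if e = e' then w e * (1 - w e) else 0 := by
  have key : ∀ x : ι → Bool,
      ((if x e then (1 : ℝ) else 0) - w e) * ((if x e' then 1 else 0) - w e') =
      ∏ i, ((if i = e then ((if x i then 1 else 0) - w i) else 1) *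
        (if i = e' then ((if x i then 1 else 0) - w i) else 1)) := by
    intro x
    rw [Finset.prod_mul_distrib, Finset.prod_ite_eq', Finset.prod_ite_eq']
    simp
  simp_rw [key]
  rw [sum_bernoulliMass_mul_prod w (fun i b => (if i = e then ((if b then 1 else 0) - w i) else 1) *
        (if i = e' then ((if b then 1 else 0) - w i) else 1))]
  by_cases h : e = e'
  · subst h
    rw [Finset.prod_eq_single e]
    · simp
      ring
    · intro b _ hb
      simp [hb]
    · simp
  · rw [if_neg h]
    refine Finset.prod_eq_zero (Finset.mem_univ e) ?_
    simp [h]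
    ring

theorem sum_bernoulliMass_mul_sq [DecidableEq ι] (w : ι → ℝ) :
    ∑ x, bernoulliMass w x * ((∑ e, if x e then (1 : ℝ) else 0) - ∑ e, w e) ^ 2 =
      ∑ e, w e * (1 - w e) := by
  have : ∀ x : ι → Bool, bernoulliMass w x * ((∑ e, if x e then (1 : ℝ) else 0) - ∑ e, w e) ^ 2 =
      ∑ e, ∑ e', bernoulliMass w x *
        (((if x e then 1 else 0) - w e) * ((if x e' then 1 else 0) - w e')) := by
    intro x
    rw [← Finset.sum_sub_distrib, sq, Finset.sum_mul_sum]
    simp_rw [Finset.mul_sum]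
  simp_rw [this]
  rw [Finset.sum_comm]
  refine Finset.sum_congr rfl fun e _ => ?_
  rw [Finset.sum_comm]
  simp_rw [sum_bernoulliMass_mul_centred]
  simp

/-- Chebyshev's inequality for the number of `true` bits. -/
theorem sum_bernoulliMass_tail_le [DecidableEq ι] {w : ι → ℝ} (h0 : ∀ i, 0 ≤ w i)
    (h1 : ∀ i, w i ≤ 1) {t : ℝ} (ht : 0 < t) (s : Set (ι → Bool)) [DecidablePred (· ∈ s)]
    (hs : ∀ x ∈ s, t ≤ |(∑ e, if x e then (1 : ℝ) else 0) - ∑ e, w e|) :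
    ∑ x, (if x ∈ s then bernoulliMass w x else 0) ≤ (∑ e, w e) / t ^ 2 := by
  rw [le_div_iff₀ (by positivity), Finset.sum_mul]
  calc _ ≤ ∑ x, bernoulliMass w x * ((∑ e, if x e then (1 : ℝ) else 0) - ∑ e, w e) ^ 2 := by
        refine Finset.sum_le_sum fun x _ => ?_
        have hm := bernoulliMass_nonneg h0 h1 x
        split_ifs with hx
        · refine mul_le_mul_of_nonneg_left ?_ hm
          rw [← sq_abs (_ - _)]
          exact pow_le_pow_left₀ ht.le (hs x hx) 2
        · simp only [zero_mul]
          positivity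
    _ = ∑ e, w e * (1 - w e) := sum_bernoulliMass_mul_sq w
    _ ≤ _ := Finset.sum_le_sum fun e _ => by nlinarith [h0 e, h1 e]

end BernoulliMass

/-! ### Graphs as bit vectors -/

/-- The pairs of distinct vertices. -/
abbrev VertexPair (n : ℕ) := {e : Sym2 (Fin n) // ¬ e.IsDiag}

open Classical in
/-- A graph is determined by its adjacency bits. -/
noncomputable def graphBits (n : ℕ) : SimpleGraph (Fin n) ≃ (VertexPair n → Bool) where
  toFun G e := decide (e.1 ∈ G.edgeSet)
  invFun x := SimpleGraph.fromEdgeSet {e | ∃ h : ¬ e.IsDiag, x ⟨e, h⟩ = true}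
  left_inv G := by
    ext u v
    simp only [SimpleGraph.fromEdgeSet_adj, Set.mem_ofPred_eq, decide_eq_true_eq,
      SimpleGraph.mem_edgeSet, Sym2.mk_isDiag_iff]
    exact ⟨fun h => h.1.2, fun h => ⟨⟨h.ne, h⟩, h.ne⟩⟩
  right_inv x := by
    ext ⟨e, he⟩
    simp only [SimpleGraph.edgeSet_fromEdgeSet, Set.mem_sdiff, Set.mem_ofPred_eq]
    rw [Bool.eq_iff_iff, decide_eq_true_eq]
    exact ⟨fun h => h.1.2, fun h => ⟨⟨he, h⟩, he⟩⟩

theorem graphBits_apply_eq_true {n : ℕ} (G : SimpleGraph (Fin n)) (e : VertexPair n) :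
    graphBits n G e = true ↔ e.1 ∈ G.edgeSet := by
  classical
  simp [graphBits]

theorem edgeMass_eq_bernoulliMass {n : ℕ} (w : Sym2 (Fin n) → ℝ) (G : SimpleGraph (Fin n)) :
    edgeMass w G = bernoulliMass (fun e : VertexPair n => w e) (graphBits n G) := by
  classical
  unfold edgeMass bernoulliMass
  rw [Finset.prod_subtype (p := fun e : Sym2 (Fin n) => ¬ e.IsDiag) _ (by simp)]
  refine Finset.prod_congr rfl fun e _ => ?_
  simp only [graphBits_apply_eq_true]

theorem sum_graph_eq_sum_bits {n : ℕ} (F : (VertexPair n → Bool) → ℝ) :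
    ∑ G : SimpleGraph (Fin n), F (graphBits n G) = ∑ x, F x :=
  (graphBits n).sum_comp F

theorem edgeMass_nonneg {n : ℕ} {w : Sym2 (Fin n) → ℝ} (h0 : ∀ e, 0 ≤ w e) (h1 : ∀ e, w e ≤ 1)
    (G : SimpleGraph (Fin n)) : 0 ≤ edgeMass w G := by
  rw [edgeMass_eq_bernoulliMass]
  exact bernoulliMass_nonneg (fun _ => h0 _) (fun _ => h1 _) _

theorem sum_edgeMass {n : ℕ} (w : Sym2 (Fin n) → ℝ) : ∑ G, edgeMass w G = 1 := by
  simp_rw [edgeMass_eq_bernoulliMass]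
  rw [sum_graph_eq_sum_bits, sum_bernoulliMass]

theorem erdosRenyi_nonneg {n : ℕ} {q : ℝ} (h0 : 0 ≤ q) (h1 : q ≤ 1) (G : SimpleGraph (Fin n)) :
    0 ≤ erdosRenyi n q G := edgeMass_nonneg (fun _ => h0) (fun _ => h1) G

theorem sum_erdosRenyi (n : ℕ) (q : ℝ) : ∑ G, erdosRenyi n q G = 1 := sum_edgeMass _

theorem plantedDense_nonneg {n k : ℕ} {p q : ℝ} (hp0 : 0 ≤ p) (hp1 : p ≤ 1) (hq0 : 0 ≤ q)
    (hq1 : q ≤ 1) (G : SimpleGraph (Fin n)) : 0 ≤ plantedDense n k p q G := by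
  refine div_nonneg (Finset.sum_nonneg fun S _ => edgeMass_nonneg ?_ ?_ G) (Nat.cast_nonneg _) <;>
  · intro e
    split_ifs <;> assumption

theorem sum_plantedDense {n k : ℕ} (hk : k ≤ n) (p q : ℝ) : ∑ G, plantedDense n k p q G = 1 := by
  unfold plantedDense
  rw [← Finset.sum_div, Finset.sum_comm]
  simp_rw [sum_edgeMass]
  have : (n.choose k : ℝ) ≠ 0 := by exact_mod_cast (Nat.choose_pos hk).ne'
  simp [this]

/-- Planting a clique amounts to joining the pairs inside it with probability `1`. -/
theorem plantedClique_eq_plantedDense (n k : ℕ) (p : ℝ) (G : SimpleGraph (Fin n)) :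
    plantedClique n k p G = plantedDense n k 1 p G := by
  classical
  unfold plantedClique plantedDense
  congr 1
  refine Finset.sum_congr rfl fun S _ => ?_
  have h1 : ∀ H : SimpleGraph (Fin n), H ⊔ cliqueOn S = G ↔
      ∀ e : VertexPair n, (graphBits n H e || decide (∀ v ∈ e.1, v ∈ S)) = graphBits n G e := by
    intro H
    rw [← (graphBits n).apply_eq_iff_eq, funext_iff]
    refine forall_congr' fun e => ?_
    have : graphBits n (H ⊔ cliqueOn S) e = (graphBits n H e || decide (∀ v ∈ e.1, v ∈ S)) := by
      rw [Bool.eq_iff_iff]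
      simp only [graphBits_apply_eq_true, Bool.or_eq_true, decide_eq_true_eq]
      obtain ⟨e, he⟩ := e
      induction e with
      | _ u v =>
        simp only [Sym2.mk_isDiag_iff] at he
        simp [cliqueOn, he]
    rw [this]
  have h2 : ∀ H : SimpleGraph (Fin n), (if H ⊔ cliqueOn S = G then erdosRenyi n p H else 0) =
      bernoulliMass (fun _ : VertexPair n => p) (graphBits n H) * ∏ e : VertexPair n,
        (if (graphBits n H e || decide (∀ v ∈ e.1, v ∈ S)) = graphBits n G e then 1 else 0) := by
    intro H
    rw [Finset.prod_ite_zero]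
    simp only [Finset.mem_univ, true_imp_iff, ← h1, Finset.prod_const_one]
    rw [erdosRenyi, edgeMass_eq_bernoulliMass]
    split_ifs <;> simp
  -- The condition on `H` factorises over pairs, so the sum over `H` is a product of one-bit sums: a
  -- pair inside `S` forces the bit `true`, any other pair keeps its law.
  have h3 := Finset.sum_congr rfl (fun H (_ : H ∈ (Finset.univ : Finset (SimpleGraph (Fin n)))) => h2 H)
  refine h3.trans ?_
  rw [sum_graph_eq_sum_bits (fun x => bernoulliMass (fun _ : VertexPair n => p) x *
    ∏ e : VertexPair n,
        (if (x e || decide (∀ v ∈ e.1, v ∈ S)) = graphBits n G e then 1 else 0)),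
    sum_bernoulliMass_mul_prod _ (fun e b =>
      if (b || decide (∀ v ∈ e.1, v ∈ S)) = graphBits n G e then 1 else 0),
    edgeMass_eq_bernoulliMass, bernoulliMass]
  refine Finset.prod_congr rfl fun e _ => ?_
  by_cases hS : ∀ v ∈ e.1, v ∈ S
  · simp only [decide_eq_true hS, if_pos hS, Bool.or_true]
    cases graphBits n G e <;> simp
  · simp only [hS, decide_false, Bool.or_false, if_false]
    cases graphBits n G e <;> simp

/-- The number of pairs of distinct vertices inside a set. -/
theorem card_vertexPair_filter {n : ℕ} (S : Finset (Fin n)) :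
    (Finset.univ.filter fun e : VertexPair n => ∀ v ∈ e.1, v ∈ S).card = S.card.choose 2 := by
  classical
  rw [← Sym2.card_image_offDiag, ← Finset.card_map (Function.Embedding.subtype _)]
  congr 1
  ext e
  constructor
  · intro h
    obtain ⟨⟨e, he⟩, hS, rfl⟩ := Finset.mem_map.1 h
    replace hS := (Finset.mem_filter.1 hS).2
    induction e with
    | _ u v =>
      exact Finset.mem_image.2 ⟨(u, v), Finset.mem_offDiag.2 ⟨hS u (by simp), hS v (by simp),
        fun hh => he (Sym2.mk_isDiag_iff.2 hh)⟩, rfl⟩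
  · intro h
    obtain ⟨⟨u, v⟩, huv, rfl⟩ := Finset.mem_image.1 h
    obtain ⟨hu, hv, huv⟩ := Finset.mem_offDiag.1 huv
    refine Finset.mem_map.2 ⟨⟨s(u, v), fun hh => huv (Sym2.mk_isDiag_iff.1 hh)⟩, ?_, rfl⟩
    simp only [Finset.mem_filter, Finset.mem_univ, true_and, Sym2.mem_iff]
    rintro w (rfl | rfl)
    exacts [hu, hv]

theorem card_vertexPair (n : ℕ) : Fintype.card (VertexPair n) = n.choose 2 := by
  simpa using card_vertexPair_filter (Finset.univ : Finset (Fin n))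

/-! ### Straight-line programs and relocation of programs -/

namespace RandomizedRAM

/-- The effect of an instruction on the memory. -/
def Instr.effect (i : Instr) (m : ℕ → ℕ) : ℕ → ℕ := (i.exec ⟨0, m, []⟩).mem

/-- An instruction which neither jumps nor uses coins. -/
def Instr.IsStraight (i : Instr) : Prop :=
  ∀ s : Config, i.exec s = ⟨s.pc + 1, i.effect s.mem, s.coins⟩

theorem Instr.isStraight_const (x c : ℕ) : (Instr.const x c).IsStraight := fun _ => rfl

theorem Instr.isStraight_add (x y z : ℕ) : (Instr.add x y z).IsStraight := fun _ => rfl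

theorem Instr.isStraight_sub (x y z : ℕ) : (Instr.sub x y z).IsStraight := fun _ => rfl

/-- The effect of a straight-line program on the memory. -/
def Program.effect (L : Program) (m : ℕ → ℕ) : ℕ → ℕ := L.foldl (fun m i => i.effect m) m

theorem Program.effect_append (L L' : Program) (m : ℕ → ℕ) :
    Program.effect (L ++ L') m = Program.effect L' (Program.effect L m) :=
  List.foldl_append

theorem run_succ (P : Program) (t : ℕ) (s : Config) : run P (t + 1) s = run P t (step P s) :=
  Function.iterate_succ_apply _ _ _

theorem run_straight (L : Program) (hL : ∀ i ∈ L, i.IsStraight) (pre post : Program) (m : ℕ → ℕ)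
    (c : List Bool) :
    run (pre ++ L ++ post) L.length ⟨pre.length, m, c⟩ =
      ⟨pre.length + L.length, Program.effect L m, c⟩ := by
  induction L generalizing pre m with
  | nil => rfl
  | cons i L ih =>
    rw [List.length_cons, run_succ]
    have h1 : step (pre ++ (i :: L) ++ post) ⟨pre.length, m, c⟩ =
        ⟨pre.length + 1, i.effect m, c⟩ := by
      simp only [step]
      rw [List.append_assoc, List.getElem?_append_right le_rfl]
      simpa using hL i (by simp) ⟨pre.length, m, c⟩
    have h2 := ih (fun j hj => hL j (by simp [hj])) (pre ++ [i]) (i.effect m)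
    rw [h1]
    simp only [List.append_assoc, List.cons_append, List.nil_append, List.length_append,
      List.length_singleton] at h2 ⊢
    rw [h2, Program.effect, Program.effect, List.foldl_cons]
    congr 1
    omega

/-- A sequence of blocks, each of which assigns a value to its own target cell, the value depending
only on cells which are no targets. -/
theorem Program.effect_flatMap {ι : Type*} (blk : ι → Program) (tgt : ι → ℕ)
    (val : ι → (ℕ → ℕ) → ℕ)
    (hblk : ∀ i m, Program.effect (blk i) m = Function.update m (tgt i) (val i m))
    (hval : ∀ i m m', (∀ a, a ∉ Set.range tgt → m a = m' a) → val i m = val i m')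
    (hinj : Function.Injective tgt) (l : List ι) (m : ℕ → ℕ) :
    (∀ a, (∀ i ∈ l, tgt i ≠ a) → Program.effect (l.flatMap blk) m a = m a) ∧
      ∀ i ∈ l, Program.effect (l.flatMap blk) m (tgt i) = val i m := by
  induction l generalizing m with
  | nil => exact ⟨fun a _ => rfl, by simp⟩
  | cons j l ih =>
    rw [List.flatMap_cons, Program.effect_append, hblk]
    obtain ⟨ih1, ih2⟩ := ih (Function.update m (tgt j) (val j m))
    -- No block reads a target cell, so the write by block `j` does not alter the values of later
    -- blocks.
    have hv : ∀ i, val i (Function.update m (tgt j) (val j m)) = val i m := fun i => by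
      refine hval i _ _ fun a ha => Function.update_of_ne ?_ _ _
      rintro rfl
      exact ha ⟨j, rfl⟩
    refine ⟨fun a ha => ?_, fun i hi => ?_⟩
    · rw [ih1 a fun i hi => ha i (by simp [hi]), Function.update_of_ne (ha j (by simp)).symm]
    · by_cases hil : i ∈ l
      · rw [ih2 i hil, hv]
      · obtain rfl : i = j := by simpa [hil] using hi
        rw [ih1, Function.update_self]
        rintro i' hi' h
        exact hil (hinj h ▸ hi')

/-- Relocation by `L` instructions. -/
def Instr.shift (L : ℕ) : Instr → Instr
  | .jumpZero x l => .jumpZero x (l + L)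
  | i => i

theorem step_shift (pre P : Program) (s : Config) :
    step (pre ++ P.map (Instr.shift pre.length)) ⟨s.pc + pre.length, s.mem, s.coins⟩ =
      ⟨(step P s).pc + pre.length, (step P s).mem, (step P s).coins⟩ := by
  simp only [step]
  rw [List.getElem?_append_right (by omega), Nat.add_sub_cancel, List.getElem?_map]
  cases P[s.pc]? with
  | none => rfl
  | some i =>
    cases i <;> simp [Instr.shift, Instr.exec, Nat.add_right_comm]
    split_ifs <;> omega

theorem run_shift (pre P : Program) (t : ℕ) (s : Config) :
    run (pre ++ P.map (Instr.shift pre.length)) t ⟨s.pc + pre.length, s.mem, s.coins⟩ =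
      ⟨(run P t s).pc + pre.length, (run P t s).mem, (run P t s).coins⟩ := by
  induction t generalizing s with
  | zero => rfl
  | succ t ih => rw [run_succ, run_succ, step_shift, ih]

theorem step_append_coins (P : Program) (pc : ℕ) (m : ℕ → ℕ) (c d : List Bool)
    (hc : 1 ≤ c.length) :
    ∃ c', (c.length ≤ c'.length + 1) ∧ ∃ pc' m', step P ⟨pc, m, c⟩ = ⟨pc', m', c'⟩ ∧
      step P ⟨pc, m, c ++ d⟩ = ⟨pc', m', c' ++ d⟩ := by
  simp only [step]
  cases P[pc]? with
  | none => exact ⟨c, by omega, pc, m, rfl, rfl⟩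
  | some i =>
    obtain ⟨b, c, rfl⟩ : ∃ b c', c = b :: c' := List.exists_cons_of_length_pos hc
    cases i
    case coin x => exact ⟨c, by simp, _, _, rfl, rfl⟩
    all_goals exact ⟨b :: c, by omega, _, _, rfl, rfl⟩

/-- In `t` steps only the first `t` coins matter. -/
theorem run_append_coins (P : Program) (t pc : ℕ) (m : ℕ → ℕ) (c d : List Bool)
    (hc : t ≤ c.length) :
    (run P t ⟨pc, m, c ++ d⟩).pc = (run P t ⟨pc, m, c⟩).pc ∧
      (run P t ⟨pc, m, c ++ d⟩).mem = (run P t ⟨pc, m, c⟩).mem := by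
  induction t generalizing pc m c with
  | zero => exact ⟨rfl, rfl⟩
  | succ t ih =>
    obtain ⟨c', hc', pc', m', h1, h2⟩ := step_append_coins P pc m c d (by omega)
    rw [run_succ, run_succ, h1, h2]
    exact ih pc' m' c' (by omega)

theorem Instr.one_le_length (i : Instr) : 1 ≤ i.length := by
  cases i <;> simp only [Instr.length] <;> omega

theorem Program.length_le_size (P : Program) : P.length ≤ Program.size P := by
  unfold Program.size
  induction P with
  | nil => simp
  | cons i P ih =>
    have := i.one_le_length
    simp only [List.length_cons, List.map_cons, List.sum_cons]
    omega

theorem Program.size_append (P Q : Program) :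
    Program.size (P ++ Q) = Program.size P + Program.size Q := by
  simp [Program.size]

theorem Program.size_le {P : Program} {b : ℕ} (h : ∀ i ∈ P, i.length ≤ b) :
    Program.size P ≤ P.length * b := by
  simpa [Program.size] using List.sum_le_card_nsmul (P.map Instr.length) b (by simpa using h)

theorem size_le_self (a : ℕ) : a.size ≤ a := Nat.size_le.2 Nat.lt_two_pow_self

theorem size_add_le (a b : ℕ) : (a + b).size ≤ a.size + b.size := by
  rw [Nat.size_le, pow_add]
  have ha := Nat.lt_size_self a
  have hb := Nat.lt_size_self b
  nlinarith

theorem Instr.length_shift_le (L : ℕ) (i : Instr) : (i.shift L).length ≤ i.length + L := by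
  cases i <;> simp only [Instr.shift, Instr.length] <;> try omega
  case jumpZero x l =>
    have := size_add_le l L
    have := size_le_self L
    omega

theorem Program.size_map_shift_le (L : ℕ) (P : Program) :
    Program.size (P.map (Instr.shift L)) ≤ Program.size P + P.length * L := by
  unfold Program.size
  induction P with
  | nil => simp
  | cons i P ih =>
    have := i.length_shift_le L
    simp only [List.length_cons, List.map_cons, List.sum_cons, add_mul, one_mul]
    omega

/-- Running a straight-line program before a test. -/
def Test.precompose {n N : ℕ} (φ : Test N) (L : Program) (hL : ∀ i ∈ L, i.IsStraight)
    (R : SimpleGraph (Fin n) → SimpleGraph (Fin N))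
    (hR : ∀ G, Program.effect L (initial G []).mem = (initial (R G) []).mem) : Test n where
  program := L ++ φ.program.map (Instr.shift L.length)
  time := φ.time + L.length
  halts G ω := by
    have h1 := run_straight L hL [] (φ.program.map (Instr.shift L.length)) (initial G []).mem
      (List.ofFn ω)
    have h2 := run_shift L φ.program φ.time ⟨0, (initial (R G) []).mem, List.ofFn ω⟩
    -- The prefix flips no coin, so the test sees the first `φ.time` coins; the remaining `L.length`
    -- coins exist only because `time` also counts the prefix.
    obtain ⟨ω, rfl⟩ := (Fin.appendEquiv φ.time L.length).surjective ω
    have h3 := run_append_coins φ.program φ.time 0 (initial (R G) []).mem (List.ofFn ω.1)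
      (List.ofFn ω.2) (by simp)
    have h4 := φ.halts (R G) ω.1
    simp only [List.nil_append, List.length_nil, Nat.zero_add] at h1 h2
    rw [List.length_append, List.length_map, run, Function.iterate_add_apply]
    change _ ≤ (run _ φ.time (run _ L.length ⟨0, (initial G []).mem, _⟩)).pc
    rw [h1, hR, h2]
    simp only [Fin.appendEquiv, Equiv.coe_fn_mk, List.ofFn_fin_append] at h3 ⊢
    rw [h3.1, Nat.add_comm]
    exact Nat.add_le_add_right h4 _

/-- Each coin sequence of `φ` extends in `2 ^ L.length` ways by coins that are never read, and this
factor cancels against the larger denominator. -/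
theorem Test.prob_precompose {n N : ℕ} (φ : Test N) (L : Program) (hL : ∀ i ∈ L, i.IsStraight)
    (R : SimpleGraph (Fin n) → SimpleGraph (Fin N))
    (hR : ∀ G, Program.effect L (initial G []).mem = (initial (R G) []).mem) (b : Bool)
    (G : SimpleGraph (Fin n)) :
    (φ.precompose L hL R hR).prob b G = φ.prob b (R G) := by
  have key : ∀ ω : (Fin φ.time → Bool) × (Fin L.length → Bool),
      (φ.precompose L hL R hR).output G (Fin.appendEquiv φ.time L.length ω) =
        φ.output (R G) ω.1 := by
    intro ω
    have h1 := run_straight L hL [] (φ.program.map (Instr.shift L.length)) (initial G []).mem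
      (List.ofFn (Fin.appendEquiv φ.time L.length ω))
    have h2 := run_shift L φ.program φ.time ⟨0, (initial (R G) []).mem,
      List.ofFn (Fin.appendEquiv φ.time L.length ω)⟩
    have h3 := run_append_coins φ.program φ.time 0 (initial (R G) []).mem (List.ofFn ω.1)
      (List.ofFn ω.2) (by simp)
    simp only [List.nil_append, List.length_nil, Nat.zero_add] at h1 h2
    unfold Test.output
    congr 1
    change (run (L ++ φ.program.map (Instr.shift L.length)) (φ.time + L.length) _).mem 0 = _
    rw [run, Function.iterate_add_apply]
    change (run _ φ.time (run _ L.length ⟨0, (initial G []).mem, _⟩)).mem 0 = _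
    erw [h1]
    rw [hR, h2]
    simp only [Fin.appendEquiv, Equiv.coe_fn_mk, List.ofFn_fin_append] at h3 ⊢
    rw [h3.2]
    rfl
  have hcard : Finset.card {ω : Fin (φ.precompose L hL R hR).time → Bool |
      (φ.precompose L hL R hR).output G ω = b} =
      Finset.card {ω : Fin φ.time → Bool | φ.output (R G) ω = b} * 2 ^ L.length := by
    have h5 : (2 : ℕ) ^ L.length = (Finset.univ : Finset (Fin L.length → Bool)).card := by simp
    rw [h5, ← Finset.card_product]
    symm
    refine Finset.card_equiv (Fin.appendEquiv φ.time L.length) fun ω => ?_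
    simp only [Finset.mem_product, Finset.mem_filter, Finset.mem_univ, true_and, and_true]
    exact Eq.congr_left (key ω).symm
  unfold Test.prob
  rw [hcard]
  change _ / (2 : ℝ) ^ (φ.time + L.length) = _
  push_cast
  rw [pow_add, mul_div_mul_right _ _ (by positivity)]

end RandomizedRAM

namespace RandomizedRAM

/-! ### Compiling maps of graphs each of whose adjacency bits depends on one adjacency bit -/

theorem initial_mem_zero {n : ℕ} (G : SimpleGraph (Fin n)) (c : List Bool) :
    (initial G c).mem 0 = n := by simp [initial]

/-- Even cells other than `0` hold no input and serve as scratch space. -/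
theorem initial_mem_even {n : ℕ} (G : SimpleGraph (Fin n)) (c : List Bool) (a : ℕ) :
    (initial G c).mem (2 * a + 2) = 0 := by
  simp only [initial]
  rw [if_neg (by omega), if_neg]
  rintro ⟨i, j, h, -⟩
  omega

theorem mul_add_fin_inj {n : ℕ} {i j i' j' : Fin n} (h : (i : ℕ) * n + j = i' * n + j') :
    i = i' ∧ j = j' := by
  have hn : 0 < n := i.pos
  have h1 := congrArg (· / n) h
  have h2 := congrArg (· % n) h
  simp only [Nat.mul_comm _ n, Nat.mul_add_div hn, Nat.mul_add_mod,
    Nat.div_eq_of_lt j.2, Nat.div_eq_of_lt j'.2, Nat.mod_eq_of_lt j.2, Nat.mod_eq_of_lt j'.2] at h1 h2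
  exact ⟨Fin.ext h1, Fin.ext h2⟩

open Classical in
theorem initial_mem_odd {n : ℕ} (G : SimpleGraph (Fin n)) (c : List Bool) (i j : Fin n) :
    (initial G c).mem (2 * (i * n + j) + 1) = (decide (G.Adj i j)).toNat := by
  simp only [initial]
  rw [if_neg (by omega)]
  by_cases h : G.Adj i j
  · rw [if_pos ⟨i, j, rfl, h⟩]
    simp [h]
  · rw [if_neg]
    · simp [h]
    · rintro ⟨i', j', h', h''⟩
      obtain ⟨rfl, rfl⟩ := mul_add_fin_inj (by omega : (i : ℕ) * n + j = i' * n + j')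
      exact h h''

theorem initial_mem_large {n : ℕ} (G : SimpleGraph (Fin n)) (c : List Bool) {a : ℕ}
    (ha : n * n ≤ a) : (initial G c).mem (2 * a + 1) = 0 := by
  simp only [initial]
  rw [if_neg (by omega), if_neg]
  rintro ⟨i, j, h, -⟩
  have hi := i.2
  have hj := j.2
  nlinarith

theorem exists_fin_mul_add {N a : ℕ} (ha : a < N * N) : ∃ u v : Fin N, a = u * N + v := by
  have hN : 0 < N := by
    rcases Nat.eq_zero_or_pos N with rfl | h
    · simp at ha
    · exact h
  exact ⟨⟨a / N, Nat.div_lt_of_lt_mul ha⟩, ⟨a % N, Nat.mod_lt _ hN⟩, (Nat.div_add_mod' a N).symm⟩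

/-- Code assigning to cell `2 * i + 2` the value `h` of the bit in cell `2 * s + 1`. -/
def bitBlock (s : ℕ) (h : Bool → Bool) (i : ℕ) : Program :=
  [.const (2 * i + 2) (h false).toNat,
    if h true = h false then .const (2 * i + 2) (h false).toNat
    else if h false then .sub (2 * i + 2) (2 * i + 2) (2 * s + 1)
    else .add (2 * i + 2) (2 * i + 2) (2 * s + 1)]

/-- The value assigned by `bitBlock`. -/
def bitValue (s : ℕ) (h : Bool → Bool) (m : ℕ → ℕ) : ℕ :=
  if h true = h false then (h false).toNat
  else if h false then 1 - m (2 * s + 1) else m (2 * s + 1)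

/-- After the first instruction the target holds `h false`, so if `h` is not constant, subtracting
the bit from `1` or adding it to `0` gives negation or identity. -/
theorem effect_bitBlock (s : ℕ) (h : Bool → Bool) (i : ℕ) (m : ℕ → ℕ) :
    Program.effect (bitBlock s h i) m = Function.update m (2 * i + 2) (bitValue s h m) := by
  have hs : 2 * s + 1 ≠ 2 * i + 2 := by omega
  unfold bitBlock bitValue
  split_ifs with h1 h2 <;>
    simp_all [Program.effect, Instr.effect, Instr.exec]

theorem bitValue_eq (s : ℕ) (h : Bool → Bool) (m : ℕ → ℕ) (b : Bool)
    (hb : m (2 * s + 1) = b.toNat) : bitValue s h m = (h b).toNat := by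
  unfold bitValue
  rw [hb]
  cases b <;> cases h0 : h false <;> cases h1 : h true <;> simp

/-- The program replacing the adjacency matrix on `Fin n` by the one on `Fin N` given by `h` and
`s`. -/
def rewriteGraph (N : ℕ) (s : ℕ → ℕ) (h : ℕ → Bool → Bool) : Program :=
  [.const 0 0] ++ (List.range (N * N)).flatMap (fun i => bitBlock (s i) (h i) i) ++
    (List.range (N * N)).flatMap (fun i => [.add (2 * i + 1) (2 * i + 2) 0]) ++
    (List.range (N * N)).flatMap (fun i => [.const (2 * i + 2) 0]) ++ [.const 0 N]

theorem isStraight_rewriteGraph (N : ℕ) (s : ℕ → ℕ) (h : ℕ → Bool → Bool) :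
    ∀ i ∈ rewriteGraph N s h, i.IsStraight := by
  intro i hi
  simp only [rewriteGraph, bitBlock, List.mem_append, List.mem_flatMap,
    List.mem_cons, List.not_mem_nil, or_false] at hi
  rcases hi with (((rfl | ⟨a, -, rfl | rfl⟩) | ⟨a, -, rfl⟩) | ⟨a, -, rfl⟩) | rfl
  · exact Instr.isStraight_const _ _
  · exact Instr.isStraight_const _ _
  · split_ifs
    · exact Instr.isStraight_const _ _
    · exact Instr.isStraight_sub _ _ _
    · exact Instr.isStraight_add _ _ _
  · exact Instr.isStraight_add _ _ _
  · exact Instr.isStraight_const _ _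
  · exact Instr.isStraight_const _ _

theorem length_rewriteGraph (N : ℕ) (s : ℕ → ℕ) (h : ℕ → Bool → Bool) :
    (rewriteGraph N s h).length = 4 * (N * N) + 2 := by
  simp [rewriteGraph, bitBlock, List.length_flatMap]
  omega

theorem toNat_size_le (b : Bool) : b.toNat.size ≤ 1 := by cases b <;> simp

theorem size_rewriteGraph_le (N : ℕ) (s : ℕ → ℕ) (h : ℕ → Bool → Bool)
    (hs : ∀ i < N * N, s i ≤ N * N) :
    Program.size (rewriteGraph N s h) ≤ (4 * (N * N) + 2) * (6 * (N * N) + N + 6) := by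
  rw [← length_rewriteGraph N s h]
  refine Program.size_le fun i hi => ?_
  simp only [rewriteGraph, bitBlock, List.mem_append, List.mem_flatMap,
    List.mem_cons, List.not_mem_nil, or_false, List.mem_range] at hi
  rcases hi with (((rfl | ⟨a, ha, rfl | rfl⟩) | ⟨a, ha, rfl⟩) | ⟨a, ha, rfl⟩) | rfl
  · simp [Instr.length]
  · have h1 := toNat_size_le (h a false)
    have h2 := size_le_self (2 * a + 2)
    simp only [Instr.length]
    omega
  · have h1 := toNat_size_le (h a false)
    have h2 := size_le_self (2 * a + 2)
    have h3 := size_le_self (2 * s a + 1)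
    have h4 := hs a ha
    split_ifs <;> simp only [Instr.length] <;> omega
  · have h2 := size_le_self (2 * a + 2)
    have h3 := size_le_self (2 * a + 1)
    simp only [Instr.length, Nat.size_zero]
    omega
  · have h2 := size_le_self (2 * a + 2)
    simp only [Instr.length, Nat.size_zero]
    omega
  · have h2 := size_le_self N
    simp only [Instr.length, Nat.size_zero]
    omega

-- The old and the new adjacency matrix share the odd cells. The new bits are therefore first
-- collected in even cells, then copied, then the even cells are cleared; cell `0` is set to zero
-- meanwhile to act as the neutral summand in the copying. Because `n ≤ N`, no bit of the old matrix
-- survives beyond the new one.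
open Classical in
theorem effect_rewriteGraph {n N : ℕ} (hnN : n ≤ N) (G : SimpleGraph (Fin n))
    (G' : SimpleGraph (Fin N)) (s : ℕ → ℕ) (h : ℕ → Bool → Bool)
    (hsh : ∀ u v : Fin N, ∃ a b : Fin n, s (u * N + v) = a * n + b ∧
      (G'.Adj u v ↔ h (u * N + v) (decide (G.Adj a b)) = true)) :
    Program.effect (rewriteGraph N s h) (initial G []).mem = (initial G' []).mem := by
  set m0 := (initial G []).mem with hm0
  simp only [rewriteGraph, Program.effect_append]
  set m1 := Program.effect [Instr.const 0 0] m0 with hm1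
  have hm1' : m1 = Function.update m0 0 0 := rfl
  have ph1 := Program.effect_flatMap (fun i => bitBlock (s i) (h i) i) (fun i => 2 * i + 2)
    (fun i m => bitValue (s i) (h i) m) (fun i m => effect_bitBlock _ _ _ _)
    (fun i m m' hmm => by
      simp only [bitValue]
      rw [hmm]
      rintro ⟨j, hj⟩
      simp only at hj
      omega) (fun i j hij => by simp only at hij; omega) (List.range (N * N)) m1
  set m2 := Program.effect ((List.range (N * N)).flatMap fun i => bitBlock (s i) (h i) i) m1
  have ph2 := Program.effect_flatMap (fun i => [Instr.add (2 * i + 1) (2 * i + 2) 0])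
    (fun i => 2 * i + 1) (fun i m => m (2 * i + 2) + m 0) (fun i m => rfl)
    (fun i m m' hmm => by
      rw [hmm, hmm] <;> rintro ⟨j, hj⟩ <;> simp only at hj <;> omega)
    (fun i j hij => by simp only at hij; omega) (List.range (N * N)) m2
  set m3 := Program.effect ((List.range (N * N)).flatMap fun i =>
    [Instr.add (2 * i + 1) (2 * i + 2) 0]) m2
  have ph3 := Program.effect_flatMap (fun i => [Instr.const (2 * i + 2) 0])
    (fun i => 2 * i + 2) (fun i m => 0) (fun i m => rfl) (fun i m m' hmm => rfl)
    (fun i j hij => by simp only at hij; omega) (List.range (N * N)) m3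
  set m4 := Program.effect ((List.range (N * N)).flatMap fun i => [Instr.const (2 * i + 2) 0]) m3
  have e5 : Program.effect [Instr.const 0 N] m4 = Function.update m4 0 N := rfl
  rw [e5]
  have hm2 : m2 0 = 0 := by
    rw [ph1.1 0 (by intro i _; omega), hm1', Function.update_self]
  have hdisj : ∀ a b : ℕ, 2 * a + 2 ≠ 2 * b + 1 := by intro a b; omega
  ext c
  rcases Nat.eq_zero_or_pos c with rfl | hc
  · rw [Function.update_self, initial_mem_zero]
  rw [Function.update_of_ne hc.ne']
  rcases Nat.even_or_odd' c with ⟨d, rfl | rfl⟩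
  · obtain ⟨d, rfl⟩ : ∃ d', d = d' + 1 := ⟨d - 1, by omega⟩
    rw [mul_add, mul_one, initial_mem_even]
    by_cases hd : d < N * N
    · exact ph3.2 d (List.mem_range.2 hd)
    · have hne : ∀ i ∈ List.range (N * N), 2 * i + 2 ≠ 2 * d + 2 := by
        intro i hi
        have := List.mem_range.1 hi
        omega
      rw [ph3.1 _ hne, ph2.1 _ (fun i _ => (hdisj d i).symm), ph1.1 _ hne, hm1',
        Function.update_of_ne (by omega), hm0, initial_mem_even]
  · rw [ph3.1 _ (fun i _ => hdisj i d)]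
    by_cases hd : d < N * N
    · rw [ph2.2 d (List.mem_range.2 hd), ph1.2 d (List.mem_range.2 hd), hm2, add_zero]
      obtain ⟨u, v, rfl⟩ := exists_fin_mul_add hd
      obtain ⟨a, b, hs, hadj⟩ := hsh u v
      rw [initial_mem_odd, bitValue_eq _ _ _ (decide (G.Adj a b))]
      · congr 1
        rw [Bool.eq_iff_iff, decide_eq_true_eq, hadj]
      · rw [hs, hm1', Function.update_of_ne (by omega), hm0, initial_mem_odd]
    · rw [initial_mem_large G' [] (not_lt.1 hd)]
      have hne : ∀ i ∈ List.range (N * N), 2 * i + 1 ≠ 2 * d + 1 := by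
        intro i hi
        have := List.mem_range.1 hi
        omega
      have := Nat.mul_le_mul hnN hnN
      rw [ph2.1 _ hne, ph1.1 _ (fun i _ => hdisj i d), hm1',
        Function.update_of_ne (by omega), hm0, initial_mem_large _ _ (by omega)]

open Classical in
/-- A map of graphs each of whose adjacency bits is a function of one adjacency bit can be composed
with a test at polynomial cost. -/
theorem exists_test_comp {n N : ℕ} (hnN : n ≤ N) (φ : Test N)
    (R : SimpleGraph (Fin n) → SimpleGraph (Fin N))
    (hR : ∀ u v : Fin N, ∃ a b : Fin n, ∃ h : Bool → Bool,
      ∀ G, (R G).Adj u v ↔ h (decide (G.Adj a b)) = true) :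
    ∃ A : Test n, A.time = φ.time + (4 * (N * N) + 2) ∧
      A.program.size ≤ (4 * (N * N) + 2) * (6 * (N * N) + N + 6) +
        (φ.program.size + φ.program.size * (4 * (N * N) + 2)) ∧
      ∀ b G, A.prob b G = φ.prob b (R G) := by
  choose a b h hh using hR
  -- The program indexes matrix entries by one number `u * N + v`, which is decoded here; the
  -- default values beyond `N * N` are never used by the program.
  let s : ℕ → ℕ := fun i => if hi : i < N * N then
    (a (exists_fin_mul_add hi).choose (exists_fin_mul_add hi).choose_spec.choose : ℕ) * n +
      b (exists_fin_mul_add hi).choose (exists_fin_mul_add hi).choose_spec.choose else 0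
  let h' : ℕ → Bool → Bool := fun i => if hi : i < N * N then
    h (exists_fin_mul_add hi).choose (exists_fin_mul_add hi).choose_spec.choose else id
  have hlt : ∀ {M : ℕ} (u v : Fin M), (u : ℕ) * M + v < M * M := by
    intro M u v
    have h1 := u.2
    have h2 := v.2
    nlinarith
  have key : ∀ u v : Fin N, s (u * N + v) = a u v * n + b u v ∧ h' (u * N + v) = h u v := by
    intro u v
    have hi := hlt u v
    have hspec := (exists_fin_mul_add hi).choose_spec.choose_spec
    obtain ⟨h1, h2⟩ := mul_add_fin_inj hspec
    simp only [s, h', dif_pos hi]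
    rw [← h2, ← h1]
    exact ⟨rfl, rfl⟩
  have hs : ∀ i < N * N, s i ≤ N * N := by
    intro i hi
    obtain ⟨u, v, rfl⟩ := exists_fin_mul_add hi
    rw [(key u v).1]
    exact (hlt _ _).le.trans (Nat.mul_le_mul hnN hnN)
  have hL := isStraight_rewriteGraph N s h'
  have heff : ∀ G, Program.effect (rewriteGraph N s h') (initial G []).mem =
      (initial (R G) []).mem := fun G => effect_rewriteGraph hnN G (R G) s h' fun u v =>
        ⟨a u v, b u v, (key u v).1, by rw [(key u v).2]; exact hh u v G⟩
  refine ⟨φ.precompose _ hL R heff, ?_, ?_, fun c G => φ.prob_precompose _ hL R heff c G⟩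
  · simp only [Test.precompose, length_rewriteGraph]
  · simp only [Test.precompose, length_rewriteGraph]
    rw [Program.size_append]
    refine Nat.add_le_add (size_rewriteGraph_le N s h' hs)
      ((Program.size_map_shift_le _ _).trans ?_)
    exact Nat.add_le_add_left (Nat.mul_le_mul_right _ (Program.length_le_size _)) _

end RandomizedRAM

/-! ### The edge count test -/

/-- The number of edges, as a function of the adjacency bits. -/
def bitCount {ι : Type*} [Fintype ι] (x : ι → Bool) : ℕ := ∑ e, (x e).toNat

open Classical in
theorem sum_adj_eq_two_mul_bitCount {n : ℕ} (G : SimpleGraph (Fin n)) :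
    ∑ u, ∑ v, (decide (G.Adj u v)).toNat = 2 * bitCount (graphBits n G) := by
  have h1 : ∀ u, ∑ v, (decide (G.Adj u v)).toNat = G.degree u := by
    intro u
    rw [← SimpleGraph.card_neighborFinset_eq_degree, SimpleGraph.neighborFinset_eq_filter,
      Finset.card_filter]
    refine Finset.sum_congr rfl fun v _ => ?_
    by_cases h : G.Adj u v <;> simp [h]
  simp_rw [h1]
  rw [SimpleGraph.sum_degrees_eq_twice_card_edges]
  congr 1
  have h2 : bitCount (graphBits n G) = (Finset.univ.filter fun e => graphBits n G e = true).card := by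
    rw [Finset.card_filter]
    refine Finset.sum_congr rfl fun e _ => ?_
    cases graphBits n G e <;> simp
  rw [h2, ← Finset.card_map (Function.Embedding.subtype _)]
  congr 1
  ext e
  simp only [SimpleGraph.mem_edgeFinset, Finset.mem_map, Finset.mem_filter, Finset.mem_univ,
    true_and, graphBits_apply_eq_true, Function.Embedding.subtype_apply, Subtype.exists,
    exists_and_left, exists_prop, exists_eq_right_right]
  constructor
  · exact fun h => ⟨h, G.not_isDiag_of_mem_edgeSet h⟩
  · exact fun h => h.1

theorem bitCount_cast {ι : Type*} [Fintype ι] (x : ι → Bool) :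
    (bitCount x : ℝ) = ∑ e, if x e then (1 : ℝ) else 0 := by
  unfold bitCount
  push_cast
  exact Finset.sum_congr rfl fun e _ => by cases x e <;> simp

namespace RandomizedRAM

/-- Counts the ordered pairs of adjacent vertices and compares with `c`. -/
def edgeCountProgram (N c : ℕ) : Program :=
  [.const 0 0] ++ (List.range (N * N)).map (fun i => .add 0 0 (2 * i + 1)) ++
    [.const 2 c, .sub 0 0 2]

theorem effect_map_add (l : List ℕ) (m : ℕ → ℕ) :
    Program.effect (l.map fun i => .add 0 0 (2 * i + 1)) m =
      Function.update m 0 (m 0 + (l.map fun i => m (2 * i + 1)).sum) := by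
  induction l generalizing m with
  | nil => simp [Program.effect]
  | cons i l ih =>
    have : Program.effect (List.map (fun i => Instr.add 0 0 (2 * i + 1)) (i :: l)) m =
        Program.effect (l.map fun i => .add 0 0 (2 * i + 1))
          (Function.update m 0 (m 0 + m (2 * i + 1))) := rfl
    rw [this, ih]
    ext a
    by_cases ha : a = 0
    · subst ha
      simp [add_assoc]
    · simp [ha]

theorem effect_edgeCountProgram {N : ℕ} (c : ℕ) (G : SimpleGraph (Fin N)) :
    Program.effect (edgeCountProgram N c) (initial G []).mem 0 =
      2 * bitCount (graphBits N G) - c := by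
  classical
  have hsum : ((List.range (N * N)).map fun i => (initial G []).mem (2 * i + 1)).sum =
      2 * bitCount (graphBits N G) := by
    change ∑ i ∈ Finset.range (N * N), (initial G []).mem (2 * i + 1) = _
    rw [← sum_adj_eq_two_mul_bitCount, Finset.sum_range, ← finProdFinEquiv.sum_comp, Fintype.sum_prod_type]
    refine Finset.sum_congr rfl fun u _ => Finset.sum_congr rfl fun v _ => ?_
    rw [← initial_mem_odd G []]
    congr 2
    simp only [finProdFinEquiv_apply_val]
    ring
  unfold edgeCountProgram
  rw [Program.effect_append, Program.effect_append, effect_map_add]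
  simp [Program.effect, Instr.effect, Instr.exec, hsum]

theorem isStraight_edgeCountProgram (N c : ℕ) : ∀ i ∈ edgeCountProgram N c, i.IsStraight := by
  intro i hi
  simp only [edgeCountProgram, List.mem_append, List.mem_map, List.mem_cons, List.not_mem_nil,
    or_false] at hi
  rcases hi with (rfl | ⟨a, -, rfl⟩) | rfl | rfl
  · exact Instr.isStraight_const _ _
  · exact Instr.isStraight_add _ _ _
  · exact Instr.isStraight_const _ _
  · exact Instr.isStraight_sub _ _ _

theorem length_edgeCountProgram (N c : ℕ) : (edgeCountProgram N c).length = N * N + 3 := by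
  simp [edgeCountProgram]

theorem size_edgeCountProgram_le (N c : ℕ) :
    Program.size (edgeCountProgram N c) ≤ (N * N + 3) * (2 * (N * N) + c + 3) := by
  rw [← length_edgeCountProgram N c]
  refine Program.size_le fun i hi => ?_
  simp only [edgeCountProgram, List.mem_append, List.mem_map, List.mem_cons, List.not_mem_nil,
    or_false, List.mem_range] at hi
  have h2 : Nat.size 2 ≤ 2 := size_le_self 2
  have hc := size_le_self c
  rcases hi with (rfl | ⟨a, ha, rfl⟩) | rfl | rfl
  · simp [Instr.length]
  · have := size_le_self (2 * a + 1)
    simp only [Instr.length, Nat.size_zero]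
    omega
  · simp only [Instr.length]
    omega
  · simp only [Instr.length, Nat.size_zero]
    omega

theorem run_edgeCountProgram {N : ℕ} (c : ℕ) (G : SimpleGraph (Fin N)) (ω : List Bool) :
    run (edgeCountProgram N c) (edgeCountProgram N c).length (initial G ω) =
      ⟨(edgeCountProgram N c).length, Program.effect (edgeCountProgram N c) (initial G []).mem, ω⟩ := by
  have := run_straight (edgeCountProgram N c) (isStraight_edgeCountProgram N c) [] []
    (initial G []).mem ω
  simp only [List.nil_append, List.append_nil, List.length_nil, Nat.zero_add] at this
  exact this

/-- Outputs `1` when twice the number of edges exceeds `c`. -/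
def edgeCountTest (N c : ℕ) : Test N where
  program := edgeCountProgram N c
  time := (edgeCountProgram N c).length
  halts G ω := by rw [run_edgeCountProgram]

theorem output_edgeCountTest {N c : ℕ} (G : SimpleGraph (Fin N))
    (ω : Fin (edgeCountTest N c).time → Bool) :
    (edgeCountTest N c).output G ω = decide (c < 2 * bitCount (graphBits N G)) := by
  unfold Test.output
  simp only [edgeCountTest]
  rw [run_edgeCountProgram]
  change (Program.effect (edgeCountProgram N c) (initial G []).mem 0 != 0) = _
  rw [effect_edgeCountProgram, Bool.eq_iff_iff, bne_iff_ne, decide_eq_true_eq]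
  omega

theorem prob_edgeCountTest {N c : ℕ} (b : Bool) (G : SimpleGraph (Fin N)) :
    (edgeCountTest N c).prob b G =
      if decide (c < 2 * bitCount (graphBits N G)) = b then 1 else 0 := by
  unfold Test.prob
  simp_rw [output_edgeCountTest]
  split_ifs with h
  · simp [h]
  · simp [h]

end RandomizedRAM

/-! ### Chebyshev analysis of the edge count and the upper bound -/

open Classical in
theorem sum_plantedWeight {n : ℕ} (S : Finset (Fin n)) (p q : ℝ) :
    ∑ e : VertexPair n, (if ∀ v ∈ e.1, v ∈ S then p else q) =
      n.choose 2 * q + S.card.choose 2 * (p - q) := by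
  have : ∀ e : VertexPair n, (if ∀ v ∈ e.1, v ∈ S then p else q) =
      q + if ∀ v ∈ e.1, v ∈ S then p - q else 0 := by
    intro e
    split_ifs <;> ring
  simp_rw [this]
  rw [Finset.sum_add_distrib, ← Finset.sum_filter, Finset.sum_const, Finset.sum_const,
    card_vertexPair_filter, Finset.card_univ, card_vertexPair]
  simp

/-- The threshold is twice the midpoint of the two means `M` and `M + Δ`, since the program counts
every edge twice. Either error forces a deviation of at least `Δ / 2`, so Chebyshev gives `M / (Δ /
2) ^ 2` and `(M + Δ) / (Δ / 2) ^ 2`, the latter for every fixed planted set. -/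
theorem error_edgeCountTest_le {N K : ℕ} {p q : ℝ} (hK : K ≤ N) (hq : 0 ≤ q) (hqp : q ≤ p)
    (hp : p ≤ 1) {Δ : ℝ} (hΔ : Δ = K.choose 2 * (p - q)) (hΔ0 : 0 < Δ) :
    (edgeCountTest N ⌊2 * (N.choose 2 * q + Δ / 2)⌋₊).error (erdosRenyi N q)
      (plantedDense N K p q) ≤ 8 * (N.choose 2 * q) / Δ ^ 2 + 4 / Δ := by
  classical
  set c := ⌊2 * (N.choose 2 * q + Δ / 2)⌋₊ with hc
  have hM : 0 ≤ (N.choose 2 : ℝ) * q := by positivity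
  have hcx : ∀ x : VertexPair N → Bool, c < 2 * bitCount x ↔
      N.choose 2 * q + Δ / 2 < ∑ e, if x e then (1 : ℝ) else 0 := by
    intro x
    rw [hc, Nat.floor_lt (by positivity), ← bitCount_cast]
    push_cast
    constructor <;> intro h <;> linarith
  have h0 : ∑ G, erdosRenyi N q G * (edgeCountTest N c).prob true G ≤
      (N.choose 2 * q) / (Δ / 2) ^ 2 := by
    have hsum : ∑ e : VertexPair N, q = N.choose 2 * q := by
      rw [Finset.sum_const, Finset.card_univ, card_vertexPair, nsmul_eq_mul]
    have := sum_bernoulliMass_tail_le (w := fun _ : VertexPair N => q) (fun _ => hq)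
      (fun _ => hqp.trans hp) (half_pos hΔ0) {x | c < 2 * bitCount x} (fun x hx => by
        rw [Set.mem_ofPred_eq, hcx] at hx
        rw [hsum]
        exact le_abs.2 (Or.inl (by linarith)))
    rw [hsum] at this
    refine le_trans (le_of_eq ?_) this
    rw [← sum_graph_eq_sum_bits (fun x => if x ∈ {x : VertexPair N → Bool | c < 2 * bitCount x} then
      bernoulliMass (fun _ => q) x else 0)]
    refine Finset.sum_congr rfl fun G _ => ?_
    rw [prob_edgeCountTest, erdosRenyi, edgeMass_eq_bernoulliMass]
    simp
  have h1 : ∑ G, plantedDense N K p q G * (edgeCountTest N c).prob false G ≤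
      (N.choose 2 * q + Δ) / (Δ / 2) ^ 2 := by
    have hch : (0 : ℝ) < N.choose K := by exact_mod_cast Nat.choose_pos hK
    simp only [plantedDense, div_mul_eq_mul_div]
    rw [← Finset.sum_div, div_le_iff₀ hch]
    simp_rw [Finset.sum_mul]
    rw [Finset.sum_comm]
    have hcard : (N.choose K : ℝ) = (Finset.powersetCard K (Finset.univ : Finset (Fin N))).card := by
      simp
    rw [hcard, mul_comm, ← nsmul_eq_mul]
    refine Finset.sum_le_card_nsmul _ _ _ fun S hS => ?_
    have hsum := sum_plantedWeight S p q
    rw [(Finset.mem_powersetCard.1 hS).2, ← hΔ] at hsum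
    have := sum_bernoulliMass_tail_le
      (w := fun e : VertexPair N => if ∀ v ∈ e.1, v ∈ S then p else q)
      (fun _ => by split_ifs <;> linarith) (fun _ => by split_ifs <;> linarith) (half_pos hΔ0)
      {x | ¬ c < 2 * bitCount x} (fun x hx => by
        rw [Set.mem_ofPred_eq, hcx, not_lt] at hx
        rw [hsum]
        exact le_abs.2 (Or.inr (by linarith)))
    rw [hsum] at this
    refine le_trans (le_of_eq ?_) this
    rw [← sum_graph_eq_sum_bits (fun x =>
      if x ∈ {x : VertexPair N → Bool | ¬ c < 2 * bitCount x} then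
      bernoulliMass (fun e : VertexPair N => if ∀ v ∈ e.1, v ∈ S then p else q) x else 0)]
    refine Finset.sum_congr rfl fun G _ => ?_
    rw [prob_edgeCountTest, edgeMass_eq_bernoulliMass]
    simp
  unfold Test.error
  refine (add_le_add h0 h1).trans (le_of_eq ?_)
  field_simp
  ring

theorem RandomizedRAM.Test.prob_nonneg {n : ℕ} (A : Test n) (b : Bool) (G : SimpleGraph (Fin n)) :
    0 ≤ A.prob b G := div_nonneg (Nat.cast_nonneg _) (by positivity)

theorem RandomizedRAM.Test.prob_false {n : ℕ} (A : Test n) (G : SimpleGraph (Fin n)) :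
    A.prob false G = 1 - A.prob true G := by
  unfold Test.prob
  rw [eq_sub_iff_add_eq, ← add_div, div_eq_one_iff_eq (by positivity), ← Nat.cast_add]
  have := Finset.card_filter_add_card_filter_not
    (s := (Finset.univ : Finset (Fin A.time → Bool))) (fun ω => A.output G ω = false)
  simp only [Bool.not_eq_false] at this
  rw [this]
  simp

theorem RandomizedRAM.Test.error_nonneg {n : ℕ} (A : Test n) {H₀ H₁ : SimpleGraph (Fin n) → ℝ}
    (h₀ : ∀ G, 0 ≤ H₀ G) (h₁ : ∀ G, 0 ≤ H₁ G) : 0 ≤ A.error H₀ H₁ :=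
  add_nonneg (Finset.sum_nonneg fun G _ => mul_nonneg (h₀ G) (A.prob_nonneg _ G))
    (Finset.sum_nonneg fun G _ => mul_nonneg (h₁ G) (A.prob_nonneg _ G))

theorem tendsto_zero_of_log_div {u L : ℕ → ℝ} {c : ℝ} (hu : ∀ᶠ n in atTop, 0 < u n)
    (hL : Tendsto L atTop atTop) (hc : c < 0)
    (h : Tendsto (fun n => Real.log (u n) / L n) atTop (𝓝 c)) : Tendsto u atTop (𝓝 0) := by
  have h1 : Tendsto (fun n => Real.exp (Real.log (u n) / L n * L n)) atTop (𝓝 0) :=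
    Real.tendsto_exp_atBot.comp (h.neg_mul_atTop hc hL)
  refine h1.congr' ?_
  filter_upwards [hu, hL.eventually_gt_atTop 0] with n hn hLn
  rw [div_mul_cancel₀ _ hLn.ne', Real.exp_log hn]

theorem choose_two_le_sq (n : ℕ) : (n.choose 2 : ℝ) ≤ n ^ 2 := by
  rw [Nat.cast_choose_two]
  nlinarith [Nat.cast_nonneg (α := ℝ) n]

/-- Only two quantities have to vanish, `N ^ 2 q / (K ^ 4 (p - q) ^ 2)` and `1 / (K ^ 2 (p - q))`;
both are negative powers of `N` on the logarithmic scale. -/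
theorem exists_tests_of_regime {α β γ : ℝ} (hα : α < 2) (hβ1 : 0 < β)
    (hβ : 1 / 2 + γ / 2 - α / 4 < β) {N K : ℕ → ℕ} {p q : ℕ → ℝ}
    (h : PDSRegime α γ β N K p q) :
    ∃ φ : ∀ n, Test (N n), PolynomialTime φ ∧ asymptoticErrorPDS φ K p q = 0 := by
  obtain ⟨hN, hK0, hKN, hq0, hqp, hp1, hlq, hld, hlK⟩ := h
  set Δ : ℕ → ℝ := fun n => (K n).choose 2 * (p n - q n) with hΔ
  have hd0 : ∀ n, 0 < p n - q n := fun n => sub_pos.2 (hqp n)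
  set c : ℕ → ℕ := fun n => ⌊2 * ((N n).choose 2 * q n + Δ n / 2)⌋₊ with hc
  refine ⟨fun n => edgeCountTest (N n) (c n), ⟨(.X ^ 2 + 3) * (6 * .X ^ 2 + 3), fun n => ?_⟩, ?_⟩
  -- The threshold is written into the program, so it must be polynomially bounded as well.
  · have hcn : c n ≤ 4 * (N n * N n) := by
      refine Nat.floor_le_of_le ?_
      have h1 := choose_two_le_sq (N n)
      have h2 : ((K n).choose 2 : ℝ) ≤ (N n).choose 2 := by
        exact_mod_cast Nat.choose_le_choose 2 (hKN n)
      have h3 : Δ n ≤ (N n).choose 2 * 1 :=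
        mul_le_mul h2 (by linarith [hp1 n, hq0 n]) (hd0 n).le (Nat.cast_nonneg _)
      have h4 : (N n).choose 2 * q n ≤ (N n).choose 2 * 1 :=
        mul_le_mul_of_nonneg_left (by linarith [hp1 n, hqp n]) (Nat.cast_nonneg _)
      push_cast
      nlinarith [sq_nonneg (N n : ℝ)]
    have e : Polynomial.eval (N n) ((Polynomial.X ^ 2 + 3) * (6 * Polynomial.X ^ 2 + 3) :
        Polynomial ℕ) = (N n * N n + 3) * (6 * (N n * N n) + 3) := by
      simp [sq]
    rw [e]
    constructor
    · simp only [edgeCountTest, length_edgeCountProgram]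
      nlinarith [Nat.zero_le (N n * N n)]
    · refine (size_edgeCountProgram_le _ _).trans (Nat.mul_le_mul_left _ ?_)
      omega
  · have hL : Tendsto (fun n => Real.log (N n)) atTop atTop :=
      Real.tendsto_log_atTop.comp (tendsto_natCast_atTop_atTop.comp hN)
    -- From `2 β > 1 + γ - α / 2` and `α < 2`: the expected surplus of edges diverges.
    have hβ0 : 0 < 2 * β - γ := by linarith
    have hLpos := hL.eventually_gt_atTop 0
    -- A planted set of one vertex contains no pair; `K = 1` would make the logarithmic ratio `0`,
    -- against `β > 0`.
    have hK2 : ∀ᶠ n in atTop, 1 < K n := by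
      filter_upwards [hlK.eventually_const_lt hβ1] with n hn
      by_contra hcon
      have hK1 : K n = 1 := le_antisymm (not_lt.1 hcon) (hK0 n)
      rw [hK1] at hn
      simp at hn
    have hA : Tendsto (fun n => (N n : ℝ) ^ 2 * q n / ((K n : ℝ) ^ 4 * (p n - q n) ^ 2)) atTop
        (𝓝 0) := by
      refine tendsto_zero_of_log_div (c := 2 - α - (4 * β - 2 * γ)) ?_ hL (by linarith) ?_
      · filter_upwards [hN.eventually_gt_atTop 0] with n hn
        have := hK0 n
        have := hq0 n
        have := hd0 n
        positivity
      · have := ((tendsto_const_nhds (x := (2 : ℝ)) (f := atTop)).sub hlq).sub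
          ((hlK.const_mul 4).sub (hld.const_mul 2))
        refine this.congr' ?_
        filter_upwards [hN.eventually_gt_atTop 0, hLpos] with n hn hLn
        have hNn : (N n : ℝ) ≠ 0 := by positivity
        have hKn : (K n : ℝ) ≠ 0 := by have := hK0 n; positivity
        have hdn := (hd0 n).ne'
        have hqn := (hq0 n).ne'
        rw [Real.log_div (by positivity) (by positivity), Real.log_mul (by positivity) hqn,
          Real.log_mul (by positivity) (by positivity), Real.log_pow, Real.log_pow, Real.log_pow,
          Real.log_inv, Real.log_inv]
        field_simp
        push_cast
        ring
    have hB : Tendsto (fun n => 1 / ((K n : ℝ) ^ 2 * (p n - q n))) atTop (𝓝 0) := by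
      refine tendsto_zero_of_log_div (c := -(2 * β - γ)) ?_ hL (by linarith) ?_
      · refine Eventually.of_forall fun n => ?_
        have := hK0 n
        have := hd0 n
        positivity
      · refine ((hlK.const_mul 2).sub hld).neg.congr' ?_
        filter_upwards [hLpos] with n hLn
        have hKn : (K n : ℝ) ≠ 0 := by have := hK0 n; positivity
        have hdn := (hd0 n).ne'
        rw [one_div, Real.log_inv (_ * _), Real.log_mul (by positivity) hdn, Real.log_pow,
          Real.log_inv]
        field_simp
        push_cast
        ring
    refine Tendsto.limsup_eq ?_
    have hbound : Tendsto (fun n => 128 * ((N n : ℝ) ^ 2 * q n /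
        ((K n : ℝ) ^ 4 * (p n - q n) ^ 2)) + 16 * (1 / ((K n : ℝ) ^ 2 * (p n - q n)))) atTop
        (𝓝 0) := by
      simpa using (hA.const_mul 128).add (hB.const_mul 16)
    refine tendsto_of_tendsto_of_tendsto_of_le_of_le' tendsto_const_nhds hbound
      (Eventually.of_forall fun n => ?_) ?_
    · have h1 := (hqp n).le
      have h2 := (hq0 n).le
      have h3 := hp1 n
      exact Test.error_nonneg _ (erdosRenyi_nonneg h2 (by linarith))
        (plantedDense_nonneg (by linarith) h3 h2 (by linarith))
    · filter_upwards [hK2] with n hn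
      have hd := hd0 n
      have hK2' : (2 : ℝ) ≤ K n := by exact_mod_cast hn
      have hch : (K n : ℝ) ^ 2 / 4 ≤ (K n).choose 2 := by
        rw [Nat.cast_choose_two]
        nlinarith
      have hΔn : (K n : ℝ) ^ 2 / 4 * (p n - q n) ≤ Δ n := mul_le_mul_of_nonneg_right hch hd.le
      have hpos : 0 < (K n : ℝ) ^ 2 / 4 * (p n - q n) := by positivity
      refine (error_edgeCountTest_le (hKN n) (hq0 n).le (hqp n).le (hp1 n) rfl
        (hpos.trans_le hΔn)).trans ?_
      have h1 : 8 * ((N n).choose 2 * q n) / Δ n ^ 2 ≤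
          8 * ((N n : ℝ) ^ 2 * q n) / ((K n : ℝ) ^ 2 / 4 * (p n - q n)) ^ 2 := by
        have := hq0 n
        have := choose_two_le_sq (N n)
        gcongr
      have h2 : 4 / Δ n ≤ 4 / ((K n : ℝ) ^ 2 / 4 * (p n - q n)) := by gcongr
      refine (add_le_add h1 h2).trans (le_of_eq ?_)
      field_simp
      ring

/-! ### Distances between mass functions -/

/-- The `ℓ¹` distance is subadditive under products. -/
theorem sum_abs_prod_sub_prod_le {ι : Type*} [Fintype ι] [DecidableEq ι] {κ : ι → Type*}
    [∀ i, Fintype (κ i)] {μ ν : ∀ i, κ i → ℝ} (hμ : ∀ i b, 0 ≤ μ i b) (hν : ∀ i b, 0 ≤ ν i b)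
    (hμ1 : ∀ i, ∑ b, μ i b = 1) (hν1 : ∀ i, ∑ b, ν i b = 1) :
    ∑ x : ∀ i, κ i, |∏ i, μ i (x i) - ∏ i, ν i (x i)| ≤ ∑ i, ∑ b, |μ i b - ν i b| := by
  -- Telescoping: the factors are changed from `ν` to `μ` one at a time, the others having total
  -- mass one.
  suffices H : ∀ s : Finset ι, ∑ x : ∀ i, κ i,
      |∏ i, (if i ∈ s then μ i (x i) else ν i (x i)) - ∏ i, ν i (x i)| ≤
        ∑ i ∈ s, ∑ b, |μ i b - ν i b| by
    simpa using H Finset.univ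
  intro s
  induction s using Finset.induction_on with
  | empty => simp
  | insert a s ha ih =>
    rw [Finset.sum_insert ha]
    have step : ∑ x : ∀ i, κ i, |∏ i, (if i ∈ insert a s then μ i (x i) else ν i (x i)) -
        ∏ i, (if i ∈ s then μ i (x i) else ν i (x i))| = ∑ b, |μ a b - ν a b| := by
      have h1 : ∀ x : ∀ i, κ i, |∏ i, (if i ∈ insert a s then μ i (x i) else ν i (x i)) -
          ∏ i, (if i ∈ s then μ i (x i) else ν i (x i))| =
          ∏ i, (if i = a then |μ i (x i) - ν i (x i)| else
            if i ∈ s then μ i (x i) else ν i (x i)) := by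
        intro x
        rw [← Finset.mul_prod_erase _ _ (Finset.mem_univ a),
          ← Finset.mul_prod_erase _ (fun i => if i ∈ s then μ i (x i) else ν i (x i))
            (Finset.mem_univ a),
          ← Finset.mul_prod_erase _ (fun i => if i = a then |μ i (x i) - ν i (x i)| else
            if i ∈ s then μ i (x i) else ν i (x i)) (Finset.mem_univ a)]
        have h2 : ∏ i ∈ Finset.univ.erase a, (if i ∈ insert a s then μ i (x i) else ν i (x i)) =
            ∏ i ∈ Finset.univ.erase a, (if i ∈ s then μ i (x i) else ν i (x i)) := by
          refine Finset.prod_congr rfl fun i hi => ?_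
          simp [Finset.ne_of_mem_erase hi]
        have h3 : ∏ i ∈ Finset.univ.erase a, (if i = a then |μ i (x i) - ν i (x i)| else
            if i ∈ s then μ i (x i) else ν i (x i)) =
            ∏ i ∈ Finset.univ.erase a, (if i ∈ s then μ i (x i) else ν i (x i)) := by
          refine Finset.prod_congr rfl fun i hi => ?_
          simp [Finset.ne_of_mem_erase hi]
        rw [h2, h3, ← sub_mul, abs_mul, if_pos (Finset.mem_insert_self a s), if_neg ha, if_pos rfl,
          abs_of_nonneg (a := ∏ i ∈ Finset.univ.erase a, _)]
        exact Finset.prod_nonneg fun i _ => by split_ifs <;> [exact hμ i _; exact hν i _]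
      simp_rw [h1]
      rw [sum_pi_prod (fun i b => if i = a then |μ i b - ν i b| else
            if i ∈ s then μ i b else ν i b), Finset.prod_eq_single a]
      · simp
      · intro i _ hi
        simp only [if_neg hi]
        split_ifs
        exacts [hμ1 i, hν1 i]
      · simp
    refine le_trans ?_ (add_le_add step.le ih)
    rw [← Finset.sum_add_distrib]
    exact Finset.sum_le_sum fun x _ => abs_sub_le _ _ _

/-- A mass function close to `P` and dominated by `2 * Q`. -/
theorem exists_dominated_mass {X : Type*} [Fintype X] {P Q : X → ℝ} (hP : ∀ x, 0 ≤ P x)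
    (hQ : ∀ x, 0 ≤ Q x) (hP1 : ∑ x, P x = 1) (hQ1 : ∑ x, Q x = 1) :
    ∃ A B : X → ℝ, (∀ x, 0 ≤ A x) ∧ (∀ x, 0 ≤ B x) ∧ ∑ x, A x = 1 ∧ ∑ x, B x = 1 ∧
      (∀ x, A x + B x = 2 * Q x) ∧ ∑ x, |A x - P x| ≤ 2 * ∑ x, max (P x - 2 * Q x) 0 := by
  set δ := ∑ x, max (P x - 2 * Q x) 0 with hδ
  have hδ0 : 0 ≤ δ := Finset.sum_nonneg fun x _ => le_max_right _ _
  have hgap : ∑ x, max (2 * Q x - P x) 0 = 1 + δ := by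
    have : ∀ x, max (2 * Q x - P x) 0 = 2 * Q x - P x + max (P x - 2 * Q x) 0 := by
      intro x
      rcases le_total (P x) (2 * Q x) with h | h
      · rw [max_eq_left (by linarith), max_eq_right (by linarith), add_zero]
      · rw [max_eq_right (by linarith), max_eq_left (by linarith)]
        ring
    simp_rw [this]
    rw [Finset.sum_add_distrib, Finset.sum_sub_distrib, ← Finset.mul_sum, hP1, hQ1]
    ring
  -- `A` truncates `P` at `2 * Q` and spreads the removed mass `δ` over the room `2 * Q - P` below
  -- the cap. That room has total mass `1 + δ`, so the fraction `ρ` of it is needed, and `ρ ≤ 1`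
  -- keeps `A ≤ 2 * Q`.
  set ρ := δ / (1 + δ) with hρ
  have hρ0 : 0 ≤ ρ := by positivity
  have hρ1 : ρ ≤ 1 := (div_le_one (by positivity)).2 (by linarith)
  have hρδ : ρ * (1 + δ) = δ := div_mul_cancel₀ _ (by positivity)
  let A : X → ℝ := fun x => P x - max (P x - 2 * Q x) 0 + ρ * max (2 * Q x - P x) 0
  have hA0 : ∀ x, 0 ≤ A x := by
    intro x
    have h1 : max (P x - 2 * Q x) 0 ≤ P x := max_le (by linarith [hQ x]) (hP x)
    have h2 : 0 ≤ ρ * max (2 * Q x - P x) 0 := mul_nonneg hρ0 (le_max_right _ _)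
    simp only [A]
    linarith
  have hA2 : ∀ x, A x ≤ 2 * Q x := by
    intro x
    have h2 : ρ * max (2 * Q x - P x) 0 ≤ 1 * max (2 * Q x - P x) 0 :=
      mul_le_mul_of_nonneg_right hρ1 (le_max_right _ _)
    simp only [A]
    rcases le_total (P x) (2 * Q x) with h | h
    · rw [max_eq_left (a := 2 * Q x - P x) (by linarith)] at h2 ⊢
      rw [max_eq_right (a := P x - 2 * Q x) (by linarith)]
      linarith
    · rw [max_eq_right (a := 2 * Q x - P x) (by linarith)] at h2 ⊢
      rw [max_eq_left (a := P x - 2 * Q x) (by linarith)]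
      linarith
  have hA1 : ∑ x, A x = 1 := by
    simp only [A]
    rw [Finset.sum_add_distrib, Finset.sum_sub_distrib, ← Finset.mul_sum, hgap, hP1, hρδ, ← hδ]
    ring
  refine ⟨A, fun x => 2 * Q x - A x, hA0, fun x => sub_nonneg.2 (hA2 x), hA1, ?_, fun x => by ring,
    ?_⟩
  · rw [Finset.sum_sub_distrib, ← Finset.mul_sum, hQ1, hA1]
    norm_num
  · calc ∑ x, |A x - P x| ≤ ∑ x, (max (P x - 2 * Q x) 0 + ρ * max (2 * Q x - P x) 0) := by
          refine Finset.sum_le_sum fun x _ => ?_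
          have h1 : 0 ≤ max (P x - 2 * Q x) 0 := le_max_right _ _
          have h2 : 0 ≤ ρ * max (2 * Q x - P x) 0 := mul_nonneg hρ0 (le_max_right _ _)
          simp only [A]
          rw [abs_le]
          constructor <;> linarith
      _ = 2 * δ := by
          rw [Finset.sum_add_distrib, ← Finset.mul_sum, hgap, hρδ, ← hδ]
          ring

/-! ### Likelihood ratio moments and χ² bounds -/

theorem exp_le_one_add_add_sq {x : ℝ} (hx : |x| ≤ 1) : Real.exp x ≤ 1 + x + x ^ 2 := by
  have := (abs_le.1 (Real.abs_exp_sub_one_sub_id_le hx)).2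
  linarith

/-- The `r`-th moment of the likelihood ratio of two Bernoulli laws. -/
theorem bernoulli_moment_le {q d : ℝ} {r : ℕ} (hq : 0 < q) (hq2 : q ≤ 1 / 2) (hd : 0 ≤ d)
    (hrd : r * d ≤ q) (hd1 : d ≤ q) :
    q * ((q + d) / q) ^ r + (1 - q) * ((1 - (q + d)) / (1 - q)) ^ r ≤
      1 + r ^ 2 * (2 * d ^ 2 / q) := by
  have hq1 : 0 < 1 - q := by linarith
  have hx : (r : ℝ) * (d / q) ≤ 1 := by
    rw [← mul_div_assoc, div_le_one hq]
    exact hrd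
  have hx0 : 0 ≤ (r : ℝ) * (d / q) := by positivity
  have hy : (r : ℝ) * (d / (1 - q)) ≤ 1 := by
    rw [← mul_div_assoc, div_le_one hq1]
    linarith
  have hy0 : 0 ≤ (r : ℝ) * (d / (1 - q)) := by positivity
  have h1 : ((q + d) / q) ^ r ≤ 1 + r * (d / q) + (r * (d / q)) ^ 2 := by
    refine le_trans ?_ (exp_le_one_add_add_sq (abs_le.2 ⟨by linarith, hx⟩))
    rw [Real.exp_nat_mul]
    refine pow_le_pow_left₀ (by positivity) ?_ r
    rw [add_div, div_self hq.ne']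
    linarith [Real.add_one_le_exp (d / q)]
  have h2 : ((1 - (q + d)) / (1 - q)) ^ r ≤
      1 + -(r * (d / (1 - q))) + (-(r * (d / (1 - q)))) ^ 2 := by
    refine le_trans ?_ (exp_le_one_add_add_sq (abs_le.2 ⟨by linarith, by linarith⟩))
    rw [← mul_neg, Real.exp_nat_mul]
    refine pow_le_pow_left₀ (div_nonneg (by linarith) hq1.le) ?_ r
    have : (1 - (q + d)) / (1 - q) = -(d / (1 - q)) + 1 := by
      field_simp
      ring
    rw [this]
    exact Real.add_one_le_exp _
  have h3 : d ^ 2 / (1 - q) ≤ d ^ 2 / q := by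
    gcongr
    linarith
  -- The first-order terms `r * d` and `-r * d` cancel, leaving a quadratic excess over `1`.
  calc _ ≤ q * (1 + r * (d / q) + (r * (d / q)) ^ 2) +
        (1 - q) * (1 + -(r * (d / (1 - q))) + (-(r * (d / (1 - q)))) ^ 2) := by gcongr
    _ = 1 + r ^ 2 * (d ^ 2 / q + d ^ 2 / (1 - q)) := by
        field_simp
        ring
    _ ≤ 1 + r ^ 2 * (d ^ 2 / q + d ^ 2 / q) := by gcongr
    _ = _ := by ring

/-- The mass which a product of Bernoulli laws of parameter `q + d` puts above twice the one of
parameter `q`. -/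
theorem bernoulliMass_excess_le {F : Type*} [Fintype F] [DecidableEq F] {q d : ℝ} {r m : ℕ}
    (hq : 0 < q) (hq2 : q ≤ 1 / 4) (hd : 0 ≤ d) (hrd : (r + 1) * d ≤ q)
    (hm : Fintype.card F ≤ m) :
    ∑ x : F → Bool, max (bernoulliMass (fun _ => q + d) x - 2 * bernoulliMass (fun _ => q) x) 0 ≤
      Real.exp (m * ((r + 1) ^ 2 * (2 * d ^ 2 / q))) / 2 ^ r := by
  have hdq : d ≤ q := le_trans (by nlinarith [Nat.cast_nonneg (α := ℝ) r]) hrd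
  have hQ : ∀ x : F → Bool, 0 < bernoulliMass (fun _ => q) x :=
    bernoulliMass_pos (fun _ => hq) (fun _ => by linarith)
  have hP : ∀ x : F → Bool, 0 < bernoulliMass (fun _ => q + d) x :=
    bernoulliMass_pos (fun _ => by linarith) (fun _ => by linarith)
  -- Where `P > 2 Q`, the factor `(P / (2 Q)) ^ r` is at least `1`, so the excess is at most `P (P /
  -- (2 Q)) ^ r = Q (P / Q) ^ (r + 1) / 2 ^ r`, whose sum is a product of one-bit moments.
  have h1 : ∀ x : F → Bool,
      max (bernoulliMass (fun _ => q + d) x - 2 * bernoulliMass (fun _ => q) x) 0 ≤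
      bernoulliMass (fun _ => q) x * (∏ i, (if x i then ((q + d) / q) ^ (r + 1) else
        ((1 - (q + d)) / (1 - q)) ^ (r + 1))) / 2 ^ r := by
    intro x
    have e : ∏ i, (if x i then ((q + d) / q) ^ (r + 1) else ((1 - (q + d)) / (1 - q)) ^ (r + 1)) =
        (bernoulliMass (fun _ => q + d) x / bernoulliMass (fun _ => q) x) ^ (r + 1) := by
      unfold bernoulliMass
      rw [← Finset.prod_div_distrib, ← Finset.prod_pow]
      refine Finset.prod_congr rfl fun i _ => ?_
      split_ifs <;> rfl
    rw [e]
    set a := bernoulliMass (fun _ => q + d) x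
    set b := bernoulliMass (fun _ => q) x
    have ha : 0 < a := hP x
    have hb : 0 < b := hQ x
    refine max_le ?_ (by positivity)
    rcases le_or_gt a (2 * b) with h | h
    · have : 0 ≤ b * (a / b) ^ (r + 1) / 2 ^ r := by positivity
      linarith
    · have h2 : b * (a / b) ^ (r + 1) / 2 ^ r = a * ((a / b) / 2) ^ r := by
        rw [div_pow (a / b), pow_succ]
        field_simp
      rw [h2]
      have h3 : 1 ≤ (a / b) / 2 := by
        rw [div_div, one_le_div (by positivity)]
        linarith
      have h4 := one_le_pow₀ h3 (n := r)
      nlinarith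
  refine (Finset.sum_le_sum fun x _ => h1 x).trans ?_
  rw [← Finset.sum_div]
  refine div_le_div_of_nonneg_right ?_ (by positivity)
  rw [sum_bernoulliMass_mul_prod _ (fun i b => if b then ((q + d) / q) ^ (r + 1) else
        ((1 - (q + d)) / (1 - q)) ^ (r + 1))]
  simp only [if_true, Bool.false_eq_true, if_false, Finset.prod_const, Finset.card_univ]
  have h2 := bernoulli_moment_le (r := r + 1) hq (by linarith) hd (by push_cast; exact hrd) hdq
  push_cast at h2
  set y := ((r : ℝ) + 1) ^ 2 * (2 * d ^ 2 / q)
  have hy : 0 ≤ y := by positivity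
  have h3 : 0 ≤ q * ((q + d) / q) ^ (r + 1) + (1 - q) * ((1 - (q + d)) / (1 - q)) ^ (r + 1) := by
    have : 0 ≤ (1 - (q + d)) / (1 - q) := div_nonneg (by linarith) (by linarith)
    have : 0 ≤ 1 - q := by linarith
    positivity
  calc _ ≤ (Real.exp y) ^ Fintype.card F := by
        refine pow_le_pow_left₀ h3 (h2.trans ?_) _
        linarith [Real.add_one_le_exp y]
    _ = Real.exp (Fintype.card F * y) := (Real.exp_nat_mul _ _).symm
    _ ≤ _ := by
        refine Real.exp_le_exp.2 (mul_le_mul_of_nonneg_right ?_ hy)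
        exact_mod_cast hm

/-- The `χ²` bound for a mixture of product Bernoulli laws. -/
theorem sq_sum_abs_mixture_le {ι J : Type*} [Fintype ι] [DecidableEq ι] [Fintype J] [Nonempty J]
    {w : ι → ℝ} (h0 : ∀ i, 0 < w i) (h1 : ∀ i, w i < 1) (W : J → ι → ℝ) :
    (∑ x, |bernoulliMass w x - (∑ j, bernoulliMass (W j) x) / Fintype.card J|) ^ 2 ≤
      (∑ j, ∑ j', ∏ i, (1 + (W j i - w i) * (W j' i - w i) / (w i * (1 - w i)))) /
        Fintype.card J ^ 2 - 1 := by
  have hJ : (Fintype.card J : ℝ) ≠ 0 := by positivity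
  have hP := bernoulliMass_pos h0 h1
  have hpair : ∀ j j', ∑ x, bernoulliMass (W j) x * bernoulliMass (W j') x / bernoulliMass w x =
      ∏ i, (1 + (W j i - w i) * (W j' i - w i) / (w i * (1 - w i))) := by
    intro j j'
    have : ∀ x : ι → Bool,
        bernoulliMass (W j) x * bernoulliMass (W j') x / bernoulliMass w x =
        ∏ i, (if x i then W j i * W j' i / w i else (1 - W j i) * (1 - W j' i) / (1 - w i)) := by
      intro x
      unfold bernoulliMass
      rw [← Finset.prod_mul_distrib, ← Finset.prod_div_distrib]
      refine Finset.prod_congr rfl fun i _ => ?_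
      split_ifs <;> rfl
    simp_rw [this]
    rw [sum_bool_prod (fun i b => if b then W j i * W j' i / w i else
      (1 - W j i) * (1 - W j' i) / (1 - w i))]
    refine Finset.prod_congr rfl fun i _ => ?_
    have := (h0 i).ne'
    have : 1 - w i ≠ 0 := by linarith [h1 i]
    simp only [if_true, Bool.false_eq_true, if_false]
    field_simp
    ring
  -- Cauchy–Schwarz with weight `bernoulliMass w` bounds the squared `ℓ¹` distance by the `χ²`
  -- divergence; expanding the square gives pair correlations which factorise over the bits.
  have hcs := Finset.sq_sum_div_le_sum_sq_div Finset.univ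
    (fun x : ι → Bool => |bernoulliMass w x - (∑ j, bernoulliMass (W j) x) / Fintype.card J|)
    (g := fun x => bernoulliMass w x) (fun x _ => hP x)
  rw [sum_bernoulliMass, div_one] at hcs
  refine hcs.trans (le_of_eq ?_)
  have hx : ∀ x, |bernoulliMass w x - (∑ j, bernoulliMass (W j) x) / Fintype.card J| ^ 2 /
      bernoulliMass w x = bernoulliMass w x - 2 * ((∑ j, bernoulliMass (W j) x) / Fintype.card J) +
      (∑ j, ∑ j', bernoulliMass (W j) x * bernoulliMass (W j') x / bernoulliMass w x) /
        Fintype.card J ^ 2 := by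
    intro x
    have hne := (hP x).ne'
    simp_rw [← Finset.sum_div]
    rw [← Finset.sum_mul_sum, sq_abs]
    field_simp
    ring
  simp_rw [hx]
  rw [Finset.sum_add_distrib, Finset.sum_sub_distrib, ← Finset.mul_sum, ← Finset.sum_div,
    ← Finset.sum_div, sum_bernoulliMass, Finset.sum_comm]
  simp_rw [sum_bernoulliMass]
  rw [Finset.sum_comm]
  have : ∀ j, ∑ x, ∑ j', bernoulliMass (W j) x * bernoulliMass (W j') x / bernoulliMass w x =
      ∑ j', ∏ i, (1 + (W j i - w i) * (W j' i - w i) / (w i * (1 - w i))) := by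
    intro j
    rw [Finset.sum_comm]
    exact Finset.sum_congr rfl fun j' _ => hpair j j'
  simp_rw [this]
  rw [Finset.sum_const, Finset.card_univ, nsmul_eq_mul, mul_one, div_self hJ]
  ring

/-- The `χ²` bound when the mixture lowers the weight by `d` on random sets `A j`. -/
theorem sq_sum_abs_mixture_lowered_le {ι J : Type*} [Fintype ι] [DecidableEq ι] [Fintype J]
    [Nonempty J] {w : ι → ℝ} (h0 : ∀ i, 0 < w i) (h1 : ∀ i, w i < 1) (A : J → Finset ι) {p d : ℝ}
    (hA : ∀ j, ∀ i ∈ A j, w i = p) {c : J → J → ℝ} (hc : ∀ j j', ((A j ∩ A j').card : ℝ) ≤ c j j')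
    (hc1 : ∀ j j', d ^ 2 / (p * (1 - p)) * c j j' ≤ 1) (hp : 0 < p) (hp1 : p < 1) :
    (∑ x, |bernoulliMass w x -
      (∑ j, bernoulliMass (fun i => if i ∈ A j then p - d else w i) x) / Fintype.card J|) ^ 2 ≤
      2 * (d ^ 2 / (p * (1 - p))) * (∑ j, ∑ j', c j j' / Fintype.card J ^ 2) := by
  have hJ : (Fintype.card J : ℝ) ≠ 0 := by positivity
  set μ := d ^ 2 / (p * (1 - p)) with hμ
  have hp2 : 0 < 1 - p := by linarith
  have hμ0 : 0 ≤ μ := by positivity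
  refine (sq_sum_abs_mixture_le h0 h1 _).trans ?_
  have h2 : ∀ j j', ∏ i, (1 + ((if i ∈ A j then p - d else w i) - w i) *
      ((if i ∈ A j' then p - d else w i) - w i) / (w i * (1 - w i))) ≤ 1 + 2 * μ * c j j' := by
    intro j j'
    -- Only bits lowered in both components are correlated, each contributing a factor `1 + μ`; so
    -- the size of the overlap of two random sets controls everything.
    have e : ∏ i, (1 + ((if i ∈ A j then p - d else w i) - w i) *
      ((if i ∈ A j' then p - d else w i) - w i) / (w i * (1 - w i))) =
      ∏ i, if i ∈ A j ∩ A j' then 1 + μ else 1 := by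
      refine Finset.prod_congr rfl fun i _ => ?_
      by_cases hi : i ∈ A j <;> by_cases hi' : i ∈ A j' <;> simp [hi, hi']
      rw [hA j i hi, hμ]
      ring
    rw [e, Finset.prod_ite_mem, Finset.univ_inter, Finset.prod_const]
    have hcard := hc j j'
    have hcc := hc1 j j'
    have hc0 : 0 ≤ μ * c j j' := mul_nonneg hμ0 ((Nat.cast_nonneg _).trans hcard)
    calc (1 + μ) ^ (A j ∩ A j').card ≤ Real.exp μ ^ (A j ∩ A j').card :=
          pow_le_pow_left₀ (by positivity) (by linarith [Real.add_one_le_exp μ]) _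
      _ = Real.exp ((A j ∩ A j').card * μ) := (Real.exp_nat_mul _ _).symm
      _ ≤ Real.exp (μ * c j j') := Real.exp_le_exp.2 (by
          rw [mul_comm]
          exact mul_le_mul_of_nonneg_left hcard hμ0)
      _ ≤ 1 + μ * c j j' + (μ * c j j') ^ 2 :=
          exp_le_one_add_add_sq (abs_le.2 ⟨by linarith, hcc⟩)
      _ ≤ _ := by nlinarith
  rw [sub_le_iff_le_add, div_le_iff₀ (by positivity)]
  refine (Finset.sum_le_sum fun j _ => Finset.sum_le_sum fun j' _ => h2 j j').trans
    (le_of_eq ?_)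
  simp_rw [Finset.sum_add_distrib, ← Finset.mul_sum, ← Finset.sum_div]
  rw [Finset.sum_const, Finset.sum_const, Finset.card_univ]
  simp only [nsmul_eq_mul, mul_one]
  field_simp
  ring

/-! ### Relabelling vertices -/

/-- The action of a permutation of the vertices on pairs. -/
def pairPerm {N : ℕ} (σ : Equiv.Perm (Fin N)) : Equiv.Perm (VertexPair N) where
  toFun e := ⟨e.1.map σ, fun h => e.2 ((Sym2.isDiag_map σ.injective).1 h)⟩
  invFun e := ⟨e.1.map σ.symm, fun h => e.2 ((Sym2.isDiag_map σ.symm.injective).1 h)⟩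
  left_inv e := Subtype.ext (by simp [Sym2.map_map])
  right_inv e := Subtype.ext (by simp [Sym2.map_map])

theorem pairPerm_coe {N : ℕ} (σ : Equiv.Perm (Fin N)) (e : VertexPair N) :
    (pairPerm σ e).1 = e.1.map σ := rfl

theorem bernoulliMass_comp {ι : Type*} [Fintype ι] (π : Equiv.Perm ι) (w : ι → ℝ) (x : ι → Bool) :
    bernoulliMass (fun i => w (π i)) (fun i => x (π i)) = bernoulliMass w x :=
  Equiv.prod_comp π fun i => if x i then w i else 1 - w i

theorem sum_comp_perm {ι : Type*} [Fintype ι] [DecidableEq ι] (π : Equiv.Perm ι)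
    (T : (ι → Bool) → ℝ) : ∑ x : ι → Bool, T (fun i => x (π i)) = ∑ x, T x :=
  (π.arrowCongr (Equiv.refl Bool)).symm.sum_comp T

/-- Averaging over the sets of a given size amounts to averaging over the images of one set. -/
theorem average_powersetCard_eq {N K : ℕ} (hKN : K ≤ N) (F : Finset (Fin N) → ℝ)
    (T : Finset (Fin N)) (hT : T.card = K) :
    (∑ S ∈ Finset.powersetCard K Finset.univ, F S) / (N.choose K : ℝ) =
      (∑ σ : Equiv.Perm (Fin N), F (Finset.univ.filter fun v => σ v ∈ T)) / (N.factorial : ℝ) := by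
  have h1 : ∀ τ : Equiv.Perm (Fin N), ∑ S ∈ Finset.powersetCard K Finset.univ, F S =
      ∑ S ∈ Finset.powersetCard K Finset.univ, F (Finset.univ.filter fun v => τ v ∈ S) := by
    intro τ
    refine Finset.sum_nbij' (fun S => S.map τ.toEmbedding)
      (fun S => S.map τ.symm.toEmbedding) ?_ ?_ ?_ ?_ ?_
    · intro S hS
      simpa using hS
    · intro S hS
      simpa using hS
    · intro S _
      ext v
      simp
    · intro S _
      ext v
      simp
    · intro S _
      congr 1
      ext v
      simp
  have h2 : ∀ S ∈ Finset.powersetCard K (Finset.univ : Finset (Fin N)),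
      ∑ τ : Equiv.Perm (Fin N), F (Finset.univ.filter fun v => τ v ∈ S) =
      ∑ τ : Equiv.Perm (Fin N), F (Finset.univ.filter fun v => τ v ∈ T) := by
    intro S hS
    have hcard : T.card = S.card := by rw [hT, (Finset.mem_powersetCard.1 hS).2]
    let e : {x // x ∈ T} ≃ {x // x ∈ S} := Finset.equivOfCardEq hcard
    have hρ : ∀ v, e.extendSubtype v ∈ S ↔ v ∈ T := by
      intro v
      constructor
      · intro hv
        by_contra hvT
        exact e.extendSubtype_not_mem v hvT hv
      · exact e.extendSubtype_mem v
    -- A permutation carrying `T` onto `S` is absorbed into the sum over all permutations.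
    rw [← Equiv.sum_comp (Equiv.mulLeft e.extendSubtype)]
    refine Finset.sum_congr rfl fun τ _ => ?_
    simp only [Equiv.coe_mulLeft, Equiv.Perm.mul_apply, hρ]
  have h3 : (N.factorial : ℝ) * ∑ S ∈ Finset.powersetCard K Finset.univ, F S =
      (N.choose K : ℝ) * ∑ τ : Equiv.Perm (Fin N), F (Finset.univ.filter fun v => τ v ∈ T) := by
    have h4 : ∑ _τ : Equiv.Perm (Fin N), ∑ S ∈ Finset.powersetCard K Finset.univ, F S =
        (N.factorial : ℝ) * ∑ S ∈ Finset.powersetCard K Finset.univ, F S := by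
      rw [Finset.sum_const, Finset.card_univ, Fintype.card_perm, Fintype.card_fin, nsmul_eq_mul]
    rw [← h4, Finset.sum_congr rfl fun τ _ => h1 τ, Finset.sum_comm, Finset.sum_congr rfl h2,
      Finset.sum_const, Finset.card_powersetCard, Finset.card_univ, Fintype.card_fin, nsmul_eq_mul]
  have h5 : (N.factorial : ℝ) ≠ 0 := by positivity
  have h6 : (N.choose K : ℝ) ≠ 0 := by exact_mod_cast (Nat.choose_pos hKN).ne'
  rw [div_eq_div_iff h6 h5]
  linarith

/-! ### Blow-ups: `n` blocks of `l` vertices -/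

section Blowup

variable {n l : ℕ}

/-- The block of a vertex of the blow-up. -/
def blockOf (v : Fin (n * l)) : Fin n := (finProdFinEquiv.symm v).1

/-- The position of a vertex of the blow-up in its block. -/
def columnOf (v : Fin (n * l)) : Fin l := (finProdFinEquiv.symm v).2

theorem blockOf_mk (b : Fin n) (s : Fin l) : blockOf (finProdFinEquiv (b, s)) = b := by
  simp [blockOf]

theorem mk_blockOf_columnOf (v : Fin (n * l)) :
    finProdFinEquiv (blockOf v, columnOf v) = v := finProdFinEquiv.apply_symm_apply v

open Classical in
/-- Pairs in the blow-up of `S` have weight `p`, except that the pairs inside blocks in `U` have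
weight `q`; all other pairs have weight `q`. -/
noncomputable def blockWeight (S U : Finset (Fin n)) (p q : ℝ) (e : Sym2 (Fin (n * l))) : ℝ :=
  if ∀ v ∈ e, blockOf v ∈ S then (if ∃ a ∈ U, ∀ v ∈ e, blockOf v = a then q else p) else q

/-- The random graph with weights `blockWeight` and randomly permuted vertices. -/
noncomputable def blockMixture (l : ℕ) (S U : Finset (Fin n)) (p q : ℝ)
    (x : VertexPair (n * l) → Bool) : ℝ :=
  (∑ σ : Equiv.Perm (Fin (n * l)),
    bernoulliMass (fun e : VertexPair (n * l) => blockWeight S U p q (pairPerm σ e).1) x) /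
      ((n * l).factorial : ℝ)

theorem card_blowup (S : Finset (Fin n)) :
    (Finset.univ.filter fun v : Fin (n * l) => blockOf v ∈ S).card = S.card * l := by
  have : (Finset.univ.filter fun v : Fin (n * l) => blockOf v ∈ S) =
      (S ×ˢ (Finset.univ : Finset (Fin l))).map finProdFinEquiv.toEmbedding := by
    ext v
    simp only [Finset.mem_filter, Finset.mem_univ, true_and, Finset.mem_map, Finset.mem_product,
      and_true, Equiv.coe_toEmbedding, Prod.exists]
    constructor
    · exact fun h => ⟨blockOf v, columnOf v, h, mk_blockOf_columnOf v⟩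
    · rintro ⟨b, s, h, rfl⟩
      rwa [blockOf_mk]
  rw [this, Finset.card_map, Finset.card_product, Finset.card_univ, Fintype.card_fin]

/-- Without modified blocks the mixture is the planted dense subgraph distribution. -/
theorem plantedDense_eq_blockMixture {k : ℕ} {S : Finset (Fin n)} (hS : S.card = k) (p q : ℝ)
    (G : SimpleGraph (Fin (n * l))) :
    plantedDense (n * l) (k * l) p q G = blockMixture l S ∅ p q (graphBits _ G) := by
  classical
  unfold plantedDense blockMixture
  have hk : k ≤ n := by
    rw [← hS]
    simpa using Finset.card_le_univ S
  rw [average_powersetCard_eq (Nat.mul_le_mul_right l hk) _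
    (Finset.univ.filter fun v : Fin (n * l) => blockOf v ∈ S) (by rw [card_blowup, hS])]
  congr 1
  refine Finset.sum_congr rfl fun σ _ => ?_
  rw [edgeMass_eq_bernoulliMass]
  congr 1
  ext e
  simp [blockWeight, pairPerm_coe, Sym2.mem_map]

/-- The permutation exchanging, in every column `s`, the block `a` with the block `j s`. -/
def columnSwap (a : Fin n) (j : Fin l → Fin n) : Equiv.Perm (Fin (n * l)) :=
  finProdFinEquiv.symm.trans
    (((Equiv.prodComm _ _).trans ((Equiv.prodShear (Equiv.refl (Fin l))
      fun s => Equiv.swap a (j s)).trans (Equiv.prodComm _ _))).trans finProdFinEquiv)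

theorem blockOf_columnSwap (a : Fin n) (j : Fin l → Fin n) (v : Fin (n * l)) :
    blockOf (columnSwap a j v) = Equiv.swap a (j (columnOf v)) (blockOf v) := by
  simp [columnSwap, blockOf, columnOf]

open Classical in
/-- The pairs with both vertices in the transversal `j`. -/
noncomputable def transversalPairs (j : Fin l → Fin n) : Finset (VertexPair (n * l)) :=
  Finset.univ.filter fun e => ∀ v ∈ e.1, blockOf v = j (columnOf v)

/-- The swap carries the transversal `j` onto block `a`. It moves vertices only between blocks of `S
\ U`, so it preserves the blow-up of `S` and fixes every block of `U`. -/
theorem blockWeight_columnSwap {S U : Finset (Fin n)} {a : Fin n} (haS : a ∈ S) (haU : a ∉ U)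
    {j : Fin l → Fin n} (hj : ∀ s, j s ∈ S \ U) (p q : ℝ) (e : VertexPair (n * l)) :
    blockWeight S (insert a U) p q (pairPerm (columnSwap a j) e).1 =
      if e ∈ transversalPairs j then q else blockWeight S U p q e.1 := by
  classical
  have hjS : ∀ s, j s ∈ S := fun s => (Finset.mem_sdiff.1 (hj s)).1
  have hjU : ∀ s, j s ∉ U := fun s => (Finset.mem_sdiff.1 (hj s)).2
  have h1 : ∀ v : Fin (n * l), blockOf (columnSwap a j v) ∈ S ↔ blockOf v ∈ S := by
    intro v
    rw [blockOf_columnSwap, Equiv.swap_apply_def]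
    split_ifs with h h'
    · simp [h, haS, hjS]
    · simp [h', haS, hjS]
    · rfl
  have h2 : ∀ v : Fin (n * l), blockOf (columnSwap a j v) = a ↔ blockOf v = j (columnOf v) := by
    intro v
    rw [blockOf_columnSwap, Equiv.swap_apply_eq_iff, Equiv.swap_apply_left]
  have h3 : ∀ v : Fin (n * l), ∀ a' ∈ U, blockOf (columnSwap a j v) = a' ↔ blockOf v = a' := by
    intro v a' ha'
    rw [blockOf_columnSwap, Equiv.swap_apply_eq_iff, Equiv.swap_apply_of_ne_of_ne]
    · rintro rfl
      exact haU ha'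
    · rintro rfl
      exact hjU _ ha'
  have e1 : (∀ v ∈ (pairPerm (columnSwap a j) e).1, blockOf v ∈ S) ↔ ∀ v ∈ e.1, blockOf v ∈ S := by
    simp [pairPerm_coe, Sym2.mem_map, h1]
  have e2 : (∃ a' ∈ insert a U, ∀ v ∈ (pairPerm (columnSwap a j) e).1, blockOf v = a') ↔
      e ∈ transversalPairs j ∨ ∃ a' ∈ U, ∀ v ∈ e.1, blockOf v = a' := by
    rw [Finset.exists_mem_insert]
    refine or_congr ?_ ?_
    · simp [transversalPairs, pairPerm_coe, Sym2.mem_map, h2]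
    · refine exists_congr fun a' => and_congr_right fun ha' => ?_
      simp only [pairPerm_coe, Sym2.mem_map, forall_exists_index, and_imp, forall_apply_eq_imp_iff₂,
        h3 _ a' ha']
  have e3 : e ∈ transversalPairs j → ∀ v ∈ e.1, blockOf v ∈ S := by
    intro he v hv
    rw [(Finset.mem_filter.1 he).2 v hv]
    exact hjS _
  unfold blockWeight
  rw [if_congr e1 (if_congr e2 rfl rfl) rfl]
  by_cases he : e ∈ transversalPairs j
  · simp [he]
  · simp [he]

/-- A transversal may meet one block in several columns, but only a block outside `U`; its pairs
therefore still have the full weight, whether or not they cross blocks. -/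
theorem blockWeight_of_mem_transversalPairs {S U : Finset (Fin n)}
    {j : Fin l → Fin n} (hj : ∀ s, j s ∈ S \ U) (p q : ℝ) {e : VertexPair (n * l)}
    (he : e ∈ transversalPairs j) : blockWeight S U p q e.1 = p := by
  have he := (Finset.mem_filter.1 he).2
  unfold blockWeight
  rw [if_pos, if_neg]
  · rintro ⟨a, haU, ha⟩
    have hv := Sym2.out_fst_mem e.1
    have := ha _ hv
    rw [he _ hv] at this
    exact (Finset.mem_sdiff.1 (hj (columnOf (Quot.out e.1).1))).2 (this ▸ haU)
  · intro v hv
    rw [he v hv]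
    exact (Finset.mem_sdiff.1 (hj _)).1

/-- The number of ordered pairs of columns in which two transversals agree. -/
def agreement {R : Type*} [DecidableEq R] (j j' : Fin l → R) : ℕ :=
  (Finset.univ.filter fun s : Fin l × Fin l => s.1 ≠ s.2 ∧ j s.1 = j' s.1 ∧ j s.2 = j' s.2).card

/-- A common pair is determined by the columns of its two vertices, which are distinct columns where
the transversals agree. -/
theorem card_transversalPairs_inter_le (j j' : Fin l → Fin n) :
    (transversalPairs j ∩ transversalPairs j').card ≤ agreement j j' := by
  classical
  rw [← Finset.card_map (Function.Embedding.subtype _)]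
  refine le_trans (Finset.card_le_card (t := (Finset.univ.filter fun s : Fin l × Fin l =>
    s.1 ≠ s.2 ∧ j s.1 = j' s.1 ∧ j s.2 = j' s.2).image fun s =>
      s(finProdFinEquiv (j s.1, s.1), finProdFinEquiv (j s.2, s.2))) ?_) Finset.card_image_le
  intro e he
  obtain ⟨⟨e, hd⟩, hmem, rfl⟩ := Finset.mem_map.1 he
  have h1 := (Finset.mem_filter.1 (Finset.mem_inter.1 hmem).1).2
  have h2 := (Finset.mem_filter.1 (Finset.mem_inter.1 hmem).2).2
  clear he hmem
  induction e with
  | _ u v =>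
    have hu := h1 u (by simp)
    have hv := h1 v (by simp)
    have hu' := h2 u (by simp)
    have hv' := h2 v (by simp)
    refine Finset.mem_image.2 ⟨(columnOf u, columnOf v), ?_, ?_⟩
    · simp only [Finset.mem_filter, Finset.mem_univ, true_and]
      refine ⟨fun h => hd ?_, by rw [← hu, hu'], by rw [← hv, hv']⟩
      rw [Sym2.mk_isDiag_iff, ← mk_blockOf_columnOf u, ← mk_blockOf_columnOf v, hu, hv, h]
    · simp only [Function.Embedding.subtype_apply]
      rw [← hu, ← hv, mk_blockOf_columnOf, mk_blockOf_columnOf]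

theorem agreement_le {R : Type*} [DecidableEq R] (j j' : Fin l → R) : agreement j j' ≤ l ^ 2 := by
  refine (Finset.card_le_univ _).trans ?_
  simp [sq]

/-- The mean agreement of two random transversals. -/
theorem sum_agreement_le {R : Type*} [DecidableEq R] [Fintype R] [Nonempty R] :
    ∑ j : Fin l → R, ∑ j' : Fin l → R, (agreement j j' : ℝ) / Fintype.card (Fin l → R) ^ 2 ≤
      l ^ 2 / Fintype.card R ^ 2 := by
  have hR : (Fintype.card R : ℝ) ≠ 0 := by positivity
  -- The indicator of agreement in columns `s` and `s'`, normalised and split into one factor per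
  -- column. Columns `s` and `s'` each sum to `1 / |R|`, all others to `1`.
  set g : Fin l → Fin l → Fin l → R × R → ℝ := fun s s' t b =>
    (if t = s ∨ t = s' then (if b.1 = b.2 then 1 else 0) else 1) / (Fintype.card R : ℝ) ^ 2 with hg
  have h1 : ∀ j j' : Fin l → R, (agreement j j' : ℝ) / Fintype.card (Fin l → R) ^ 2 =
      ∑ s, ∑ s', if s ≠ s' then ∏ t, g s s' t (j t, j' t) else 0 := by
    intro j j'
    have hcard : (Fintype.card (Fin l → R) : ℝ) ^ 2 = ∏ _t : Fin l, (Fintype.card R : ℝ) ^ 2 := by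
      rw [Fintype.card_fun, Finset.prod_const, Finset.card_univ, Fintype.card_fin]
      push_cast
      ring
    unfold agreement
    rw [Finset.card_filter, Fintype.sum_prod_type]
    push_cast
    rw [Finset.sum_div]
    refine Finset.sum_congr rfl fun s _ => ?_
    rw [Finset.sum_div]
    refine Finset.sum_congr rfl fun s' _ => ?_
    by_cases hs : s = s'
    · simp [hs]
    · simp only [hg, ne_eq, hs, not_false_eq_true, true_and, if_true]
      rw [Finset.prod_div_distrib, ← hcard]
      congr 1
      have : ∀ t, (if t = s ∨ t = s' then (if j t = j' t then (1 : ℝ) else 0) else 1) =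
          if (t = s ∨ t = s') → j t = j' t then 1 else 0 := by
        intro t
        by_cases ht : t = s ∨ t = s' <;> simp [ht]
      simp_rw [this]
      rw [Finset.prod_ite_zero]
      simp
  have h2 : ∀ s s', s ≠ s' → ∑ j : Fin l → R, ∑ j' : Fin l → R, ∏ t, g s s' t (j t, j' t) =
      1 / Fintype.card R ^ 2 := by
    intro s s' hs
    rw [← Fintype.sum_prod_type' (fun j j' : Fin l → R => ∏ t, g s s' t (j t, j' t)),
      ← (Equiv.arrowProdEquivProdArrow (Fin l) (fun _ => R) (fun _ => R)).sum_comp]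
    simp only [Equiv.arrowProdEquivProdArrow, Equiv.coe_fn_mk]
    rw [sum_pi_prod (fun t b => g s s' t b)]
    have h3 : ∀ t, ∑ b, g s s' t b = (if t = s then (Fintype.card R : ℝ)⁻¹ else 1) *
        (if t = s' then (Fintype.card R : ℝ)⁻¹ else 1) := by
      intro t
      simp only [hg]
      rw [← Finset.sum_div, Fintype.sum_prod_type]
      by_cases h : t = s
      · have h' : t ≠ s' := fun h'' => hs (h ▸ h'')
        simp [h, hs]
        field_simp
      · by_cases h' : t = s'
        · subst h'
          simp [h]
          field_simp
        · simp [h, h']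
          field_simp
    simp_rw [h3]
    rw [Finset.prod_mul_distrib, Finset.prod_ite_eq', Finset.prod_ite_eq']
    simp
    ring
  simp_rw [h1]
  have h4 : ∑ j : Fin l → R, ∑ j' : Fin l → R, ∑ s, ∑ s',
      (if s ≠ s' then ∏ t, g s s' t (j t, j' t) else 0) =
      ∑ s, ∑ s', ∑ j : Fin l → R, ∑ j' : Fin l → R,
      (if s ≠ s' then ∏ t, g s s' t (j t, j' t) else 0) := by
    rw [Finset.sum_congr rfl fun j _ => Finset.sum_comm, Finset.sum_comm]
    refine Finset.sum_congr rfl fun s _ => ?_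
    rw [Finset.sum_congr rfl fun j _ => Finset.sum_comm, Finset.sum_comm]
  rw [h4]
  calc _ ≤ ∑ s : Fin l, ∑ s' : Fin l, 1 / (Fintype.card R : ℝ) ^ 2 := by
        refine Finset.sum_le_sum fun s _ => Finset.sum_le_sum fun s' _ => ?_
        by_cases hs : s = s'
        · simp only [hs, ne_eq, not_true_eq_false, if_false, Finset.sum_const_zero]
          positivity
        · simp only [ne_eq, hs, not_false_eq_true, if_true]
          exact (h2 s s' hs).le
    _ = _ := by
        simp only [Finset.sum_const, Finset.card_univ, Fintype.card_fin, nsmul_eq_mul]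
        ring

end Blowup

/-! ### Hybrid argument: lowering the blocks one at a time -/

section Hybrid

variable {n l : ℕ}

theorem pairPerm_mul {N : ℕ} (τ σ : Equiv.Perm (Fin N)) (e : VertexPair N) :
    pairPerm (τ * σ) e = pairPerm τ (pairPerm σ e) :=
  Subtype.ext (by simp [pairPerm_coe, Sym2.map_map])

theorem blockWeight_mem {S U : Finset (Fin n)} {p q : ℝ} (e : Sym2 (Fin (n * l))) :
    blockWeight S U p q e = p ∨ blockWeight S U p q e = q := by
  unfold blockWeight
  split_ifs <;> simp

/-- The column swap disappears in the average over relabellings. Since `j` is arbitrary, the lowered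
block can be replaced by a uniformly random transversal. -/
theorem blockMixture_insert_eq {S U : Finset (Fin n)} {a : Fin n} (haS : a ∈ S) (haU : a ∉ U)
    (p q : ℝ) (x : VertexPair (n * l) → Bool) (j : Fin l → {b // b ∈ S \ U}) :
    blockMixture l S (insert a U) p q x =
      (∑ σ : Equiv.Perm (Fin (n * l)), bernoulliMass (fun e : VertexPair (n * l) =>
        if pairPerm σ e ∈ transversalPairs (fun s => (j s).1) then q
        else blockWeight S U p q (pairPerm σ e).1) x) / ((n * l).factorial : ℝ) := by
  unfold blockMixture
  congr 1
  rw [← Equiv.sum_comp (Equiv.mulLeft (columnSwap a fun s => (j s).1))]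
  refine Finset.sum_congr rfl fun σ _ => ?_
  congr 1
  ext e
  rw [Equiv.coe_mulLeft, pairPerm_mul, blockWeight_columnSwap haS haU fun s => (j s).2]

/-- Lowering the weights inside one more block hardly changes the mixture. -/
theorem sum_abs_blockMixture_insert_le {S U : Finset (Fin n)} {a : Fin n} (haS : a ∈ S)
    (haU : a ∉ U) {q d : ℝ} (hq : 0 < q) (hq2 : q ≤ 1 / 4) (hd : 0 ≤ d) (hdq : d ≤ q)
    (hl : 2 * d ^ 2 / q * l ^ 2 ≤ 1) :
    ∑ x, |blockMixture l S U (q + d) q x - blockMixture l S (insert a U) (q + d) q x| ≤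
      √(2 * (2 * d ^ 2 / q)) * l / (S \ U).card := by
  classical
  set p := q + d with hp
  have hp0 : 0 < p := by linarith
  have hp1 : p < 1 := by linarith
  let R := {b // b ∈ S \ U}
  have : Nonempty R := ⟨⟨a, Finset.mem_sdiff.2 ⟨haS, haU⟩⟩⟩
  have hRc : Fintype.card R = (S \ U).card := Fintype.card_coe (S \ U)
  have hr : (0 : ℝ) < (S \ U).card := by
    rw [← hRc]
    exact_mod_cast Fintype.card_pos
  set w : VertexPair (n * l) → ℝ := fun e => blockWeight S U p q e.1 with hw
  have hw0 : ∀ e, 0 < w e := fun e => by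
    rcases blockWeight_mem (S := S) (U := U) (p := p) (q := q) e.1 with h | h <;>
    · simp only [hw, h]
      assumption
  have hw1 : ∀ e, w e < 1 := fun e => by
    rcases blockWeight_mem (S := S) (U := U) (p := p) (q := q) e.1 with h | h <;>
    · simp only [hw, h]
      linarith
  let A : (Fin l → R) → Finset (VertexPair (n * l)) := fun j => transversalPairs fun s => (j s).1
  -- Here `p ≥ q` and, as `d ≤ q ≤ 1 / 4`, also `1 - p ≥ 1 / 2`.
  have hμ : d ^ 2 / (p * (1 - p)) ≤ 2 * d ^ 2 / q := by
    rw [div_le_div_iff₀ (by nlinarith) hq]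
    have : q ≤ 2 * (p * (1 - p)) := by nlinarith
    nlinarith [sq_nonneg d]
  have hμ0 : 0 ≤ d ^ 2 / (p * (1 - p)) := div_nonneg (sq_nonneg d) (by nlinarith)
  have hΛ0 : 0 ≤ 2 * d ^ 2 / q := by positivity
  have hchi := sq_sum_abs_mixture_lowered_le (w := w) hw0 hw1 A (p := p) (d := d)
    (fun j e he => blockWeight_of_mem_transversalPairs (fun s => (j s).2) p q he)
    (c := fun j j' => (agreement j j' : ℝ)) (fun j j' => by
      have h1 := card_transversalPairs_inter_le (fun s => (j s).1) (fun s => (j' s).1)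
      have h2 : agreement (fun s => (j s).1) (fun s => (j' s).1) = agreement j j' :=
        congrArg Finset.card (Finset.filter_congr fun s _ => and_congr_right fun _ =>
          and_congr Subtype.val_injective.eq_iff Subtype.val_injective.eq_iff)
      rw [h2] at h1
      exact_mod_cast h1) (fun j j' => by
      have h1 : (agreement j j' : ℝ) ≤ l ^ 2 := by exact_mod_cast agreement_le j j'
      exact (mul_le_mul hμ h1 (Nat.cast_nonneg _) hΛ0).trans hl) hp0 hp1
  have hpd : p - d = q := by rw [hp]; ring
  rw [hpd] at hchi
  have hagree := sum_agreement_le (l := l) (R := R)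
  rw [hRc] at hagree
  have hB : ∑ x, |bernoulliMass w x - (∑ j : Fin l → R,
      bernoulliMass (fun i => if i ∈ A j then q else w i) x) / Fintype.card (Fin l → R)| ≤
      √(2 * (2 * d ^ 2 / q)) * l / (S \ U).card := by
    have h0 : 0 ≤ √(2 * (2 * d ^ 2 / q)) * l / (S \ U).card := by positivity
    refine le_of_sq_le_sq ?_ h0
    refine hchi.trans ?_
    rw [div_pow, mul_pow, Real.sq_sqrt (by positivity), mul_div_assoc]
    refine mul_le_mul (mul_le_mul_of_nonneg_left hμ zero_le_two) hagree ?_ (by positivity)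
    exact Finset.sum_nonneg fun j _ => Finset.sum_nonneg fun j' _ => by positivity
  set B := √(2 * (2 * d ^ 2 / q)) * l / (S \ U).card
  have hJ : (Fintype.card (Fin l → R) : ℝ) ≠ 0 := by positivity
  have hN : (0 : ℝ) < ((n * l).factorial : ℝ) := by positivity
  -- The same mass, averaged over all transversals of the intact blocks.
  have e1 : ∀ x, blockMixture l S (insert a U) p q x = (∑ σ : Equiv.Perm (Fin (n * l)),
      (∑ j : Fin l → R, bernoulliMass (fun e : VertexPair (n * l) =>
        if pairPerm σ e ∈ A j then q else w (pairPerm σ e)) x) / Fintype.card (Fin l → R)) /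
        ((n * l).factorial : ℝ) := by
    intro x
    rw [← Finset.sum_div, Finset.sum_comm, div_right_comm, Finset.sum_div, eq_div_iff hJ]
    rw [← Finset.sum_congr rfl fun j _ => blockMixture_insert_eq haS haU p q x j, Finset.sum_const,
      Finset.card_univ, nsmul_eq_mul, mul_comm]
  calc _ ≤ ∑ x, (∑ σ : Equiv.Perm (Fin (n * l)), |bernoulliMass (fun e => w (pairPerm σ e)) x -
        (∑ j : Fin l → R, bernoulliMass (fun e : VertexPair (n * l) =>
        if pairPerm σ e ∈ A j then q else w (pairPerm σ e)) x) / Fintype.card (Fin l → R)|) /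
        ((n * l).factorial : ℝ) := by
        refine Finset.sum_le_sum fun x _ => ?_
        rw [e1, blockMixture, ← sub_div, abs_div, abs_of_pos hN, ← Finset.sum_sub_distrib]
        exact div_le_div_of_nonneg_right (Finset.abs_sum_le_sum_abs _ _) hN.le
    _ = (∑ σ : Equiv.Perm (Fin (n * l)), ∑ x, |bernoulliMass (fun e => w (pairPerm σ e)) x -
        (∑ j : Fin l → R, bernoulliMass (fun e : VertexPair (n * l) =>
        if pairPerm σ e ∈ A j then q else w (pairPerm σ e)) x) / Fintype.card (Fin l → R)|) /
        ((n * l).factorial : ℝ) := by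
        rw [← Finset.sum_div, Finset.sum_comm]
    _ ≤ B := by
        rw [div_le_iff₀ hN]
        have hcard : ((n * l).factorial : ℝ) =
            (Finset.univ : Finset (Equiv.Perm (Fin (n * l)))).card := by
          rw [Finset.card_univ, Fintype.card_perm, Fintype.card_fin]
        rw [hcard, mul_comm B, ← nsmul_eq_mul]
        refine Finset.sum_le_card_nsmul _ _ _ fun σ _ => ?_
        -- Relabelling the bits makes the term of `σ` equal to the one without relabelling, so all
        -- terms obey the same `χ²` bound.
        rw [← sum_comp_perm (pairPerm σ)]
        refine le_trans (le_of_eq (Finset.sum_congr rfl fun x _ => ?_)) hB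
        rw [bernoulliMass_comp (pairPerm σ) w x]
        congr 3
        refine Finset.sum_congr rfl fun j _ => ?_
        exact bernoulliMass_comp (pairPerm σ) (fun e => if e ∈ A j then q else w e) x

theorem sum_range_inv_sub_eq_harmonic (k : ℕ) :
    ∑ i ∈ Finset.range k, ((k - i : ℕ) : ℝ)⁻¹ = (harmonic k : ℝ) := by
  rw [harmonic]
  push_cast
  rw [← Finset.sum_range_reflect]
  refine Finset.sum_congr rfl fun i hi => ?_
  have := Finset.mem_range.1 hi
  rw [show k - (k - 1 - i) = i + 1 by omega]
  push_cast
  rfl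

/-- Lowering the weights inside all blocks hardly changes the mixture. -/
theorem sum_abs_blockMixture_le {S : Finset (Fin n)} {q d : ℝ} (hq : 0 < q) (hq2 : q ≤ 1 / 4)
    (hd : 0 ≤ d) (hdq : d ≤ q) (hl : 2 * d ^ 2 / q * l ^ 2 ≤ 1) :
    ∑ x, |blockMixture l S ∅ (q + d) q x - blockMixture l S S (q + d) q x| ≤
      √(2 * (2 * d ^ 2 / q)) * l * (1 + Real.log S.card) := by
  set B := √(2 * (2 * d ^ 2 / q)) * l with hB
  have hB0 : 0 ≤ B := by positivity
  -- When `i` blocks have been lowered, `S.card - i` are intact, and lowering the next one costs `B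
  -- / (S.card - i)`.
  have key : ∀ U : Finset (Fin n), U ⊆ S →
      ∑ x, |blockMixture l S ∅ (q + d) q x - blockMixture l S U (q + d) q x| ≤
        B * ∑ i ∈ Finset.range U.card, ((S.card - i : ℕ) : ℝ)⁻¹ := by
    intro U
    induction U using Finset.induction_on with
    | empty => simp
    | insert a U ha ih =>
      intro hU
      have haS := hU (Finset.mem_insert_self a U)
      have hUS := (Finset.insert_subset_iff.1 hU).2
      rw [Finset.card_insert_of_notMem ha, Finset.sum_range_succ, mul_add]
      have hstep := sum_abs_blockMixture_insert_le (l := l) haS ha hq hq2 hd hdq hl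
      rw [Finset.card_sdiff_of_subset hUS, ← hB, div_eq_mul_inv] at hstep
      refine le_trans ?_ (add_le_add (ih hUS) hstep)
      rw [← Finset.sum_add_distrib]
      exact Finset.sum_le_sum fun x _ => abs_sub_le _ _ _
  refine (key S subset_rfl).trans (mul_le_mul_of_nonneg_left ?_ hB0)
  rw [sum_range_inv_sub_eq_harmonic]
  exact harmonic_le_one_add_log _

end Hybrid

/-! ### Bitwise channels -/

/-- Choosing, for every index, one of two independent samples. -/
theorem sum_select_eq {I : Type*} [Fintype I] [DecidableEq I] {X : I → Type*}
    [∀ i, Fintype (X i)] {μ ν : ∀ i, X i → ℝ} (hμ : ∀ i, ∑ a, μ i a = 1)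
    (hν : ∀ i, ∑ a, ν i a = 1) (b : I → Bool) (T : (∀ i, X i) → ℝ) :
    ∑ Z : ∀ i, X i × X i, (∏ i, μ i (Z i).1 * ν i (Z i).2) *
        T (fun i => if b i then (Z i).1 else (Z i).2) =
      ∑ y : ∀ i, X i, (∏ i, if b i then μ i (y i) else ν i (y i)) * T y := by
  -- Exchanging the two samples where `b i` is `false` makes the selected sample always the first
  -- one; the second then sums out to one.
  let sw : (∀ i, X i × X i) ≃ ∀ i, X i × X i :=
    Equiv.piCongrRight fun i => if b i then Equiv.refl _ else Equiv.prodComm _ _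
  have h1 : ∀ Z : ∀ i, X i × X i, (∏ i, μ i (sw Z i).1 * ν i (sw Z i).2) *
        T (fun i => if b i then (sw Z i).1 else (sw Z i).2) =
      (∏ i, if b i then μ i (Z i).1 else ν i (Z i).1) *
        (∏ i, if b i then ν i (Z i).2 else μ i (Z i).2) * T (fun i => (Z i).1) := by
    intro Z
    rw [← Finset.prod_mul_distrib]
    congr 1
    · refine Finset.prod_congr rfl fun i _ => ?_
      cases hb : b i <;> simp [sw, hb, mul_comm]
    · congr 1
      ext i
      cases hb : b i <;> simp [sw, hb]
  rw [← sw.sum_comp]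
  simp_rw [h1]
  rw [← (Equiv.arrowProdEquivProdArrow I X X).symm.sum_comp, Fintype.sum_prod_type]
  refine Finset.sum_congr rfl fun y _ => ?_
  simp only [Equiv.arrowProdEquivProdArrow, Equiv.coe_fn_symm_mk]
  rw [← Finset.sum_mul, ← Finset.mul_sum, sum_pi_prod (fun i a => if b i then ν i a else μ i a)]
  have : ∀ i, ∑ a, (if b i then ν i a else μ i a) = 1 := by
    intro i
    split_ifs
    exacts [hν i, hμ i]
  simp [this]

/-- Derandomisation: some outcome is no worse than the average, and it can be hard-wired into a
program depending on the input size. -/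
theorem exists_le_of_sum_mul_le {Ω : Type*} [Fintype Ω] {ρ f : Ω → ℝ} {B : ℝ}
    (hρ : ∀ ω, 0 ≤ ρ ω) (hρ1 : ∑ ω, ρ ω = 1) (h : ∑ ω, ρ ω * f ω ≤ B) : ∃ ω, f ω ≤ B := by
  by_contra! hcon
  obtain ⟨ω₀, -, hω₀⟩ : ∃ ω ∈ Finset.univ, 0 < ρ ω := by
    by_contra! hneg
    have := Finset.sum_nonpos hneg
    linarith
  have : ∑ ω, ρ ω * B < ∑ ω, ρ ω * f ω :=
    Finset.sum_lt_sum (fun ω _ => mul_le_mul_of_nonneg_left (hcon ω).le (hρ ω))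
      ⟨ω₀, Finset.mem_univ _, mul_lt_mul_of_pos_left (hcon ω₀) hω₀⟩
  rw [← Finset.sum_mul, hρ1] at this
  linarith

section Channel

variable {n l : ℕ}

/-- The pair of blocks of a pair of vertices of the blow-up. -/
def pairBlock (e : VertexPair (n * l)) : Sym2 (Fin n) := e.1.map blockOf

/-- The pairs of vertices between two given blocks. -/
abbrev BlockFiber (n l : ℕ) (i : Sym2 (Fin n)) := {e : VertexPair (n * l) // pairBlock e = i}

/-- Once the two blocks are known, a pair is determined by two columns. -/
theorem card_blockFiber_le (i : Sym2 (Fin n)) : Fintype.card (BlockFiber n l i) ≤ l ^ 2 := by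
  induction i with
  | _ a b =>
    have h : ∀ e : BlockFiber n l s(a, b), ∃ s : Fin l × Fin l,
        e.1.1 = s(finProdFinEquiv (a, s.1), finProdFinEquiv (b, s.2)) := by
      rintro ⟨⟨e, hd⟩, he⟩
      induction e with
      | _ u v =>
        simp only [pairBlock, Sym2.map_mk, Sym2.eq_iff] at he
        rcases he with ⟨rfl, rfl⟩ | ⟨rfl, rfl⟩
        · exact ⟨(columnOf u, columnOf v), by simp only [mk_blockOf_columnOf]⟩
        · exact ⟨(columnOf v, columnOf u), by simp only [mk_blockOf_columnOf, Sym2.eq_swap]⟩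
    choose c hc using h
    have hinj : Function.Injective c := fun e e' hee => by
      apply Subtype.ext
      apply Subtype.ext
      rw [hc, hc, hee]
    refine (Fintype.card_le_of_injective c hinj).trans ?_
    simp [sq]

/-- Splitting the bits according to the pair of blocks. -/
def fiberBits (n l : ℕ) : (VertexPair (n * l) → Bool) ≃ ∀ i, (BlockFiber n l i → Bool) where
  toFun y i e := y e.1
  invFun z e := z (pairBlock e) ⟨e, rfl⟩
  left_inv _ := rfl
  right_inv z := by
    ext i ⟨e, rfl⟩
    rfl

theorem bernoulliMass_eq_prod_fiber (w : VertexPair (n * l) → ℝ) (y : VertexPair (n * l) → Bool) :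
    bernoulliMass w y =
      ∏ i, bernoulliMass (fun e : BlockFiber n l i => w e.1) (fiberBits n l y i) :=
  (Fintype.prod_fiberwise pairBlock fun e => if y e then w e else 1 - w e).symm

/-- The adjacency bits, extended by `true` to the diagonal. -/
def extendBits (x : VertexPair n → Bool) (i : Sym2 (Fin n)) : Bool :=
  if h : i.IsDiag then true else x ⟨i, h⟩

/-- The output bits of the blow-up channel before relabelling: between two blocks, the bits are
those of one of two samples, according to the input bit. -/
def selectBits (Z : ∀ i, (BlockFiber n l i → Bool) × (BlockFiber n l i → Bool))
    (x : VertexPair n → Bool) : VertexPair (n * l) → Bool :=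
  (fiberBits n l).symm fun i => if extendBits x i then (Z i).1 else (Z i).2

/-- The distribution of the output of the channel on independent input bits. -/
def channelMass (A B : ∀ i, (BlockFiber n l i → Bool) → ℝ) (w : VertexPair n → ℝ)
    (y : VertexPair (n * l) → Bool) : ℝ :=
  ∏ i, if h : i.IsDiag then A i (fiberBits n l y i) else
    w ⟨i, h⟩ * A i (fiberBits n l y i) + (1 - w ⟨i, h⟩) * B i (fiberBits n l y i)

theorem sum_bernoulliMass_mul_prod_extend (w : VertexPair n → ℝ) (g : Sym2 (Fin n) → Bool → ℝ) :
    ∑ x, bernoulliMass w x * ∏ i, g i (extendBits x i) =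
      ∏ i, if h : i.IsDiag then g i true else w ⟨i, h⟩ * g i true + (1 - w ⟨i, h⟩) * g i false := by
  have h1 : ∀ x : VertexPair n → Bool, ∏ i, g i (extendBits x i) =
      (∏ i : {i : Sym2 (Fin n) // i.IsDiag}, g i true) * ∏ i : VertexPair n, g i (x i) := by
    intro x
    rw [← Fintype.prod_subtype_mul_prod_subtype (fun i : Sym2 (Fin n) => i.IsDiag)]
    congr 1
    · exact Finset.prod_congr rfl fun i _ => by simp [extendBits, i.2]
    · exact Finset.prod_congr rfl fun i _ => by simp [extendBits, i.2]
  simp_rw [h1]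
  rw [← Fintype.prod_subtype_mul_prod_subtype (fun i : Sym2 (Fin n) => i.IsDiag)]
  rw [Finset.sum_congr rfl fun x _ => mul_left_comm _ _ _, ← Finset.mul_sum, sum_bernoulliMass_mul_prod w (fun i b => g i b)]
  congr 1
  · exact Finset.prod_congr rfl fun i _ => by simp [i.2]
  · exact Finset.prod_congr rfl fun i _ => by simp [i.2]

/-- For a fixed input, averaging over the samples leaves `A` or `B` between each two blocks;
averaging over independent input bits then mixes the two laws separately for each pair of blocks. -/
theorem sum_selectBits_eq {A B : ∀ i, (BlockFiber n l i → Bool) → ℝ} (hA : ∀ i, ∑ a, A i a = 1)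
    (hB : ∀ i, ∑ a, B i a = 1) (w : VertexPair n → ℝ) (T : (VertexPair (n * l) → Bool) → ℝ) :
    ∑ Z : ∀ i, (BlockFiber n l i → Bool) × (BlockFiber n l i → Bool),
      (∏ i, A i (Z i).1 * B i (Z i).2) * ∑ x, bernoulliMass w x * T (selectBits Z x) =
    ∑ y, channelMass A B w y * T y := by
  have h1 : ∀ x : VertexPair n → Bool,
      ∑ Z : ∀ i, (BlockFiber n l i → Bool) × (BlockFiber n l i → Bool),
        (∏ i, A i (Z i).1 * B i (Z i).2) * T (selectBits Z x) =
      ∑ y, (∏ i, if extendBits x i then A i (fiberBits n l y i) else B i (fiberBits n l y i)) *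
        T y := by
    intro x
    rw [← (fiberBits n l).symm.sum_comp]
    simp only [Equiv.apply_symm_apply]
    exact sum_select_eq hA hB (extendBits x) fun z => T ((fiberBits n l).symm z)
  calc _ = ∑ x, bernoulliMass w x * ∑ Z : ∀ i, (BlockFiber n l i → Bool) × (BlockFiber n l i → Bool),
        (∏ i, A i (Z i).1 * B i (Z i).2) * T (selectBits Z x) := by
        simp_rw [Finset.mul_sum]
        rw [Finset.sum_comm]
        refine Finset.sum_congr rfl fun x _ => Finset.sum_congr rfl fun Z _ => ?_
        ring
    _ = _ := by
        simp_rw [h1, Finset.mul_sum]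
        rw [Finset.sum_comm]
        refine Finset.sum_congr rfl fun y _ => ?_
        simp_rw [← mul_assoc]
        rw [← Finset.sum_mul, sum_bernoulliMass_mul_prod_extend w
          (fun i b => if b then A i (fiberBits n l y i) else B i (fiberBits n l y i))]
        simp [channelMass]

/-- Moves the random relabelling from the test to the mass function, where it produces a
`blockMixture`. -/
theorem sum_average_perm_eq {N : ℕ} (w : VertexPair N → ℝ) (T : (VertexPair N → Bool) → ℝ) :
    ∑ y, bernoulliMass w y *
      ((∑ σ : Equiv.Perm (Fin N), T fun e => y (pairPerm σ e)) / (N.factorial : ℝ)) =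
    ∑ y, ((∑ σ : Equiv.Perm (Fin N), bernoulliMass (fun e => w (pairPerm σ e)) y) /
      (N.factorial : ℝ)) * T y := by
  simp_rw [mul_div_assoc', div_mul_eq_mul_div, Finset.mul_sum, Finset.sum_mul, ← Finset.sum_div]
  congr 1
  rw [Finset.sum_comm, Finset.sum_comm (s := (Finset.univ : Finset (VertexPair N → Bool)))]
  refine Finset.sum_congr rfl fun σ _ => ?_
  refine Eq.trans ?_ (sum_comp_perm (pairPerm σ) _)
  exact Finset.sum_congr rfl fun y _ => by rw [bernoulliMass_comp (pairPerm σ)]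

end Channel

/-! ### The reduction from planted clique to planted dense subgraph -/

section Reduction

variable {n l : ℕ}

open Classical in
/-- A pair of laws on each block such that their mean is the law of parameter `q`, the first one
being close to the law of parameter `q + d` off the diagonal. -/
theorem exists_channel (n l : ℕ) {q d : ℝ} {r : ℕ} (hq : 0 < q) (hq2 : q ≤ 1 / 4) (hd : 0 ≤ d)
    (hrd : (r + 1) * d ≤ q) :
    ∃ A B : ∀ i, (BlockFiber n l i → Bool) → ℝ, (∀ i a, 0 ≤ A i a) ∧ (∀ i a, 0 ≤ B i a) ∧
      (∀ i, ∑ a, A i a = 1) ∧ (∀ i, ∑ a, B i a = 1) ∧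
      (∀ i a, A i a + B i a = 2 * bernoulliMass (fun _ => q) a) ∧
      (∀ i, i.IsDiag → ∀ a, A i a = bernoulliMass (fun _ => q) a) ∧
      ∀ i, ∑ a, |A i a - bernoulliMass (fun _ => if i.IsDiag then q else q + d) a| ≤
        2 * (Real.exp (l ^ 2 * ((r + 1) ^ 2 * (2 * d ^ 2 / q))) / 2 ^ r) := by
  have hdq : d ≤ q := le_trans (by nlinarith [Nat.cast_nonneg (α := ℝ) r]) hrd
  have hQ : ∀ i (a : BlockFiber n l i → Bool), 0 ≤ bernoulliMass (fun _ => q) a := fun i a =>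
    bernoulliMass_nonneg (fun _ => hq.le) (fun _ => by linarith) a
  have H : ∀ i : Sym2 (Fin n), ∃ A B : (BlockFiber n l i → Bool) → ℝ,
      (∀ a, 0 ≤ A a) ∧ (∀ a, 0 ≤ B a) ∧ ∑ a, A a = 1 ∧ ∑ a, B a = 1 ∧
      (∀ a, A a + B a = 2 * bernoulliMass (fun _ => q) a) ∧
      (i.IsDiag → ∀ a, A a = bernoulliMass (fun _ => q) a) ∧
      ∑ a, |A a - bernoulliMass (fun _ => if i.IsDiag then q else q + d) a| ≤
        2 * (Real.exp (l ^ 2 * ((r + 1) ^ 2 * (2 * d ^ 2 / q))) / 2 ^ r) := by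
    intro i
    by_cases hi : i.IsDiag
    · refine ⟨fun a => bernoulliMass (fun _ => q) a, fun a => bernoulliMass (fun _ => q) a,
        hQ i, hQ i, sum_bernoulliMass _, sum_bernoulliMass _, fun a => by ring, fun _ a => rfl, ?_⟩
      simp only [hi, if_true, sub_self, abs_zero, Finset.sum_const_zero]
      positivity
    · obtain ⟨A, B, hA, hB, hA1, hB1, hAB, hAP⟩ := exists_dominated_mass
        (P := fun a : BlockFiber n l i → Bool => bernoulliMass (fun _ => q + d) a)
        (Q := fun a : BlockFiber n l i → Bool => bernoulliMass (fun _ => q) a)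
        (fun a => bernoulliMass_nonneg (fun _ => by linarith) (fun _ => by linarith) a) (hQ i)
        (sum_bernoulliMass _) (sum_bernoulliMass _)
      refine ⟨A, B, hA, hB, hA1, hB1, hAB, fun h => absurd h hi, ?_⟩
      simp only [hi, if_false]
      refine hAP.trans (mul_le_mul_of_nonneg_left ?_ zero_le_two)
      have := bernoulliMass_excess_le (F := BlockFiber n l i) hq hq2 hd hrd (card_blockFiber_le i)
      push_cast at this
      exact this
  choose A B h1 h2 h3 h4 h5 h6 h7 using H
  exact ⟨A, B, h1, h2, h3, h4, h5, h6, h7⟩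

/-- A fair input bit selects the mean of `A` and `B`, which is exactly the law of parameter `q`. The
null hypothesis is thus reproduced without any loss. -/
theorem channelMass_half {q : ℝ} {A B : ∀ i, (BlockFiber n l i → Bool) → ℝ}
    (hAB : ∀ i a, A i a + B i a = 2 * bernoulliMass (fun _ => q) a)
    (hdiag : ∀ i, i.IsDiag → ∀ a, A i a = bernoulliMass (fun _ => q) a)
    (y : VertexPair (n * l) → Bool) :
    channelMass A B (fun _ => 1 / 2) y = bernoulliMass (fun _ => q) y := by
  rw [bernoulliMass_eq_prod_fiber, channelMass]
  refine Finset.prod_congr rfl fun i _ => ?_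
  split_ifs with h
  · exact hdiag i h _
  · have h2 := hAB i (fiberBits n l y i)
    rw [← mul_div_cancel_left₀ (bernoulliMass _ _) (two_ne_zero (α := ℝ))]
    refine Eq.trans ?_ (congrArg (· / 2) h2)
    ring

open Classical in
theorem blockWeight_self_eq (S : Finset (Fin n)) (p q : ℝ) (e : VertexPair (n * l)) :
    blockWeight S S p q e.1 =
      if ∀ v ∈ pairBlock e, v ∈ S then (if (pairBlock e).IsDiag then q else p) else q := by
  obtain ⟨e, he⟩ := e
  induction e with
  | _ u v =>
    simp only [blockWeight, pairBlock, Sym2.map_mk, Sym2.mem_iff, forall_eq_or_imp, forall_eq,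
      Sym2.mk_isDiag_iff]
    by_cases hu : blockOf u ∈ S <;> by_cases hv : blockOf v ∈ S <;> simp [hu, hv, eq_comm]

-- Pairs of blocks not both in `S` are exact because their input bit is fair, and diagonal ones by
-- construction. For the others the output law is `A`, at distance at most `ε` from its target, and
-- there are at most `(n + 1) ^ 2` of them.
open Classical in
theorem sum_abs_channelMass_sub_le {q d ε : ℝ} (hε0 : 0 ≤ ε) (hq : 0 < q) (hq2 : q ≤ 1 / 4) (hd : 0 ≤ d)
    (hdq : d ≤ q) {A B : ∀ i, (BlockFiber n l i → Bool) → ℝ} (hA : ∀ i a, 0 ≤ A i a)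
    (hA1 : ∀ i, ∑ a, A i a = 1)
    (hAB : ∀ i a, A i a + B i a = 2 * bernoulliMass (fun _ => q) a)
    (hdiag : ∀ i, i.IsDiag → ∀ a, A i a = bernoulliMass (fun _ => q) a)
    (hε : ∀ i, ∑ a, |A i a - bernoulliMass (fun _ => if i.IsDiag then q else q + d) a| ≤ ε)
    (S : Finset (Fin n)) :
    ∑ y, |channelMass A B (fun e => if ∀ v ∈ e.1, v ∈ S then 1 else 1 / 2) y -
      bernoulliMass (fun e : VertexPair (n * l) => blockWeight S S (q + d) q e.1) y| ≤
      (n + 1) ^ 2 * ε := by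
  -- Within a fiber of pairs between two given blocks, the target weight is constant.
  let c : Sym2 (Fin n) → ℝ := fun i =>
    if ∀ v ∈ i, v ∈ S then (if i.IsDiag then q else q + d) else q
  have hc : ∀ i, c i = q ∨ c i = q + d := fun i => by
    simp only [c]
    split_ifs <;> simp
  let ν : ∀ i, (BlockFiber n l i → Bool) → ℝ := fun i a => if i.IsDiag then A i a else
    (if ∀ v ∈ i, v ∈ S then 1 else 1 / 2) * A i a +
      (1 - if ∀ v ∈ i, v ∈ S then 1 else 1 / 2) * B i a
  have hν : ∀ i, ν i = A i ∨ ν i = fun a => bernoulliMass (fun _ => q) a := by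
    intro i
    by_cases h : i.IsDiag
    · left
      ext a
      simp [ν, h]
    · by_cases hS : ∀ v ∈ i, v ∈ S
      · left
        ext a
        simp only [ν, if_neg h, if_pos hS]
        ring
      · right
        ext a
        simp only [ν, if_neg h, if_neg hS]
        linarith [hAB i a]
  have e1 : ∀ y, channelMass A B (fun e => if ∀ v ∈ e.1, v ∈ S then 1 else 1 / 2) y =
      ∏ i, ν i (fiberBits n l y i) := fun y =>
    Finset.prod_congr rfl fun i _ => by
      simp only [ν]
      split_ifs <;> rfl
  have e2 : ∀ y, bernoulliMass (fun e : VertexPair (n * l) => blockWeight S S (q + d) q e.1) y =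
      ∏ i, bernoulliMass (fun _ => c i) (fiberBits n l y i) := fun y => by
    rw [bernoulliMass_eq_prod_fiber]
    refine Finset.prod_congr rfl fun i _ => ?_
    congr 1
    ext e
    rw [blockWeight_self_eq, e.2]
  simp_rw [e1, e2]
  rw [(fiberBits n l).sum_comp fun z => |∏ i, ν i (z i) - ∏ i, bernoulliMass (fun _ => c i) (z i)|]
  refine (sum_abs_prod_sub_prod_le (μ := ν) (ν := fun i a => bernoulliMass (fun _ => c i) a)
    ?_ ?_ ?_ ?_).trans ?_
  · intro i a
    rcases hν i with h | h <;> rw [h]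
    · exact hA i a
    · exact bernoulliMass_nonneg (fun _ => hq.le) (fun _ => by linarith) a
  · intro i a
    rcases hc i with h | h <;> rw [h]
    · exact bernoulliMass_nonneg (fun _ => hq.le) (fun _ => by linarith) a
    · exact bernoulliMass_nonneg (fun _ => by linarith) (fun _ => by linarith) a
  · intro i
    rcases hν i with h | h <;> rw [h]
    · exact hA1 i
    · exact sum_bernoulliMass _
  · exact fun i => sum_bernoulliMass _
  · have h1 : ∀ i ∈ (Finset.univ : Finset (Sym2 (Fin n))),
        ∑ a, |ν i a - bernoulliMass (fun _ => c i) a| ≤ ε := by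
      intro i _
      by_cases h : i.IsDiag
      · have e : ∀ a, ν i a - bernoulliMass (fun _ => c i) a = 0 := by
          intro a
          simp [ν, c, h, hdiag i h a]
        simpa [e] using hε0
      · by_cases hS : ∀ v ∈ i, v ∈ S
        · refine le_trans (le_of_eq (Finset.sum_congr rfl fun a _ => ?_)) (hε i)
          have e : c i = if i.IsDiag then q else q + d := if_pos hS
          rw [e]
          simp only [ν, if_neg h, if_pos hS]
          congr 2
          ring
        · have e : ∀ a, ν i a - bernoulliMass (fun _ => c i) a = 0 := by
            intro a
            have e : c i = q := if_neg hS
            rw [e]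
            simp only [ν, if_neg h, if_neg hS]
            linarith [hAB i a]
          simpa [e] using hε0
    refine (Finset.sum_le_card_nsmul _ _ _ h1).trans ?_
    rw [nsmul_eq_mul]
    refine mul_le_mul_of_nonneg_right ?_ hε0
    rw [Finset.card_univ, Sym2.card, Fintype.card_fin]
    have := choose_two_le_sq (n + 1)
    push_cast at this
    exact this

/-- The map of graphs given by fixed samples and a fixed relabelling. -/
noncomputable def blowupGraph (σ : Equiv.Perm (Fin (n * l)))
    (Z : ∀ i, (BlockFiber n l i → Bool) × (BlockFiber n l i → Bool)) (G : SimpleGraph (Fin n)) :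
    SimpleGraph (Fin (n * l)) :=
  (graphBits _).symm fun e => selectBits Z (graphBits n G) (pairPerm σ e)

-- With samples and relabelling fixed, an output bit is one of two constants, chosen by the input
-- bit of the corresponding pair of blocks. This is the form that compiles to a straight-line
-- program.
open Classical in
theorem blowupGraph_adj (σ : Equiv.Perm (Fin (n * l)))
    (Z : ∀ i, (BlockFiber n l i → Bool) × (BlockFiber n l i → Bool)) (u v : Fin (n * l)) :
    ∃ a b : Fin n, ∃ h : Bool → Bool,
      ∀ G, (blowupGraph σ Z G).Adj u v ↔ h (decide (G.Adj a b)) = true := by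
  by_cases huv : u = v
  · exact ⟨blockOf u, blockOf u, fun _ => false, fun G => by simp [huv]⟩
  have hd : ¬ (s(u, v) : Sym2 _).IsDiag := fun h => huv (Sym2.mk_isDiag_iff.1 h)
  set e := pairPerm σ ⟨s(u, v), hd⟩ with he
  have hadj : ∀ G, (blowupGraph σ Z G).Adj u v ↔ selectBits Z (graphBits n G) e = true := by
    intro G
    rw [← SimpleGraph.mem_edgeSet,
      ← graphBits_apply_eq_true (blowupGraph σ Z G) ⟨s(u, v), hd⟩, blowupGraph,
      Equiv.apply_symm_apply]
  have hsel : ∀ G, selectBits Z (graphBits n G) e =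
      if extendBits (graphBits n G) (pairBlock e) then (Z (pairBlock e)).1 ⟨e, rfl⟩
      else (Z (pairBlock e)).2 ⟨e, rfl⟩ := by
    intro G
    simp only [selectBits, fiberBits, Equiv.coe_fn_symm_mk]
    split_ifs <;> rfl
  obtain ⟨a, b, hab⟩ : ∃ a b, pairBlock e = s(a, b) := by
    induction pairBlock e with
    | _ a b => exact ⟨a, b, rfl⟩
  refine ⟨a, b, fun β => if (β || decide (pairBlock e).IsDiag) then (Z (pairBlock e)).1 ⟨e, rfl⟩
      else (Z (pairBlock e)).2 ⟨e, rfl⟩, fun G => ?_⟩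
  rw [hadj, hsel]
  have : extendBits (graphBits n G) (pairBlock e) =
      (decide (G.Adj a b) || decide (pairBlock e).IsDiag) := by
    unfold extendBits
    by_cases h : (pairBlock e).IsDiag
    · simp [h]
    · rw [dif_neg h, decide_eq_false h, Bool.or_false, Bool.eq_iff_iff, graphBits_apply_eq_true,
        decide_eq_true_eq]
      simp only [hab, SimpleGraph.mem_edgeSet]
  rw [this]

open Classical in
/-- The reduction from planted clique to planted dense subgraph. -/
theorem exists_test_of_blowup {k r : ℕ} (hk : k ≤ n) (hl0 : 0 < l) {q d : ℝ} (hq : 0 < q)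
    (hq2 : q ≤ 1 / 4) (hd : 0 ≤ d) (hrd : (r + 1) * d ≤ q) (hl : 2 * d ^ 2 / q * l ^ 2 ≤ 1)
    (φ : Test (n * l)) :
    ∃ A : Test n, A.time = φ.time + (4 * (n * l * (n * l)) + 2) ∧
      A.program.size ≤ (4 * (n * l * (n * l)) + 2) * (6 * (n * l * (n * l)) + n * l + 6) +
        (φ.program.size + φ.program.size * (4 * (n * l * (n * l)) + 2)) ∧
      A.error (erdosRenyi n (1 / 2)) (plantedClique n k (1 / 2)) ≤
        φ.error (erdosRenyi (n * l) q) (plantedDense (n * l) (k * l) (q + d) q) +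
          ((n + 1) ^ 2 * (2 * (Real.exp (l ^ 2 * ((r + 1) ^ 2 * (2 * d ^ 2 / q))) / 2 ^ r)) +
            √(2 * (2 * d ^ 2 / q)) * l * (1 + Real.log k)) := by
  have hdq : d ≤ q := le_trans (by nlinarith [Nat.cast_nonneg (α := ℝ) r]) hrd
  obtain ⟨A, B, hA, hB, hA1, hB1, hAB, hdiag, hε⟩ := exists_channel n l hq hq2 hd hrd
  set ε := 2 * (Real.exp (l ^ 2 * ((r + 1) ^ 2 * (2 * d ^ 2 / q))) / 2 ^ r) with hεdef
  have hε0 : 0 ≤ ε := by positivity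
  set η := √(2 * (2 * d ^ 2 / q)) * l * (1 + Real.log k) with hη
  have hnN : n ≤ n * l := Nat.le_mul_of_pos_right n hl0
  choose C hC1 hC2 hC3 using fun (σ : Equiv.Perm (Fin (n * l)))
    (Z : ∀ i, (BlockFiber n l i → Bool) × (BlockFiber n l i → Bool)) =>
    exists_test_comp hnN φ (blowupGraph σ Z) (blowupGraph_adj σ Z)
  -- The randomness of the reduction: a uniform relabelling and independent samples from `A` and `B`
  -- for all pairs of blocks.
  let Ω := Equiv.Perm (Fin (n * l)) × (∀ i, (BlockFiber n l i → Bool) × (BlockFiber n l i → Bool))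
  let ρ : Ω → ℝ := fun ω => (∏ i, A i (ω.2 i).1 * B i (ω.2 i).2) / ((n * l).factorial : ℝ)
  have hN : (0 : ℝ) < ((n * l).factorial : ℝ) := by positivity
  have hρ0 : ∀ ω, 0 ≤ ρ ω := fun ω =>
    div_nonneg (Finset.prod_nonneg fun i _ => mul_nonneg (hA i _) (hB i _)) hN.le
  have hperm : (Fintype.card (Equiv.Perm (Fin (n * l))) : ℝ) = ((n * l).factorial : ℝ) := by
    rw [Fintype.card_perm, Fintype.card_fin]
  have hρ1 : ∑ ω, ρ ω = 1 := by
    rw [Fintype.sum_prod_type]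
    simp only [ρ]
    rw [Finset.sum_const, Finset.card_univ, nsmul_eq_mul, hperm, ← Finset.sum_div,
      sum_pi_prod (fun i (z : (BlockFiber n l i → Bool) × (BlockFiber n l i → Bool)) =>
        A i z.1 * B i z.2)]
    have : ∀ i, ∑ z : (BlockFiber n l i → Bool) × (BlockFiber n l i → Bool),
        A i z.1 * B i z.2 = 1 := by
      intro i
      rw [Fintype.sum_prod_type]
      simp_rw [← Finset.mul_sum, hB1, mul_one]
      exact hA1 i
    simp_rw [this]
    rw [Finset.prod_const_one]
    field_simp
  let T : Bool → (VertexPair (n * l) → Bool) → ℝ := fun b y => φ.prob b ((graphBits _).symm y)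
  let M : Bool → (VertexPair (n * l) → Bool) → ℝ := fun b y =>
    (∑ σ : Equiv.Perm (Fin (n * l)), T b fun e => y (pairPerm σ e)) / ((n * l).factorial : ℝ)
  have hT0 : ∀ b y, 0 ≤ T b y := fun b y => φ.prob_nonneg b _
  have hT1 : ∀ b y, T b y ≤ 1 := by
    intro b y
    have h1 := φ.prob_false ((graphBits _).symm y)
    have h2 := φ.prob_nonneg true ((graphBits _).symm y)
    have h3 := φ.prob_nonneg false ((graphBits _).symm y)
    cases b <;> simp only [T] <;> linarith
  have hM0 : ∀ b y, 0 ≤ M b y := fun b y =>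
    div_nonneg (Finset.sum_nonneg fun σ _ => hT0 b _) hN.le
  have hM1 : ∀ b y, M b y ≤ 1 := fun b y => by
    simp only [M]
    rw [div_le_one hN, ← hperm]
    simpa using Finset.sum_le_card_nsmul Finset.univ _ 1
      fun (σ : Equiv.Perm (Fin (n * l))) _ => hT1 b fun e => y (pairPerm σ e)
  have hmean : ∀ (w : VertexPair n → ℝ) (b : Bool),
      ∑ ω : Ω, ρ ω * ∑ G : SimpleGraph (Fin n), bernoulliMass w (graphBits n G) *
        (C ω.1 ω.2).prob b G = ∑ y, channelMass A B w y * M b y := by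
    intro w b
    have h1 : ∀ σ : Equiv.Perm (Fin (n * l)), ∑ Z : ∀ i, (BlockFiber n l i → Bool) ×
        (BlockFiber n l i → Bool), ρ (σ, Z) * ∑ G : SimpleGraph (Fin n),
          bernoulliMass w (graphBits n G) * (C σ Z).prob b G =
        (∑ y, channelMass A B w y * T b fun e => y (pairPerm σ e)) /
          ((n * l).factorial : ℝ) := by
      intro σ
      rw [← sum_selectBits_eq hA1 hB1 w fun y => T b fun e => y (pairPerm σ e), Finset.sum_div]
      refine Finset.sum_congr rfl fun Z _ => ?_
      simp only [ρ, hC3]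
      rw [div_mul_eq_mul_div, ← sum_graph_eq_sum_bits fun x => bernoulliMass w x *
        T b fun e => selectBits Z x (pairPerm σ e)]
      rfl
    rw [Fintype.sum_prod_type, Finset.sum_congr rfl fun σ _ => h1 σ, ← Finset.sum_div,
      Finset.sum_comm, Finset.sum_div]
    refine Finset.sum_congr rfl fun y _ => ?_
    rw [← Finset.mul_sum, mul_div_assoc]
  have h0 : ∑ ω : Ω, ρ ω * ∑ G, erdosRenyi n (1 / 2) G * (C ω.1 ω.2).prob true G =
      ∑ G, erdosRenyi (n * l) q G * φ.prob true G := by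
    have h1 : ∀ G : SimpleGraph (Fin n), erdosRenyi n (1 / 2) G =
        bernoulliMass (fun _ => 1 / 2) (graphBits n G) := fun G => edgeMass_eq_bernoulliMass _ G
    simp_rw [h1]
    rw [hmean]
    simp_rw [channelMass_half hAB hdiag]
    simp only [M]
    rw [sum_average_perm_eq, ← sum_graph_eq_sum_bits]
    refine Finset.sum_congr rfl fun G _ => ?_
    rw [Finset.sum_const, Finset.card_univ, nsmul_eq_mul, hperm, mul_div_assoc, mul_div_cancel₀ _ hN.ne',
      erdosRenyi, edgeMass_eq_bernoulliMass]
    simp only [T, Equiv.symm_apply_apply]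
  -- Two replacements: the channel output by exact Bernoulli bits, at cost `(n + 1) ^ 2 * ε`, and,
  -- after relabelling, the lowered blocks by full ones, at cost `η`. The test takes values in `[0,
  -- 1]`, so an `ℓ¹` distance bounds the change.
  have hS : ∀ S : Finset (Fin n), S.card = k →
      ∑ y, channelMass A B (fun e => if ∀ v ∈ e.1, v ∈ S then 1 else 1 / 2) y * M false y ≤
        ∑ G, plantedDense (n * l) (k * l) (q + d) q G * φ.prob false G +
          ((n + 1) ^ 2 * ε + η) := by
    intro S hSk
    have h1 := sum_abs_channelMass_sub_le hε0 hq hq2 hd hdq hA hA1 hAB hdiag hε S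
    have h2 := sum_abs_blockMixture_le (l := l) (S := S) hq hq2 hd hdq hl
    rw [hSk, ← hη] at h2
    have h3 : ∑ y, channelMass A B (fun e => if ∀ v ∈ e.1, v ∈ S then 1 else 1 / 2) y * M false y ≤
        ∑ y, bernoulliMass (fun e : VertexPair (n * l) => blockWeight S S (q + d) q e.1) y *
          M false y + (n + 1) ^ 2 * ε := by
      refine le_trans ?_ (add_le_add_right h1 _)
      rw [← Finset.sum_add_distrib]
      refine Finset.sum_le_sum fun y _ => ?_
      have h4 := le_abs_self (channelMass A B (fun e => if ∀ v ∈ e.1, v ∈ S then 1 else 1 / 2) y -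
        bernoulliMass (fun e : VertexPair (n * l) => blockWeight S S (q + d) q e.1) y)
      nlinarith [hM0 false y, hM1 false y, abs_nonneg (channelMass A B
        (fun e => if ∀ v ∈ e.1, v ∈ S then 1 else 1 / 2) y -
        bernoulliMass (fun e : VertexPair (n * l) => blockWeight S S (q + d) q e.1) y)]
    have h5 : ∑ y, bernoulliMass (fun e : VertexPair (n * l) => blockWeight S S (q + d) q e.1) y *
          M false y = ∑ y, blockMixture l S S (q + d) q y * T false y := by
      simp only [M]
      exact sum_average_perm_eq _ _
    have h6 : ∑ y, blockMixture l S S (q + d) q y * T false y ≤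
        ∑ y, blockMixture l S ∅ (q + d) q y * T false y + η := by
      refine le_trans ?_ (add_le_add_right h2 _)
      rw [← Finset.sum_add_distrib]
      refine Finset.sum_le_sum fun y _ => ?_
      have h4 := neg_abs_le (blockMixture l S ∅ (q + d) q y - blockMixture l S S (q + d) q y)
      nlinarith [hT0 false y, hT1 false y, abs_nonneg (blockMixture l S ∅ (q + d) q y -
        blockMixture l S S (q + d) q y)]
    have h7 : ∑ y, blockMixture l S ∅ (q + d) q y * T false y =
        ∑ G, plantedDense (n * l) (k * l) (q + d) q G * φ.prob false G := by
      rw [← sum_graph_eq_sum_bits]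
      refine Finset.sum_congr rfl fun G _ => ?_
      rw [plantedDense_eq_blockMixture hSk]
      simp only [T, Equiv.symm_apply_apply]
    linarith
  have h1 : ∑ ω : Ω, ρ ω * ∑ G, plantedClique n k (1 / 2) G * (C ω.1 ω.2).prob false G ≤
      ∑ G, plantedDense (n * l) (k * l) (q + d) q G * φ.prob false G + ((n + 1) ^ 2 * ε + η) := by
    have hch : (0 : ℝ) < n.choose k := by exact_mod_cast Nat.choose_pos hk
    have h2 : ∀ G : SimpleGraph (Fin n), ∀ c : ℝ, plantedClique n k (1 / 2) G * c =
        (∑ S ∈ Finset.powersetCard k (Finset.univ : Finset (Fin n)),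
          bernoulliMass (fun e : VertexPair n => if ∀ v ∈ e.1, v ∈ S then 1 else 1 / 2)
            (graphBits n G) * c) / (n.choose k : ℝ) := by
      intro G c
      rw [plantedClique_eq_plantedDense, plantedDense, div_mul_eq_mul_div, Finset.sum_mul]
      simp_rw [edgeMass_eq_bernoulliMass]
    simp_rw [h2, ← Finset.sum_div, mul_div_assoc', ← Finset.sum_div]
    rw [div_le_iff₀ hch]
    have h3 : ∑ ω : Ω, ρ ω * ∑ G : SimpleGraph (Fin n),
        ∑ S ∈ Finset.powersetCard k (Finset.univ : Finset (Fin n)),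
          bernoulliMass (fun e : VertexPair n => if ∀ v ∈ e.1, v ∈ S then 1 else 1 / 2)
            (graphBits n G) * (C ω.1 ω.2).prob false G =
        ∑ S ∈ Finset.powersetCard k (Finset.univ : Finset (Fin n)),
          ∑ y, channelMass A B (fun e => if ∀ v ∈ e.1, v ∈ S then 1 else 1 / 2) y * M false y := by
      rw [← Finset.sum_congr rfl fun S _ => hmean _ false, Finset.sum_comm]
      refine Finset.sum_congr rfl fun ω _ => ?_
      rw [Finset.sum_comm, Finset.mul_sum]
    rw [h3]
    refine (Finset.sum_le_card_nsmul _ _ _ fun S hSm => hS S (Finset.mem_powersetCard.1 hSm).2).trans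
      (le_of_eq ?_)
    rw [Finset.card_powersetCard, Finset.card_univ, Fintype.card_fin, nsmul_eq_mul, mul_comm]
  -- The sum of both errors is averaged, so that one outcome serves both hypotheses.
  obtain ⟨ω, hω⟩ := exists_le_of_sum_mul_le hρ0 hρ1
    (f := fun ω => (C ω.1 ω.2).error (erdosRenyi n (1 / 2)) (plantedClique n k (1 / 2)))
    (B := φ.error (erdosRenyi (n * l) q) (plantedDense (n * l) (k * l) (q + d) q) +
          ((n + 1) ^ 2 * ε + η)) (by
      simp only [Test.error, mul_add]
      rw [Finset.sum_add_distrib, h0]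
      linarith)
  exact ⟨C ω.1 ω.2, hC1 _ _, hC2 _ _, hω⟩

end Reduction

/-! ### Choice of the parameters -/

/-- `m ^ θ`, rounded up to a positive integer. -/
noncomputable def powCeil (θ : ℝ) (m : ℕ) : ℕ := max 1 ⌈(m : ℝ) ^ θ⌉₊

theorem powCeil_pos (θ : ℝ) (m : ℕ) : 0 < powCeil θ m := lt_of_lt_of_le one_pos (le_max_left _ _)

theorem rpow_le_powCeil (θ : ℝ) (m : ℕ) : (m : ℝ) ^ θ ≤ powCeil θ m :=
  (Nat.le_ceil _).trans (by exact_mod_cast le_max_right _ _)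

theorem powCeil_le_of_le {θ : ℝ} {m a : ℕ} (ha : 1 ≤ a) (h : (m : ℝ) ^ θ ≤ a) : powCeil θ m ≤ a :=
  max_le ha (Nat.ceil_le.2 h)

theorem powCeil_le_two_mul {θ : ℝ} (hθ : 0 ≤ θ) {m : ℕ} (hm : 1 ≤ m) :
    (powCeil θ m : ℝ) ≤ 2 * (m : ℝ) ^ θ := by
  have h1 : (1 : ℝ) ≤ (m : ℝ) ^ θ := Real.one_le_rpow (by exact_mod_cast hm) hθ
  have h2 : ((⌈(m : ℝ) ^ θ⌉₊ : ℕ) : ℝ) < (m : ℝ) ^ θ + 1 := Nat.ceil_lt_add_one (by linarith)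
  unfold powCeil
  push_cast
  exact max_le (by linarith) (by linarith)

theorem powCeil_le_self {θ : ℝ} (hθ : θ ≤ 1) {m : ℕ} (hm : 1 ≤ m) : powCeil θ m ≤ m := by
  refine powCeil_le_of_le hm ?_
  calc (m : ℝ) ^ θ ≤ (m : ℝ) ^ (1 : ℝ) := Real.rpow_le_rpow_of_exponent_le (by exact_mod_cast hm) hθ
    _ = m := Real.rpow_one _

theorem powCeil_le_pow {θ : ℝ} {m : ℕ} (hm : 1 ≤ m) : powCeil θ m ≤ m ^ ⌈θ⌉₊ := by
  refine powCeil_le_of_le (Nat.one_le_pow _ _ hm) ?_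
  rw [Nat.cast_pow, ← Real.rpow_natCast]
  exact Real.rpow_le_rpow_of_exponent_le (by exact_mod_cast hm) (Nat.le_ceil _)

theorem tendsto_log_natCast : Tendsto (fun m : ℕ => Real.log m) atTop atTop :=
  Real.tendsto_log_atTop.comp tendsto_natCast_atTop_atTop

theorem tendsto_log_powCeil_div {θ : ℝ} (hθ : 0 ≤ θ) :
    Tendsto (fun m : ℕ => Real.log (powCeil θ m) / Real.log m) atTop (𝓝 θ) := by
  have h1 : Tendsto (fun m : ℕ => θ + Real.log 2 / Real.log m) atTop (𝓝 θ) := by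
    simpa using (tendsto_const_nhds (x := θ)).add
      ((tendsto_const_nhds (x := Real.log 2)).div_atTop tendsto_log_natCast)
  refine tendsto_of_tendsto_of_tendsto_of_le_of_le' tendsto_const_nhds h1 ?_ ?_
  · filter_upwards [eventually_gt_atTop 1] with m hm
    have hm' : (1 : ℝ) < m := by exact_mod_cast hm
    rw [le_div_iff₀ (Real.log_pos hm'), ← Real.log_rpow (by linarith)]
    exact Real.log_le_log (by positivity) (rpow_le_powCeil θ m)
  · filter_upwards [eventually_gt_atTop 1] with m hm
    have hm' : (1 : ℝ) < m := by exact_mod_cast hm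
    have hlog := Real.log_pos hm'
    have h2 : Real.log (powCeil θ m) ≤ Real.log 2 + θ * Real.log m := by
      rw [← Real.log_rpow (by linarith), ← Real.log_mul (by norm_num) (by positivity)]
      exact Real.log_le_log (by exact_mod_cast powCeil_pos θ m) (powCeil_le_two_mul hθ hm.le)
    rw [div_le_iff₀ hlog, add_mul, div_mul_cancel₀ _ hlog.ne']
    linarith

/-- A logarithmic factor. -/
def logFactor (N : ℕ) : ℕ := 3 * (Nat.log 2 N + 1)

/-- Using `logFactor N` as the order of the moment, the excess mass `O(N ^ (-3))` survives a union
over at most `O(N ^ 2)` pairs of blocks. -/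
theorem pow_three_le_two_pow_logFactor (N : ℕ) : N ^ 3 ≤ 2 ^ logFactor N := by
  have : N < 2 ^ (Nat.log 2 N + 1) := Nat.lt_pow_succ_log_self one_lt_two N
  rw [logFactor, mul_comm, pow_mul]
  exact Nat.pow_le_pow_left this.le 3

/-- Lets the harmonic sum of the hybrid argument be absorbed by the logarithmic factor in
`densityGap`. -/
theorem log_add_one_le_logFactor {N : ℕ} (hN : 1 ≤ N) : Real.log N + 1 ≤ logFactor N + 1 := by
  have h1 : (N : ℝ) ≤ 2 ^ (Nat.log 2 N + 1) := by
    exact_mod_cast (Nat.lt_pow_succ_log_self one_lt_two N).le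
  have h2 := Real.log_le_log (by exact_mod_cast hN) h1
  rw [Real.log_pow] at h2
  have h3 : Real.log 2 ≤ 1 := by linarith [Real.log_two_lt_d9]
  have h4 : (0 : ℝ) ≤ ((Nat.log 2 N + 1 : ℕ) : ℝ) := Nat.cast_nonneg _
  unfold logFactor
  push_cast at *
  nlinarith

theorem logFactor_add_one_le {N : ℕ} (hN : 1 ≤ N) : (logFactor N + 1 : ℝ) ≤ 6 * Real.log N + 4 := by
  have h1 : ((2 ^ Nat.log 2 N : ℕ) : ℝ) ≤ N := by
    exact_mod_cast Nat.pow_log_le_self 2 (by omega)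
  have h2 := Real.log_le_log (by positivity) h1
  push_cast at h2
  rw [Real.log_pow] at h2
  have h3 : 1 / 2 ≤ Real.log 2 := by linarith [Real.log_two_gt_d9]
  have h4 : (0 : ℝ) ≤ (Nat.log 2 N : ℝ) := Nat.cast_nonneg _
  unfold logFactor
  push_cast
  nlinarith

theorem tendsto_log_logFactor_div {N : ℕ → ℕ} (hN : Tendsto N atTop atTop) :
    Tendsto (fun n => Real.log (logFactor (N n) + 1) / Real.log (N n)) atTop (𝓝 0) := by
  have hL : Tendsto (fun n => Real.log (N n)) atTop atTop := tendsto_log_natCast.comp hN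
  have h1 : Tendsto (fun n => Real.log 10 / Real.log (N n) +
      Real.log (Real.log (N n)) / Real.log (N n)) atTop (𝓝 0) := by
    have h2 : Tendsto (fun y : ℝ => Real.log y / y) atTop (𝓝 0) :=
      Real.isLittleO_log_id_atTop.tendsto_div_nhds_zero
    simpa using ((tendsto_const_nhds (x := Real.log 10)).div_atTop hL).add (h2.comp hL)
  refine tendsto_of_tendsto_of_tendsto_of_le_of_le' tendsto_const_nhds h1 ?_ ?_
  · filter_upwards [hL.eventually_gt_atTop 0] with n hn
    exact div_nonneg (Real.log_nonneg (by linarith [Nat.cast_nonneg (α := ℝ) (logFactor (N n))]))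
      hn.le
  · filter_upwards [hL.eventually_ge_atTop 1, hN.eventually_ge_atTop 1] with n hn hN1
    rw [← add_div, ← Real.log_mul (by norm_num) (by linarith)]
    refine div_le_div_of_nonneg_right (Real.log_le_log (by positivity) ?_) (by linarith)
    linarith [logFactor_add_one_le hN1]

/-- The background density. -/
noncomputable def bgDensity (α : ℝ) (N : ℕ) : ℝ := (N : ℝ) ^ (-α) / 4

/-- The elevation of the density in the planted part. -/
noncomputable def densityGap (γ : ℝ) (N : ℕ) : ℝ :=
  (N : ℝ) ^ (-γ) / (16 * (logFactor N + 1 : ℝ) ^ 3)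

theorem bgDensity_pos (α : ℝ) {N : ℕ} (hN : 1 ≤ N) : 0 < bgDensity α N := by
  have : (0 : ℝ) < N := by exact_mod_cast hN
  unfold bgDensity
  positivity

theorem bgDensity_le {α : ℝ} (hα : 0 ≤ α) {N : ℕ} (hN : 1 ≤ N) : bgDensity α N ≤ 1 / 4 := by
  have : (N : ℝ) ^ (-α) ≤ 1 := Real.rpow_le_one_of_one_le_of_nonpos (by exact_mod_cast hN)
    (by linarith)
  unfold bgDensity
  linarith

theorem densityGap_pos (γ : ℝ) {N : ℕ} (hN : 1 ≤ N) : 0 < densityGap γ N := by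
  have : (0 : ℝ) < N := by exact_mod_cast hN
  unfold densityGap
  positivity

theorem logFactor_mul_densityGap_le {α γ : ℝ} (hαγ : α ≤ γ) {N : ℕ} (hN : 1 ≤ N) :
    (logFactor N + 1) * densityGap γ N ≤ bgDensity α N := by
  have hN' : (1 : ℝ) ≤ N := by exact_mod_cast hN
  have h1 : (N : ℝ) ^ (-γ) ≤ (N : ℝ) ^ (-α) :=
    Real.rpow_le_rpow_of_exponent_le hN' (by linarith)
  have h2 : 0 < (N : ℝ) ^ (-γ) := by positivity
  have h3 : (1 : ℝ) ≤ logFactor N + 1 := by linarith [Nat.cast_nonneg (α := ℝ) (logFactor N)]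
  set x : ℝ := logFactor N + 1 with hx
  unfold densityGap bgDensity
  rw [← hx, mul_div_assoc', div_le_div_iff₀ (by positivity) (by norm_num)]
  have h4 : x ≤ x ^ 3 := le_self_pow₀ h3 (by norm_num)
  nlinarith [mul_le_mul h1 h4 (by positivity) (by positivity)]

/-- `2 d ^ 2 / q` is the information per bit in both the moment and the `χ²` bound; the cube in
`densityGap` becomes a sixth power of slack. -/
theorem signal_eq (α γ : ℝ) {N : ℕ} (hN : 1 ≤ N) :
    2 * densityGap γ N ^ 2 / bgDensity α N =
      (N : ℝ) ^ (-(2 * γ - α)) / (32 * (logFactor N + 1 : ℝ) ^ 6) := by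
  have hN' : (0 : ℝ) < N := by exact_mod_cast hN
  have h1 : (N : ℝ) ^ (-(2 * γ - α)) = ((N : ℝ) ^ (-γ)) ^ 2 / (N : ℝ) ^ (-α) := by
    rw [← Real.rpow_natCast ((N : ℝ) ^ (-γ)), ← Real.rpow_mul hN'.le, ← Real.rpow_sub hN']
    congr 1
    push_cast
    ring
  rw [h1]
  unfold densityGap bgDensity
  have h2 : (N : ℝ) ^ (-α) ≠ 0 := by positivity
  have h3 : (logFactor N + 1 : ℝ) ≠ 0 := by positivity
  field_simp
  ring

/-- The loss of the reduction, for the above parameters. -/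
theorem reduction_loss_le {α γ : ℝ} {n l k : ℕ} (hn : 1 ≤ n) (hl0 : 1 ≤ l) (hk0 : 1 ≤ k)
    (hk : k ≤ n) (hl : (l : ℝ) ^ 2 ≤ 4 * ((n * l : ℕ) : ℝ) ^ (2 * γ - α)) :
    2 * densityGap γ (n * l) ^ 2 / bgDensity α (n * l) * l ^ 2 ≤ 1 ∧
    (n + 1 : ℝ) ^ 2 * (2 * (Real.exp (l ^ 2 * ((logFactor (n * l) + 1 : ℝ) ^ 2 *
      (2 * densityGap γ (n * l) ^ 2 / bgDensity α (n * l)))) / 2 ^ logFactor (n * l))) +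
      √(2 * (2 * densityGap γ (n * l) ^ 2 / bgDensity α (n * l))) * l * (1 + Real.log k) ≤
      24 / ((n * l : ℕ) : ℝ) + 1 / (logFactor (n * l) + 1 : ℝ) := by
  set N := n * l with hNdef
  have hN : 1 ≤ N := Nat.mul_pos hn hl0
  have hN' : (1 : ℝ) ≤ N := by exact_mod_cast hN
  rw [signal_eq α γ hN]
  set x : ℝ := logFactor N + 1 with hx
  have hx1 : 1 ≤ x := by
    have := Nat.cast_nonneg (α := ℝ) (logFactor N)
    linarith
  set Λ := (N : ℝ) ^ (-(2 * γ - α)) / (32 * x ^ 6) with hΛ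
  have hΛ0 : 0 ≤ Λ := by positivity
  -- The single smallness estimate: `l ^ 2` is at most `4` times the power of `N` in the denominator
  -- of `Λ`.
  have hΛl : Λ * l ^ 2 ≤ 1 / (8 * x ^ 6) := by
    have h1 : (N : ℝ) ^ (-(2 * γ - α)) * l ^ 2 ≤ 4 := by
      rw [Real.rpow_neg (by linarith), inv_mul_le_iff₀ (by positivity)]
      linarith
    rw [hΛ, div_mul_eq_mul_div, div_le_div_iff₀ (by positivity) (by positivity)]
    nlinarith [pow_pos (zero_lt_one.trans_le hx1) 6]
  have hx6 : 1 ≤ x ^ 6 := one_le_pow₀ hx1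
  refine ⟨hΛl.trans ((div_le_one (by positivity)).2 (by linarith)), add_le_add ?_ ?_⟩
  · have h1 : (l : ℝ) ^ 2 * (x ^ 2 * Λ) ≤ 1 := by
      calc (l : ℝ) ^ 2 * (x ^ 2 * Λ) = x ^ 2 * (Λ * l ^ 2) := by ring
        _ ≤ x ^ 2 * (1 / (8 * x ^ 6)) := by gcongr
        _ = 1 / (8 * x ^ 4) := by field_simp
        _ ≤ 1 := (div_le_one (by positivity)).2 (by nlinarith [one_le_pow₀ hx1 (n := 4)])
    have h2 : Real.exp ((l : ℝ) ^ 2 * (x ^ 2 * Λ)) ≤ 3 :=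
      (Real.exp_le_exp.2 h1).trans (by linarith [Real.exp_one_lt_d9])
    have h3 : (N : ℝ) ^ 3 ≤ 2 ^ logFactor N := by
      exact_mod_cast pow_three_le_two_pow_logFactor N
    have h4 : (n + 1 : ℝ) ^ 2 ≤ 4 * (N : ℝ) ^ 2 := by
      have h5 : n ≤ N := Nat.le_mul_of_pos_right n hl0
      have h5' : (n : ℝ) ≤ N := by exact_mod_cast h5
      have h6 : (0 : ℝ) ≤ n := Nat.cast_nonneg n
      nlinarith
    calc _ ≤ 4 * (N : ℝ) ^ 2 * (2 * (3 / (N : ℝ) ^ 3)) := by gcongr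
      _ = 24 / N := by
        field_simp
        norm_num
  · have h1 : √(2 * Λ) * l ≤ 1 / (2 * x ^ 3) := by
      refine le_of_sq_le_sq ?_ (by positivity)
      rw [mul_pow, Real.sq_sqrt (by positivity)]
      calc 2 * Λ * (l : ℝ) ^ 2 = 2 * (Λ * l ^ 2) := by ring
        _ ≤ 2 * (1 / (8 * x ^ 6)) := by gcongr
        _ = _ := by
          field_simp
          norm_num
    have h2 : 1 + Real.log k ≤ x := by
      have h3 : k ≤ N := hk.trans (Nat.le_mul_of_pos_right n hl0)
      have h4 : Real.log k ≤ Real.log N :=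
        Real.log_le_log (by exact_mod_cast hk0) (by exact_mod_cast h3)
      linarith [log_add_one_le_logFactor hN]
    have h3 : 0 ≤ 1 + Real.log k := by
      linarith [Real.log_nonneg (by exact_mod_cast hk0 : (1 : ℝ) ≤ k)]
    calc _ ≤ 1 / (2 * x ^ 3) * x := by gcongr
      _ = 1 / (2 * x ^ 2) := by field_simp
      _ ≤ 1 / x := by
        refine one_div_le_one_div_of_le (by linarith) ?_
        nlinarith

/-- The input size will be `N ^ ν`. The lower bounds on `ν` keep the blocks short enough to hide the
signal and the clique exponent nonnegative; `ν < 2 * (1 - β)` keeps the clique below the square root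
of the input size. The lower bound `1 - (2 * γ - α) / 2` is less than `2 * (1 - β)` exactly below
the boundary, and `3 / 2 * (1 - β)` is the midpoint of the remaining constraints. -/
theorem exists_exponent {α β γ : ℝ} (hα : 0 ≤ α) (hβ0 : 0 < β) (hβ1 : β < 1) (hαγ : α ≤ γ)
    (hβ : β < 1 / 2 + γ / 2 - α / 4) :
    ∃ ν : ℝ, ν ≤ 1 ∧ 2 * (1 - ν) ≤ 2 * γ - α ∧ 1 - β < ν ∧ ν < 2 * (1 - β) := by
  refine ⟨min 1 (max (1 - (2 * γ - α) / 2) (3 / 2 * (1 - β))), min_le_left _ _, ?_, ?_, ?_⟩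
  · have : 1 - (2 * γ - α) / 2 ≤ min 1 (max (1 - (2 * γ - α) / 2) (3 / 2 * (1 - β))) :=
      le_min (by linarith) (le_max_left _ _)
    linarith
  · exact lt_min (by linarith) (lt_max_of_lt_right (by linarith))
  · exact min_lt_of_right_lt (max_lt (by linarith) (by linarith))

/-! ### The lower bound -/

theorem polynomial_eval_mono (P : Polynomial ℕ) : Monotone fun a => P.eval a := by
  intro a b hab
  simp only [Polynomial.eval_eq_sum, Polynomial.sum]
  exact Finset.sum_le_sum fun i _ => Nat.mul_le_mul_left _ (Nat.pow_le_pow_left hab i)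

theorem RandomizedRAM.Test.prob_le_one {n : ℕ} (A : Test n) (b : Bool) (G : SimpleGraph (Fin n)) :
    A.prob b G ≤ 1 := by
  have h1 := A.prob_false G
  have h2 := A.prob_nonneg true G
  have h3 := A.prob_nonneg false G
  cases b <;> linarith

theorem RandomizedRAM.Test.error_le_two {n : ℕ} (A : Test n) {H₀ H₁ : SimpleGraph (Fin n) → ℝ}
    (h₀ : ∀ G, 0 ≤ H₀ G) (h₁ : ∀ G, 0 ≤ H₁ G) (s₀ : ∑ G, H₀ G = 1) (s₁ : ∑ G, H₁ G = 1) :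
    A.error H₀ H₁ ≤ 2 := by
  have h : ∀ (H : SimpleGraph (Fin n) → ℝ) (b : Bool), (∀ G, 0 ≤ H G) → ∑ G, H G = 1 →
      ∑ G, H G * A.prob b G ≤ 1 := fun H b hH sH => by
    rw [← sH]
    exact Finset.sum_le_sum fun G _ => mul_le_of_le_one_right (hH G) (A.prob_le_one b G)
  have h1 := h H₀ true h₀ s₀
  have h2 := h H₁ false h₁ s₁
  unfold Test.error
  linarith

section Parameters

variable (α γ θ κ : ℝ)

/-- The number of vertices in the lower bound. -/
noncomputable def lowerN (n : ℕ) : ℕ := (n + 1) * powCeil θ (n + 1)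

/-- The size of the planted set in the lower bound. -/
noncomputable def lowerK (n : ℕ) : ℕ := powCeil κ (n + 1) * powCeil θ (n + 1)

theorem one_le_lowerN (n : ℕ) : 1 ≤ lowerN θ n := Nat.mul_pos n.succ_pos (powCeil_pos _ _)

theorem tendsto_lowerN : Tendsto (lowerN θ) atTop atTop :=
  tendsto_atTop_mono (fun n => (Nat.le_succ n).trans (Nat.le_mul_of_pos_right _ (powCeil_pos _ _)))
    tendsto_id

variable {θ κ}

theorem tendsto_log_lowerK_div (hθ : 0 ≤ θ) (hκ : 0 ≤ κ) :
    Tendsto (fun n => Real.log (lowerK θ κ n) / Real.log (lowerN θ n)) atTop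
      (𝓝 ((κ + θ) / (1 + θ))) := by
  have h : Tendsto (fun m : ℕ => (Real.log (powCeil κ m) / Real.log m +
      Real.log (powCeil θ m) / Real.log m) / (1 + Real.log (powCeil θ m) / Real.log m)) atTop
      (𝓝 ((κ + θ) / (1 + θ))) :=
    ((tendsto_log_powCeil_div hκ).add (tendsto_log_powCeil_div hθ)).div
      (tendsto_const_nhds.add (tendsto_log_powCeil_div hθ)) (by linarith)
  refine (h.comp (tendsto_add_atTop_nat 1)).congr' ?_
  filter_upwards [eventually_gt_atTop 0] with n hn
  have hm : (1 : ℝ) < ((n + 1 : ℕ) : ℝ) := by exact_mod_cast Nat.succ_lt_succ hn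
  have hlog := (Real.log_pos hm).ne'
  have h1 : ((powCeil κ (n + 1) : ℕ) : ℝ) ≠ 0 := by exact_mod_cast (powCeil_pos κ (n + 1)).ne'
  have h2 : ((powCeil θ (n + 1) : ℕ) : ℝ) ≠ 0 := by exact_mod_cast (powCeil_pos θ (n + 1)).ne'
  simp only [Function.comp_apply, lowerK, lowerN]
  rw [Nat.cast_mul, Nat.cast_mul, Real.log_mul h1 h2, Real.log_mul (by linarith) h2, ← add_div]
  rw [← div_self hlog, ← add_div, div_div_div_cancel_right₀ hlog]

/-- Constants and powers of `logFactor` disappear after division by `log N`. -/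
theorem pdsRegime_lower {α γ β : ℝ} (hα : 0 ≤ α) (hαγ : α ≤ γ) (hθ : 0 ≤ θ) (hκ : 0 ≤ κ)
    (hκ1 : κ ≤ 1) (hβ : (κ + θ) / (1 + θ) = β) :
    PDSRegime α γ β (lowerN θ) (lowerK θ κ) (fun n => bgDensity α (lowerN θ n) +
      densityGap γ (lowerN θ n)) (fun n => bgDensity α (lowerN θ n)) := by
  have hN := tendsto_lowerN θ
  have hL : Tendsto (fun n => Real.log (lowerN θ n)) atTop atTop := tendsto_log_natCast.comp hN
  refine ⟨hN, fun n => Nat.mul_pos (powCeil_pos _ _) (powCeil_pos _ _),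
    fun n => Nat.mul_le_mul_right _ (powCeil_le_self hκ1 n.succ_pos),
    fun n => bgDensity_pos α (one_le_lowerN θ n),
    fun n => lt_add_of_pos_right _ (densityGap_pos γ (one_le_lowerN θ n)), fun n => ?_, ?_, ?_,
    hβ ▸ tendsto_log_lowerK_div hθ hκ⟩
  · have h1 := logFactor_mul_densityGap_le hαγ (one_le_lowerN θ n)
    have h2 := densityGap_pos γ (one_le_lowerN θ n)
    have h3 := bgDensity_le hα (one_le_lowerN θ n)
    have h4 := Nat.cast_nonneg (α := ℝ) (logFactor (lowerN θ n))
    nlinarith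
  · have h : Tendsto (fun n => α + Real.log 4 / Real.log (lowerN θ n)) atTop (𝓝 α) := by
      simpa using (tendsto_const_nhds (x := α)).add
        ((tendsto_const_nhds (x := Real.log 4)).div_atTop hL)
    refine h.congr' ?_
    filter_upwards [hL.eventually_gt_atTop 0] with n hn
    have hN0 : (0 : ℝ) < lowerN θ n := by exact_mod_cast one_le_lowerN θ n
    rw [bgDensity, Real.log_inv, Real.log_div (by positivity) (by norm_num), Real.log_rpow hN0]
    field_simp
    ring
  · have h : Tendsto (fun n => γ + Real.log 16 / Real.log (lowerN θ n) +
        3 * (Real.log (logFactor (lowerN θ n) + 1) / Real.log (lowerN θ n))) atTop (𝓝 γ) := by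
      simpa using ((tendsto_const_nhds (x := γ)).add
        ((tendsto_const_nhds (x := Real.log 16)).div_atTop hL)).add
          ((tendsto_log_logFactor_div hN).const_mul 3)
    refine h.congr' ?_
    filter_upwards [hL.eventually_gt_atTop 0] with n hn
    have hN0 : (0 : ℝ) < lowerN θ n := by exact_mod_cast one_le_lowerN θ n
    have h3 : (0 : ℝ) < logFactor (lowerN θ n) + 1 := by positivity
    simp only [add_sub_cancel_left]
    rw [densityGap, Real.log_inv, Real.log_div (by positivity) (by positivity),
      Real.log_rpow hN0, Real.log_mul (by norm_num) (by positivity), Real.log_pow]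
    field_simp
    push_cast
    ring

end Parameters

theorem lowerN_le_pow (θ : ℝ) (n : ℕ) : lowerN θ n ≤ (n + 1) ^ (⌈θ⌉₊ + 1) := by
  rw [pow_succ, mul_comm]
  exact Nat.mul_le_mul_left _ (powCeil_le_pow n.succ_pos)

/-- With `θ = (1 - ν) / ν` the total size is at least `m ^ (1 / ν)`, so `m ^ θ ≤ N ^ (1 - ν)`; the
factor `4` pays for rounding up. -/
theorem powCeil_sq_le {ν s : ℝ} (hν0 : 0 < ν) (hν1 : ν ≤ 1) (hs : 2 * (1 - ν) ≤ s) {m : ℕ}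
    (hm : 1 ≤ m) :
    (powCeil ((1 - ν) / ν) m : ℝ) ^ 2 ≤ 4 * ((m * powCeil ((1 - ν) / ν) m : ℕ) : ℝ) ^ s := by
  set θ := (1 - ν) / ν with hθ
  have hθ0 : 0 ≤ θ := div_nonneg (by linarith) hν0.le
  have hm' : (1 : ℝ) ≤ m := by exact_mod_cast hm
  have hm0 : (0 : ℝ) < m := by linarith
  set N := m * powCeil θ m with hN
  have h1 : (m : ℝ) ^ (1 / ν) ≤ N := by
    have : 1 / ν = 1 + θ := by
      rw [hθ]
      field_simp
      ring
    rw [this, Real.rpow_add hm0, Real.rpow_one, hN, Nat.cast_mul]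
    exact mul_le_mul_of_nonneg_left (rpow_le_powCeil θ m) hm0.le
  have hN1 : (1 : ℝ) ≤ N := (Real.one_le_rpow hm' (by positivity)).trans h1
  have h2 : (m : ℝ) ^ θ ≤ (N : ℝ) ^ (1 - ν) := by
    have : θ = 1 / ν * (1 - ν) := by
      rw [hθ]
      ring
    rw [this, Real.rpow_mul hm0.le]
    exact Real.rpow_le_rpow (by positivity) h1 (by linarith)
  have h3 : ((N : ℝ) ^ (1 - ν)) ^ 2 ≤ (N : ℝ) ^ s := by
    rw [← Real.rpow_natCast, ← Real.rpow_mul (by linarith)]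
    refine Real.rpow_le_rpow_of_exponent_le hN1 ?_
    push_cast
    linarith
  have h4 := powCeil_le_two_mul hθ0 hm
  calc (powCeil θ m : ℝ) ^ 2 ≤ (2 * (N : ℝ) ^ (1 - ν)) ^ 2 :=
        pow_le_pow_left₀ (Nat.cast_nonneg _) (h4.trans (by linarith)) 2
    _ = 4 * ((N : ℝ) ^ (1 - ν)) ^ 2 := by ring
    _ ≤ _ := by linarith

/-- The bounds `0 ≤ a` and `e ≤ 2` exclude the default values of `liminf` and `limsup` on unbounded
real sequences. -/
theorem one_le_limsup_of_le_add {a e η : ℕ → ℝ} (ha : ∀ n, 0 ≤ a n)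
    (h : 1 ≤ liminf a atTop) (hae : ∀ n, a (n + 1) ≤ e n + η n) (hη : Tendsto η atTop (𝓝 0))
    (he : ∀ n, e n ≤ 2) : 1 ≤ limsup e atTop := by
  refine le_of_forall_lt_imp_le_of_dense fun c hc => ?_
  have hb : IsBoundedUnder (· ≥ ·) atTop a :=
    isBoundedUnder_of ⟨0, fun n => ha n⟩
  have h1 : ∀ᶠ n in atTop, (c + 1) / 2 < a n :=
    eventually_lt_of_lt_liminf (lt_of_lt_of_le (by linarith) h) hb
  have h2 : ∀ᶠ n in atTop, η n < (1 - c) / 2 := hη.eventually_lt_const (by linarith)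
  refine le_limsup_of_frequently_le (Eventually.frequently ?_) (isBoundedUnder_of ⟨2, he⟩)
  filter_upwards [(tendsto_add_atTop_nat 1).eventually h1, h2] with n hn1 hn2
  linarith [hae n]

/-- Composing with the reduction turns `φ` into tests for planted cliques of size `n ^ κ`, `κ < 1 /
2`, with error larger by at most a vanishing loss. The conjecture bounds these errors from below. -/
theorem one_le_asymptoticErrorPDS {α γ ν θ κ : ℝ} (hα : 0 ≤ α) (hαγ : α ≤ γ) (hν0 : 0 < ν)
    (hν1 : ν ≤ 1) (hθ : θ = (1 - ν) / ν) (hs : 2 * (1 - ν) ≤ 2 * γ - α) (hκ : 0 ≤ κ) (hκ1 : κ < 1 / 2)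
    (hPC : PCConjecture (1 / 2)) (φ : ∀ n, Test (lowerN θ n))
    (hφ : PolynomialTime φ) :
    1 ≤ asymptoticErrorPDS φ (lowerK θ κ)
      (fun n => bgDensity α (lowerN θ n) + densityGap γ (lowerN θ n))
      (fun n => bgDensity α (lowerN θ n)) := by
  have hθ0 : 0 ≤ θ := hθ ▸ div_nonneg (by linarith) hν0.le
  have hsq : ∀ {m : ℕ}, 1 ≤ m →
      (powCeil θ m : ℝ) ^ 2 ≤ 4 * ((m * powCeil θ m : ℕ) : ℝ) ^ (2 * γ - α) := by
    intro m hm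
    rw [hθ]
    exact powCeil_sq_le hν0 hν1 hs hm
  obtain ⟨P, hP⟩ := hφ
  have hred := fun n : ℕ => exists_test_of_blowup (n := n + 1) (l := powCeil θ (n + 1))
    (k := powCeil κ (n + 1)) (r := logFactor (lowerN θ n))
    (powCeil_le_self (by linarith) n.succ_pos) (powCeil_pos _ _)
    (bgDensity_pos α (one_le_lowerN θ n)) (bgDensity_le hα (one_le_lowerN θ n))
    (densityGap_pos γ (one_le_lowerN θ n)).le
    (logFactor_mul_densityGap_le hαγ (one_le_lowerN θ n))
    (reduction_loss_le (α := α) (γ := γ) n.succ_pos (powCeil_pos θ (n + 1))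
      (powCeil_pos κ (n + 1)) (powCeil_le_self (by linarith) n.succ_pos)
      (hsq n.succ_pos)).1 (φ n)
  choose A hA1 hA2 hA3 using hred
  -- The `n`-th problem comes from graphs on `n + 1` vertices; size `0` gets a dummy program,
  -- irrelevant for the limit.
  let A' : ∀ m, Test m := fun m => match m with
    | 0 => ⟨[], 0, fun _ _ => Nat.zero_le _⟩
    | n + 1 => A n
  have hpoly : PolynomialTime A' := by
    let E := ⌈θ⌉₊ + 1
    -- The sum of the time and size bounds in terms of `N`; composing with `X ^ E`, where `N ≤ (n +
    -- 1) ^ E`, makes it a polynomial in the input size.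
    let Q : Polynomial ℕ := (P + (4 * (.X * .X) + 2)) +
      ((4 * (.X * .X) + 2) * (6 * (.X * .X) + .X + 6) + (P + P * (4 * (.X * .X) + 2)))
    refine ⟨Q.comp (.X ^ E), fun m => ?_⟩
    cases m with
    | zero => exact ⟨Nat.zero_le _, Nat.zero_le _⟩
    | succ n =>
      have h1 := lowerN_le_pow θ n
      have h2 : Q.eval (lowerN θ n) ≤ (Q.comp (.X ^ E)).eval (n + 1) := by
        rw [Polynomial.eval_comp, Polynomial.eval_pow, Polynomial.eval_X]
        exact polynomial_eval_mono Q h1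
      have h3 : Q.eval (lowerN θ n) = (P.eval (lowerN θ n) + (4 * (lowerN θ n * lowerN θ n) + 2)) +
          ((4 * (lowerN θ n * lowerN θ n) + 2) *
            (6 * (lowerN θ n * lowerN θ n) + lowerN θ n + 6) +
          (P.eval (lowerN θ n) +
            P.eval (lowerN θ n) * (4 * (lowerN θ n * lowerN θ n) + 2))) := by
        simp [Q]
      have h4 : (A n).time = (φ n).time + (4 * (lowerN θ n * lowerN θ n) + 2) := hA1 n
      have h5 : (A n).program.size ≤ (4 * (lowerN θ n * lowerN θ n) + 2) *
          (6 * (lowerN θ n * lowerN θ n) + lowerN θ n + 6) + ((φ n).program.size +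
            (φ n).program.size * (4 * (lowerN θ n * lowerN θ n) + 2)) := hA2 n
      have h6 := Nat.mul_le_mul_right (4 * (lowerN θ n * lowerN θ n) + 2) (hP n).2
      have h7 := hP n
      refine ⟨le_trans ?_ h2, le_trans ?_ h2⟩
      · change (A n).time ≤ _
        omega
      · change (A n).program.size ≤ _
        omega
  have hlim : limsup (fun n : ℕ => ((Real.logb n (powCeil κ n) : ℝ) : EReal)) atTop <
      ((1 / 2 : ℝ) : EReal) := by
    have h1 := (continuous_coe_real_ereal.tendsto κ).comp (tendsto_log_powCeil_div hκ)
    have h2 : limsup (fun n : ℕ => ((Real.logb n (powCeil κ n) : ℝ) : EReal)) atTop =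
        (κ : EReal) := h1.limsup_eq
    rw [h2]
    exact EReal.coe_lt_coe_iff.2 hκ1
  have hlower := hPC A' (powCeil κ) hpoly (powCeil_pos κ) hlim
  have hN := tendsto_lowerN θ
  have hη : Tendsto (fun n => 24 / (lowerN θ n : ℝ) + 1 / (logFactor (lowerN θ n) + 1 : ℝ)) atTop
      (𝓝 0) := by
    have h1 : Tendsto (fun n => (lowerN θ n : ℝ)) atTop atTop :=
      tendsto_natCast_atTop_atTop.comp hN
    have h2 : Tendsto (fun n => (logFactor (lowerN θ n) + 1 : ℝ)) atTop atTop := by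
      refine tendsto_atTop_mono (fun n => ?_) (tendsto_log_natCast.comp hN)
      have := log_add_one_le_logFactor (one_le_lowerN θ n)
      simp only [Function.comp_apply]
      linarith
    simpa using ((tendsto_const_nhds (x := (24 : ℝ))).div_atTop h1).add
      ((tendsto_const_nhds (x := (1 : ℝ))).div_atTop h2)
  have hq : ∀ n, 0 ≤ bgDensity α (lowerN θ n) := fun n => (bgDensity_pos α (one_le_lowerN θ n)).le
  have hreg := pdsRegime_lower (θ := θ) hα hαγ hθ0 hκ (by linarith)
    rfl
  refine one_le_limsup_of_le_add (fun m => ?_) hlower (fun n => ?_) hη fun n => ?_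
  · refine Test.error_nonneg _ (erdosRenyi_nonneg (by norm_num) (by norm_num)) fun G => ?_
    rw [plantedClique_eq_plantedDense]
    exact plantedDense_nonneg (by norm_num) le_rfl (by norm_num) (by norm_num) G
  · have h1 := (reduction_loss_le (α := α) (γ := γ) n.succ_pos (powCeil_pos θ (n + 1))
      (powCeil_pos κ (n + 1)) (powCeil_le_self (by linarith) n.succ_pos)
      (hsq n.succ_pos)).2
    exact (hA3 n).trans (add_le_add_right h1 _)
  · have h1 := hreg.p_le_one n
    have h2 := (hreg.q_lt_p n).le
    have h3 := hq n
    exact Test.error_le_two _ (erdosRenyi_nonneg h3 (h2.trans h1))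
      (plantedDense_nonneg (h3.trans h2) h1 h3 (h2.trans h1)) (sum_erdosRenyi _ _)
      (sum_plantedDense (hreg.K_le n) _ _)

/-! ### The computational boundary -/

theorem mainTheorem1 (α β γ : ℝ) (hα : α ∈ Set.Ico (0 : ℝ) 2) (hγ : γ ∈ Set.Ico (0 : ℝ) 2)
    (hβ : β ∈ Set.Ioo (0 : ℝ) 1) (hαγ : α ≤ γ) :
    (β < 1 / 2 + γ / 2 - α / 4 →
      ∃ (N K : ℕ → ℕ) (p q : ℕ → ℝ), PDSRegime α γ β N K p q ∧
        (PCConjecture (1 / 2) →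
          ∀ φ : ∀ n, Test (N n), PolynomialTime φ → 1 ≤ asymptoticErrorPDS φ K p q)) ∧
    (1 / 2 + γ / 2 - α / 4 < β →
      ∀ (N K : ℕ → ℕ) (p q : ℕ → ℝ), PDSRegime α γ β N K p q →
        ∃ φ : ∀ n, Test (N n), PolynomialTime φ ∧ asymptoticErrorPDS φ K p q = 0) := by
  refine ⟨fun hβ' => ?_, fun hβ' N K p q h => exists_tests_of_regime hα.2 hβ.1 hβ' h⟩
  obtain ⟨ν, hν1, hs, hνβ, hν2⟩ := exists_exponent hα.1 hβ.1 hβ.2 hαγ hβ'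
  have hν0 : 0 < ν := by linarith [hβ.2]
  -- The clique exponent `κ = 1 - (1 - β) / ν` comes from `K / N = k / n` with `n ≈ N ^ ν`, that is
  -- `β - 1 = ν * (κ - 1)`.
  have hκ0 : 0 ≤ 1 - (1 - β) / ν := sub_nonneg.2 ((div_le_one hν0).2 hνβ.le)
  have hκ1 : 1 - (1 - β) / ν < 1 / 2 := by
    have : 1 / 2 < (1 - β) / ν := by
      rw [div_lt_div_iff₀ two_pos hν0]
      linarith
    linarith
  have hexp : (1 - (1 - β) / ν + (1 - ν) / ν) / (1 + (1 - ν) / ν) = β := by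
    field_simp
    ring
  exact ⟨_, _, _, _, pdsRegime_lower hα.1 hαγ (div_nonneg (by linarith) hν0.le) hκ0
    (by linarith) hexp, fun hPC φ hφ =>
      one_le_asymptoticErrorPDS hα.1 hαγ hν0 hν1 rfl hs hκ0 hκ1 hPC φ hφ⟩
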